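/- Let $R$ be a commutative ring and $\mathcal D(R)$ its derived category with the derived tensor product, with unit $R$. Let $\mathcal C,\mathcal C'$ be triangulated symmetric monoidal categories with arbitrary (small) direct sums, whose tensor products are additive and exact in each variable, and let $O\in\mathcal C$ be a $\otimes$-invertible object, with a coherent choice of powers $O^{\otimes i}$, $i\in\mathbb Z$. The orbit category $\mathcal C/_{-\otimes O}$ has the objects of $\mathcal C$ and morphisms $\operatorname{Hom}(a,b)=\bigoplus_{i\in\mathbb Z}\operatorname{Hom}_{\mathcal C}(a,b\otimes O^{\otimes i})$, where the composite of $f:a\to b\otimes O^{\otimes i}$ and $g:b\to c\otimes O^{\otimes j}$ is $(g\otimes O^{\otimes i})\circ f:a\to c\otimes O^{\otimes (j+i)}$. Let $\pi:\mathcal C\to\mathcal C/_{-\otimes O}$ be the projection (inclusion of degree $0$). In the orbit category there is a canonical isomorphism $\pi(O)\simeq\pi(\mathbf 1)$, given in degree $1$ by $O\simeq \mathbf 1\otimes O^{\otimes 1}$. A symmetric monoidal functor $\omega:\mathcal C\to\mathcal D(R)$ satisfies the conditions of Ayoub's weak Tannakian formalism if it has a right adjoint $\underline\omega$; if it is equipped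 with a symmetric monoidal functor $s:\mathcal D(R)\to\mathcal C$ having a right adjoint, and a monoidal isomorphism $\omega\circ s\simeq\mathrm{id}$; and if the coprojections $\underline\omega(M)\otimes N\to\underline\omega(M\otimes\omega(N))$ are isomorphisms for all $M\in\mathcal D(R)$, $N\in\mathcal C$. In this case $\mathcal H(\mathcal C):=\omega\underline\omega(\mathbf 1)$ has the following structure morphisms: unit and multiplication come from the lax monoidal structures of $\omega$ and $\underline\omega$; the counit is the counit of the adjunction at $\mathbf 1$; the comultiplication is the one of the comonad $\omega\underline\omega$, evaluated at $\mathbf 1$, via the isomorphisms $\mathcal H(\mathcal C)\otimes M\simeq\omega(\underline\omega(\mathbf 1)\otimes s(M))\simeq\omega\underline\omega(M)$. The same applies to $\mathcal C'$. Let $F:\mathcal C\to\mathcal C'$ and $\omega':\mathcal C'\to\mathcal D(R)$ be triangulated symmetric monoidal functors such that $\omega'$ and $\omega:=\omega'\circ F$ satisfy these conditions, with sections $s',s$ for which there is a monoidal isomorphism $F\circ s\simeq s'$ compatible with $\omega\circ s\simeq\mathrm{id}\simeq\omega'\circ s'$. Assume: (i) $\omega'$ preserves arbitrary direct sums. (ii)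 $F$ preserves arbitrary direct sums and has a right adjoint which also preserves arbitrary direct sums. (iii) $\mathcal C$ has a set $\mathcal G$ of compact generators such that $F(\mathcal G)$ is a set of generators of $\mathcal C'$. (A set of objects, closed under shifts up to isomorphism, generates if every object receiving no nonzero morphism from its members is zero.) (iv) $F$ factors through $\pi$, up to isomorphism, by an additive functor $\mathcal C/_{-\otimes O}\to\mathcal C'$ that is compatible with tensor products, and the resulting maps $\operatorname{Hom}_{\mathcal C/_{-\otimes O}}(\pi(a),\pi(b))\to\operatorname{Hom}_{\mathcal C'}(F(a),F(b))$ are bijective for all $a,b\in\mathcal G$. The factorization gives an isomorphism $F(O)\simeq F(\mathbf 1)\simeq\mathbf 1$, hence $\omega(O)\simeq R$. Let $t:R\to\mathcal H(\mathcal C)$ be the coaction $\omega(O)\to\omega\underline\omega(\omega(O))$ (the image under $\omega$ of the unit of the adjunction) with $\omega(O)$ identified with $R$. Let $\varphi:\mathcal H(\mathcal C)\to\mathcal H(\mathcal C')$ be the image under $\omega'$ of the morphism $F\underline\omega(\mathbf 1)\to\underline\omega'(\mathbf 1)$ adjoint to the counit $\omega'F\underline\omega(\mathbf 1)\to\mathbf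 1$. Then the above structure morphisms make $\mathcal H(\mathcal C)$ and $\mathcal H(\mathcal C')$ Hopf algebras in $\mathcal D(R)$, the element $t$ is group-like ($\Delta t=t\otimes t$ and $\varepsilon t=1$), $\varphi$ is a morphism of Hopf algebras, and $\varphi$ induces an isomorphism $$\mathcal H(\mathcal C)\otimes^{\mathbf L}_{R[t,t^{-1}]}R\;\simeq\;\mathcal H(\mathcal C'),$$ where $R$ is an $R[t,t^{-1}]$-algebra by $t\mapsto 1$. Explicitly, there are a K-projective complex $M$ of $R[t,t^{-1}]$-modules and isomorphisms $\mathcal H(\mathcal C)\simeq M$ and $\mathcal H(\mathcal C')\simeq M\otimes_{R[t,t^{-1}]}R$ in $\mathcal D(R)$, such that the first one carries multiplication by $t$ on $\mathcal H(\mathcal C)$ to multiplication by $t$ on $M$, and the two carry $\varphi$ to the canonical morphism $m\mapsto m\otimes 1$. -/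

import Mathlib

open CategoryTheory MonoidalCategory Limits Category

universe w v u u₁ u₂ u₃ v₁ v₂ v₃

noncomputable section

namespace ComplexTensor
open GradedObject GradedObject.Monoidal
variable {R : Type w} [CommRing R]

lemma comp_units_smul {X Y Z : ModuleCat.{w} R} (f : X ⟶ Y) (e : ℤˣ) (g : Y ⟶ Z) :
    f ≫ (e • g) = e • (f ≫ g) := by
  rcases Int.units_eq_one_or e with rfl | rfl <;> simp

lemma units_smul_comp {X Y Z : ModuleCat.{w} R} (f : X ⟶ Y) (e : ℤˣ) (g : Y ⟶ Z) :
    (e • f) ≫ g = e • (f ≫ g) := by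
  rcases Int.units_eq_one_or e with rfl | rfl <;> simp

lemma units_smul_whiskerRight {X Y : ModuleCat.{w} R} (f : X ⟶ Y) (e : ℤˣ) (Z : ModuleCat.{w} R) :
    (e • f) ▷ Z = e • (f ▷ Z) := by
  rcases Int.units_eq_one_or e with rfl | rfl
  · simp
  · rw [Units.neg_smul, one_smul, Units.neg_smul, one_smul]; exact (tensorRight Z).map_neg

lemma whiskerLeft_units_smul {X Y : ModuleCat.{w} R} (f : X ⟶ Y) (e : ℤˣ) (Z : ModuleCat.{w} R) :
    Z ◁ (e • f) = e • (Z ◁ f) := by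
  rcases Int.units_eq_one_or e with rfl | rfl
  · simp
  · rw [Units.neg_smul, one_smul, Units.neg_smul, one_smul]; exact (tensorLeft Z).map_neg

/-- The symmetry of the tensor product of graded modules, with the Koszul sign `(-1)^(ij)`. -/
def swap (X Y : GradedObject ℤ (ModuleCat.{w} R)) :
    GradedObject.Monoidal.tensorObj X Y ⟶ GradedObject.Monoidal.tensorObj Y X :=
  fun k => tensorObjDesc (fun i j hij => (i * j).negOnePow • ((β_ (X i) (Y j)).hom ≫
    ιTensorObj Y X j i k (by simpa only [add_comm j i] using hij)))

lemma ι_swap (X Y : GradedObject ℤ (ModuleCat.{w} R)) (i j k : ℤ) (h : i + j = k) :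
    ιTensorObj X Y i j k h ≫ swap X Y k = (i * j).negOnePow • ((β_ (X i) (Y j)).hom ≫
    ιTensorObj Y X j i k (by simpa only [add_comm j i] using h)) := by
  simp [swap]

lemma swap_swap (X Y : GradedObject ℤ (ModuleCat.{w} R)) : swap X Y ≫ swap Y X = 𝟙 _ := by
  ext1 k
  apply tensorObj_ext
  intro i j h
  change _ ≫ swap X Y k ≫ swap Y X k = _ ≫ 𝟙 _
  rw [reassoc_of% ι_swap, units_smul_comp, assoc, ι_swap, comp_units_smul, smul_smul, mul_comm j i,
    Int.units_mul_self, one_smul, SymmetricCategory.symmetry_assoc, comp_id]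

lemma swap_nat {X X' Y Y' : GradedObject ℤ (ModuleCat.{w} R)} (f : X ⟶ X') (g : Y ⟶ Y') :
    GradedObject.Monoidal.tensorHom f g ≫ swap X' Y' = swap X Y ≫ GradedObject.Monoidal.tensorHom g f := by
  ext1 k
  apply tensorObj_ext
  intro i j h
  change _ ≫ GradedObject.Monoidal.tensorHom f g k ≫ swap X' Y' k = _ ≫ swap X Y k ≫ GradedObject.Monoidal.tensorHom g f k
  rw [ι_tensorHom_assoc, ι_swap, reassoc_of% ι_swap, units_smul_comp, comp_units_smul, assoc, ι_tensorHom,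
    BraidedCategory.braiding_naturality_assoc]

lemma hexagon (X Y Z : GradedObject ℤ (ModuleCat.{w} R)) :
    (GradedObject.Monoidal.associator X Y Z).hom ≫ swap X (GradedObject.Monoidal.tensorObj Y Z) ≫ (GradedObject.Monoidal.associator Y Z X).hom =
      GradedObject.Monoidal.whiskerRight (swap X Y) Z ≫ (GradedObject.Monoidal.associator Y X Z).hom ≫
        GradedObject.Monoidal.whiskerLeft Y (swap X Z) := by
  ext1 k
  apply tensorObj₃'_ext
  intro i₁ i₂ i₃ h
  change _ ≫ (GradedObject.Monoidal.associator X Y Z).hom k ≫ swap X (GradedObject.Monoidal.tensorObj Y Z) k ≫ (GradedObject.Monoidal.associator Y Z X).hom k =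
    _ ≫ GradedObject.Monoidal.whiskerRight (swap X Y) Z k ≫ (GradedObject.Monoidal.associator Y X Z).hom k ≫
        GradedObject.Monoidal.whiskerLeft Y (swap X Z) k
  rw [ιTensorObj₃'_associator_hom_assoc, ιTensorObj₃_eq X Y Z i₁ i₂ i₃ k h _ rfl,
    assoc, reassoc_of% ι_swap, units_smul_comp, comp_units_smul, assoc, ← MonoidalCategory.id_tensorHom,
    BraidedCategory.braiding_naturality_assoc,
    BraidedCategory.braiding_tensor_right_hom, assoc, assoc, assoc, assoc, comp_units_smul, Iso.hom_inv_id_assoc,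
    MonoidalCategory.tensorHom_id,
    ← ιTensorObj₃'_eq_assoc Y Z X i₂ i₃ i₁ k (by rw [add_comm _ i₁, ← add_assoc, h]) _ rfl,
    ιTensorObj₃'_associator_hom, Iso.inv_hom_id_assoc]
  rw [ιTensorObj₃'_eq X Y Z i₁ i₂ i₃ k h _ rfl, assoc, ι_tensorHom_assoc,
    categoryOfGradedObjects_id, MonoidalCategory.tensorHom_id, ← comp_whiskerRight_assoc, ι_swap,
    units_smul_whiskerRight, units_smul_comp, comp_whiskerRight, assoc,
    ← ιTensorObj₃'_eq_assoc Y X Z i₂ i₁ i₃ k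
      (by rw [add_comm i₂ i₁, h]) (i₁ + i₂) (add_comm i₂ i₁),
    ιTensorObj₃'_associator_hom_assoc,
    ιTensorObj₃_eq Y X Z i₂ i₁ i₃ k (by rw [add_comm i₂ i₁, h]) _ rfl, assoc,
    ι_tensorHom, categoryOfGradedObjects_id, MonoidalCategory.id_tensorHom,
    ← MonoidalCategory.whiskerLeft_comp_assoc, ι_swap, whiskerLeft_units_smul,
    units_smul_comp, comp_units_smul, comp_units_smul, smul_smul,
    MonoidalCategory.whiskerLeft_comp, assoc,
    ← ιTensorObj₃_eq Y Z X i₂ i₃ i₁ k (by rw [add_comm _ i₁, ← add_assoc, h])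
      (i₁ + i₃) (add_comm _ _), mul_add, Int.negOnePow_add]



section
variable (K L : CochainComplex (ModuleCat.{w} R) ℤ)

/-- The inclusion of the summand `K^p ⊗ L^q` in the degree `p + q` of `K ⊗ L`. -/
def ι (p q n : ℤ) (h : p + q = n) : K.X p ⊗ L.X q ⟶ (K ⊗ L).X n :=
  HomologicalComplex.ιTensorObj K L p q n h

variable {K L} in
lemma hom_ext {A : ModuleCat.{w} R} {n : ℤ} {f g : (K ⊗ L).X n ⟶ A}
    (H : ∀ p q h, ι K L p q n h ≫ f = ι K L p q n h ≫ g) : f = g :=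
  tensorObj_ext (X₁ := K.X) (X₂ := L.X) f g H

open HomologicalComplex in
lemma ι_d (p q n p' q' n' : ℤ) (h : p + q = n) (hp : p + 1 = p') (hq : q + 1 = q') (hn : n + 1 = n') :
    ι K L p q n h ≫ (K ⊗ L).d n n' =
      (K.d p p' ▷ L.X q) ≫ ι K L p' q n' (by lia) +
      p.negOnePow • ((K.X p ◁ L.d q q') ≫ ι K L p q' n' (by lia)) := by
  subst hp hq hn
  have hp : (ComplexShape.up ℤ).Rel p (p+1) := rfl
  have hq : (ComplexShape.up ℤ).Rel q (q+1) := rfl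
  change ιMapBifunctor K L (curriedTensor _) _ p q n h ≫ (mapBifunctor K L (curriedTensor _) _).d n (n+1) = _
  rw [mapBifunctor.d_eq, Preadditive.comp_add, 
    mapBifunctor.ι_D₁, mapBifunctor.ι_D₂, 
    mapBifunctor.d₁_eq _ _ _ _ hp _ _ (by change p + 1 + q = _; lia),
    mapBifunctor.d₂_eq _ _ _ _ _ hq _ (by change p + (q + 1) = _; lia)]
  change (1 : ℤˣ) • _ + _ = _
  rw [one_smul]
  rfl

/-- The symmetry of the tensor product of complexes in degree `n`. -/
def swapX (n : ℤ) : (K ⊗ L).X n ⟶ (L ⊗ K).X n := swap K.X L.X n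

lemma ι_swapX (p q n : ℤ) (h : p + q = n) :
    ι K L p q n h ≫ swapX K L n = (p * q).negOnePow • ((β_ (K.X p) (L.X q)).hom ≫
      ι L K q p n (by lia)) := ι_swap K.X L.X p q n h

lemma swapX_d (n n' : ℤ) (hn : n + 1 = n') :
    swapX K L n ≫ (L ⊗ K).d n n' = (K ⊗ L).d n n' ≫ swapX K L n' := by
  apply hom_ext
  intro p q h
  rw [reassoc_of% ι_swapX, units_smul_comp, assoc, ι_d L K q p n _ _ n' (by lia) rfl rfl hn,
    reassoc_of% (ι_d K L p q n _ _ n' (by lia) rfl rfl hn), Preadditive.add_comp, Preadditive.comp_add, assoc,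
    units_smul_comp, assoc, ι_swapX, ι_swapX, comp_units_smul, comp_units_smul, comp_units_smul,
    BraidedCategory.braiding_naturality_left_assoc, BraidedCategory.braiding_naturality_right_assoc,
    smul_add, smul_smul, smul_smul, add_comm]
  congr 2
  · rw [add_mul, one_mul, Int.negOnePow_add]
  · rw [mul_add, mul_one, Int.negOnePow_add, mul_comm p q, mul_comm (q * p).negOnePow, ← mul_assoc,
      Int.units_mul_self, one_mul]


/-- The symmetry `x ⊗ y ↦ (-1)^(pq) y ⊗ x` of the tensor product of complexes. -/
def braiding : K ⊗ L ≅ L ⊗ K where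
  hom := { f := swapX K L, comm' := fun i j h => swapX_d K L i j h }
  inv := { f := swapX L K, comm' := fun i j h => swapX_d L K i j h }
  hom_inv_id := by
    ext1 n
    exact congrFun (swap_swap K.X L.X) n
  inv_hom_id := by
    ext1 n
    exact congrFun (swap_swap L.X K.X) n

end

lemma reverse_of_forward {C : Type*} [Category C] [MonoidalCategory C]
    (b : ∀ X Y : C, X ⊗ Y ≅ Y ⊗ X) (hb : ∀ X Y, (b X Y).hom ≫ (b Y X).hom = 𝟙 _)
    (H : ∀ X Y Z, (α_ X Y Z).hom ≫ (b X (Y ⊗ Z)).hom ≫ (α_ Y Z X).hom =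
      ((b X Y).hom ▷ Z) ≫ (α_ Y X Z).hom ≫ (Y ◁ (b X Z).hom)) (X Y Z : C) :
    (α_ X Y Z).inv ≫ (b (X ⊗ Y) Z).hom ≫ (α_ Z X Y).inv =
      (X ◁ (b Y Z).hom) ≫ (α_ X Z Y).inv ≫ ((b X Z).hom ▷ Y) := by
  have hb' : ∀ X Y, (b X Y).inv = (b Y X).hom := fun X Y => by
    rw [← cancel_epi (b X Y).hom, Iso.hom_inv_id, hb]
  have h := congrArg Iso.inv (a₁ := α_ Z X Y ≪≫ b Z (X ⊗ Y) ≪≫ α_ X Y Z)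
    (a₂ := whiskerRightIso (b Z X) Y ≪≫ α_ X Z Y ≪≫ whiskerLeftIso X (b Z Y)) (by
      ext
      exact H Z X Y)
  simpa [hb'] using h

/-- Cochain complexes of `R`-modules with the tensor product of complexes
(`d (x ⊗ y) = d x ⊗ y + (-1)^p x ⊗ d y`) and the Koszul symmetry. -/
instance : SymmetricCategory (CochainComplex (ModuleCat.{w} R) ℤ) where
  braiding := braiding
  braiding_naturality_left f Z := by
    ext1 n
    exact congrFun (swap_nat f.f (𝟙 Z.X)) n
  braiding_naturality_right Z _ _ f := by
    ext1 n
    exact congrFun (swap_nat (𝟙 Z.X) f.f) n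
  hexagon_forward X Y Z := by
    ext1 n
    exact congrFun (hexagon X.X Y.X Z.X) n
  hexagon_reverse := reverse_of_forward _ (fun K L => by
    ext1 n
    exact congrFun (swap_swap K.X L.X) n) (fun X Y Z => by
    ext1 n
    exact congrFun (hexagon X.X Y.X Z.X) n)
  symmetry K L := by
    ext1 n
    exact congrFun (swap_swap K.X L.X) n

open HomologicalComplex in
instance : (homotopyEquivalences (ModuleCat.{w} R) (.up ℤ)).IsMonoidal where
  whiskerLeft X Y₁ Y₂ g hg := by
    obtain ⟨e, rfl⟩ := hg
    exact ⟨{ hom := X ◁ e.hom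
             inv := X ◁ e.inv
             homotopyHomInvId := (Homotopy.ofEq (MonoidalCategory.whiskerLeft_comp _ _ _).symm).trans ((mapBifunctorMapHomotopy₂ (𝟙 X) e.homotopyHomInvId (curriedTensor _) _).trans (Homotopy.ofEq (MonoidalCategory.whiskerLeft_id X _)))
             homotopyInvHomId := (Homotopy.ofEq (MonoidalCategory.whiskerLeft_comp _ _ _).symm).trans ((mapBifunctorMapHomotopy₂ (𝟙 X) e.homotopyInvHomId (curriedTensor _) _).trans (Homotopy.ofEq (MonoidalCategory.whiskerLeft_id X _))) }, rfl⟩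
  whiskerRight f hf Y := by
    obtain ⟨e, rfl⟩ := hf
    exact ⟨{ hom := e.hom ▷ Y
             inv := e.inv ▷ Y
             homotopyHomInvId := (Homotopy.ofEq (comp_whiskerRight _ _ _).symm).trans ((mapBifunctorMapHomotopy₁ e.homotopyHomInvId (𝟙 Y) (curriedTensor _) _).trans (Homotopy.ofEq (id_whiskerRight _ Y)))
             homotopyInvHomId := (Homotopy.ofEq (comp_whiskerRight _ _ _).symm).trans ((mapBifunctorMapHomotopy₁ e.homotopyInvHomId (𝟙 Y) (curriedTensor _) _).trans (Homotopy.ofEq (id_whiskerRight _ Y))) }, rfl⟩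

/-- The homotopy category of complexes of `R`-modules, with the tensor product
induced by the tensor product of complexes. -/
abbrev KR (R : Type w) [CommRing R] :=
  LocalizedMonoidal (HomotopyCategory.quotient (ModuleCat.{w} R) (.up ℤ))
    (HomologicalComplex.homotopyEquivalences (ModuleCat.{w} R) (.up ℤ)) (Iso.refl _)
instance : MonoidalCategory (HomotopyCategory (ModuleCat.{w} R) (.up ℤ)) := inferInstanceAs (MonoidalCategory (KR R))
instance : SymmetricCategory (HomotopyCategory (ModuleCat.{w} R) (.up ℤ)) := inferInstanceAs (SymmetricCategory (KR R))
instance : (HomotopyCategory.quotient (ModuleCat.{w} R) (.up ℤ)).Monoidal :=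
  inferInstanceAs (Localization.Monoidal.toMonoidalCategory (HomotopyCategory.quotient (ModuleCat.{w} R) (.up ℤ))
    (HomologicalComplex.homotopyEquivalences (ModuleCat.{w} R) (.up ℤ)) (Iso.refl _)).Monoidal

section KProj
open CochainComplex.HomComplex TensorProduct
variable (K L A : CochainComplex (ModuleCat.{w} R) ℤ)

/-- The complex of morphisms from `L` to `A`. -/
def ihom : CochainComplex (ModuleCat.{w} R) ℤ where
  X n := ModuleCat.of R (Cochain L A n)
  d n m := ModuleCat.ofHom (δ_hom R L A n m)
  shape n m h := by
    apply ModuleCat.hom_ext; apply LinearMap.ext; intro z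
    exact δ_shape n m h z
  d_comp_d' n m p _ _ := by
    apply ModuleCat.hom_ext; apply LinearMap.ext; intro z
    exact δ_δ n m p z

variable {L A} in
/-- A cochain evaluated in a given degree, as a linear map. -/
def ev (n p q : ℤ) (h : p + n = q) : Cochain L A n →ₗ[R] (L.X p →ₗ[R] A.X q) where
  toFun z := (z.v p q h).hom
  map_add' _ _ := rfl
  map_smul' _ _ := rfl

variable {K L A} in
/-- The map `k ↦ (l ↦ f (k ⊗ l))`. -/
def adj (f : K ⊗ L ⟶ A) (n : ℤ) : K.X n →ₗ[R] Cochain L A n where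
  toFun k := Cochain.mk (fun p q h => ModuleCat.ofHom
    ((f.f q).hom ∘ₗ (ι K L n p q (by lia)).hom ∘ₗ TensorProduct.mk R (K.X n) (L.X p) k))
  map_add' x y := by
    ext p q h l
    simp
  map_smul' x y := by
    ext p q h l
    change (f.f q).hom ((ι K L n p q (by lia)).hom ((x • y) ⊗ₜ l)) = x • (f.f q).hom ((ι K L n p q (by lia)).hom (y ⊗ₜ l))
    rw [← TensorProduct.smul_tmul', map_smul, map_smul]

lemma δ_apply {n m : ℤ} (hnm : n + 1 = m) (z : Cochain L A n) (p q : ℤ) (hpq : p + m = q) (q₁ q₂ : ℤ)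
    (hq₁ : q₁ = q - 1) (hq₂ : p + 1 = q₂) (l : L.X p) : ((δ n m z).v p q hpq).hom l =
    (A.d q₁ q).hom ((z.v p q₁ (by lia)).hom l) + m.negOnePow • (z.v q₂ q (by lia)).hom ((L.d p q₂).hom l) := by
  rw [δ_v n m hnm z p q hpq q₁ q₂ hq₁ hq₂]
  rcases Int.units_eq_one_or m.negOnePow with h | h <;> simp [h]

lemma d_ι_apply (p q n p' q' n' : ℤ) (h : p + q = n) (hp : p + 1 = p') (hq : q + 1 = q') (hn : n + 1 = n')
    (k : K.X p) (l : L.X q) : ((K ⊗ L).d n n').hom ((ι K L p q n h).hom (k ⊗ₜ l)) =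
     (ι K L p' q n' (by lia)).hom ((K.d p p').hom k ⊗ₜ l) +
      p.negOnePow • (ι K L p q' n' (by lia)).hom (k ⊗ₜ (L.d q q').hom l) := by
  have := congrArg (fun g => g.hom (k ⊗ₜ[R] l)) (ι_d K L p q n p' q' n' h hp hq hn)
  refine this.trans ?_
  rcases Int.units_eq_one_or p.negOnePow with h | h <;> simp [h]

variable {K L A} in
/-- A morphism `K ⊗ L ⟶ A` as a morphism from `K` to the complex of morphisms from `L` to `A`. -/
def adjHom (f : K ⊗ L ⟶ A) : K ⟶ ihom L A where
  f n := ModuleCat.ofHom (adj f n)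
  comm' n m hnm := by
    change n + 1 = m at hnm
    ext k
    change δ n m (adj f n k) = adj f m ((K.d n m).hom k)
    ext p q hpq l
    rw [δ_apply _ _ hnm _ p q hpq (q - 1) _ rfl rfl]
    change (A.d (q-1) q).hom ((f.f (q-1)).hom ((ι K L n p (q-1) (by lia)).hom (k ⊗ₜ l))) +
      m.negOnePow • ((f.f q).hom ((ι K L n (p+1) q (by lia)).hom (k ⊗ₜ (L.d p (p+1)).hom l))) =
      (f.f q).hom ((ι K L m p q (by lia)).hom ((K.d n m).hom k ⊗ₜ l))
    have hf := congrArg (fun g => g.hom ((ι K L n p (q-1) (by lia)).hom (k ⊗ₜ[R] l))) (f.comm (q-1) q)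
    change (A.d (q-1) q).hom ((f.f (q-1)).hom _) = (f.f q).hom (((K ⊗ L).d (q-1) q).hom _) at hf
    rw [hf, d_ι_apply K L n p (q-1) m (p+1) q (by lia) hnm rfl (by lia), map_add, show m.negOnePow = -n.negOnePow by rw [← hnm, Int.negOnePow_succ]]
    rcases Int.units_eq_one_or n.negOnePow with h | h <;> simp [h]

variable {L A} in
lemma ihom_acyclic [hL : L.IsKProjective] (hA : A.Acyclic) : (ihom L A).Acyclic := by
  intro n
  rw [HomologicalComplex.exactAt_iff' _ (n-1) n (n+1) (by simp) (by simp),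
    ShortComplex.moduleCat_exact_iff]
  intro z hz
  change δ n (n+1) z = 0 at hz
  have hA' : (HomotopyCategory.subcategoryAcyclic (ModuleCat.{w} R)) ((HomotopyCategory.quotient _ _).obj (A⟦n⟧)) :=
    ObjectProperty.prop_of_iso _
      (((HomotopyCategory.quotient _ (.up ℤ)).commShiftIso n).symm.app A)
      ((HomotopyCategory.subcategoryAcyclic _).le_shift n _
        ((HomotopyCategory.quotient_obj_mem_subcategoryAcyclic_iff_acyclic A).2 hA))
  have h := (CohomologyClass.toHom_mk_eq_zero_iff (Cocycle.mk z (n+1) rfl hz)).1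
    (CochainComplex.IsKProjective.leftOrthogonal L _ hA')
  rw [mem_coboundaries_iff _ (n-1) (by simp)] at h
  exact h

variable {K L A} in
/-- The value on an element of a homotopy with target the complex of cochains. -/
def hval {f : K ⟶ ihom L A} (h : Homotopy f 0) (i m : ℤ) (k : K.X i) : Cochain L A m :=
  (h.hom i m).hom k

variable {K L A} in
lemma hval_eq (f : K ⊗ L ⟶ A) (h : Homotopy (adjHom f) 0) (i j n a b : ℤ) (ha : a + 1 = i)
    (hb : i + 1 = b) (hij : i + j = n) (e1 : j + i = n) (k : K.X i) (l : L.X j) :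
    (f.f n).hom ((ι K L i j n hij).hom (k ⊗ₜ l)) =
      ((hval h b i ((K.d i b).hom k)).v j n e1).hom l +
        ((δ a i (hval h i a k)).v j n e1).hom l := by
  have hm := h.comm i
  rw [dNext_eq _ (show (ComplexShape.up ℤ).Rel i b from hb),
    prevD_eq _ (show (ComplexShape.up ℤ).Rel a i from ha)] at hm
  have h1 := congrArg (fun g => (Cochain.v (g.hom k : Cochain L A i) j n e1).hom l) hm
  exact h1.trans (add_zero _)

variable {K L A} in
lemma homotopy_aux (f : K ⊗ L ⟶ A) (h : Homotopy (adjHom f) 0) (H : Cochain (K ⊗ L) A (-1))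
    (hH : ∀ (i j n q m : ℤ) (hij : i + j = n) (hnq : n + -1 = q) (hm : m + 1 = i)
      (k : K.X i) (l : L.X j),
        (H.v n q hnq).hom ((ι K L i j n hij).hom (k ⊗ₜ l)) =
          ((hval h i m k).v j q (by lia)).hom l)
    (i j n a b c e : ℤ) (ha : a + 1 = i) (hb : i + 1 = b) (hc : c + 1 = n) (he : n + 1 = e)
    (hij : i + j = n) (k : K.X i) (l : L.X j) :
    (f.f n).hom ((ι K L i j n hij).hom (k ⊗ₜ l)) =
      ((δ (-1) 0 H).v n n (add_zero n)).hom ((ι K L i j n hij).hom (k ⊗ₜ l)) := by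
  have e1 : j + i = n := (add_comm j i).trans hij
  have e2 : c = n - 1 := by omega
  have e3 : n + (-1) = c := by omega
  have e4 : b + j = e := by omega
  have e5 : e + (-1) = n := by omega
  have e6 : i + (j + 1) = e := by omega
  rw [hval_eq f h i j n a b ha hb hij e1 k l, δ_apply L A ha _ j n e1 c (j+1) e2 rfl,
    δ_apply (K ⊗ L) A (n := -1) (m := 0) (neg_add_cancel 1) H n n (add_zero n) c e e2 he,
    hH i j n c a hij e3 ha,
    d_ι_apply K L i j n b (j+1) e hij hb rfl he, map_add,
    hH b j e n i e4 e5 hb, Int.negOnePow_zero, one_smul]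
  rcases Int.units_eq_one_or i.negOnePow with h | h <;>
    simp only [h, one_smul, Units.neg_smul, map_neg, hH i (j + 1) e n a e6 e5 ha] <;> abel

/-- The tensor product of two K-projective complexes is K-projective. -/
instance [K.IsKProjective] [L.IsKProjective] : (K ⊗ L).IsKProjective where
  nonempty_homotopy_zero {A} f hA := by
    obtain ⟨h⟩ := CochainComplex.IsKProjective.nonempty_homotopy_zero (adjHom f)
      (ihom_acyclic (L := L) hA)
    let H : Cochain (K ⊗ L) A (-1) := Cochain.mk (fun n q hnq =>
      GradedObject.Monoidal.tensorObjDesc (X₁ := K.X) (X₂ := L.X) (k := n) (fun i j hij =>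
        ModuleCat.ofHom (TensorProduct.lift
          ((ev (i-1) j q (by lia)).comp (h.hom i (i-1)).hom))))
    have hH (i j n q m : ℤ) (hij : i + j = n) (hnq : n + -1 = q) (hm : m + 1 = i)
        (k : K.X i) (l : L.X j) :
        (H.v n q hnq).hom ((ι K L i j n hij).hom (k ⊗ₜ l)) =
          ((hval h i m k).v j q (by lia)).hom l := by
      obtain rfl : m = i - 1 := by lia
      have : ι K L i j n hij ≫ H.v n q hnq = ModuleCat.ofHom (TensorProduct.lift
          ((ev (i-1) j q (by lia)).comp (h.hom i (i-1)).hom)) :=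
        GradedObject.Monoidal.ι_tensorObjDesc (X₁ := K.X) (X₂ := L.X) (k := n) _ i j hij
      exact congrArg (fun g => g.hom (k ⊗ₜ[R] l)) this
    refine ⟨(Cochain.equivHomotopy f 0).symm ⟨H, ?_⟩⟩
    rw [Cochain.ofHom_zero, add_zero]
    apply Cochain.ext₀
    intro n
    rw [Cochain.ofHom_v]
    apply hom_ext
    intro i j hij
    apply ModuleCat.hom_ext
    apply TensorProduct.ext'
    intro k l
    exact homotopy_aux f h H hH i j n (i-1) _ (n-1) _ (by simp) rfl (by simp) rfl hij k l
end KProj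

variable (R) in
/-- K-projective complexes (left orthogonal to the acyclic ones) in the homotopy category. -/
abbrev kproj : ObjectProperty (HomotopyCategory (ModuleCat.{w} R) (.up ℤ)) :=
  (HomotopyCategory.subcategoryAcyclic (ModuleCat.{w} R)).leftOrthogonal
 
lemma kproj_iff (K : CochainComplex (ModuleCat.{w} R) ℤ) :
    kproj R ((HomotopyCategory.quotient _ _).obj K) ↔ K.IsKProjective :=
  (CochainComplex.isKProjective_iff_leftOrthogonal K).symm

lemma tensorUnit_eq : 𝟙_ (CochainComplex (ModuleCat.{w} R) ℤ) = (HomologicalComplex.single (ModuleCat.{w} R) (.up ℤ) 0).obj (𝟙_ (ModuleCat.{w} R)) := rfl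

instance : (𝟙_ (CochainComplex (ModuleCat.{w} R) ℤ)).IsKProjective := by
  have (n : ℤ) : Projective ((𝟙_ (CochainComplex (ModuleCat.{w} R) ℤ)).X n) := by
    by_cases h : n = 0
    · subst h
      exact Projective.of_iso (HomologicalComplex.singleObjXSelf (.up ℤ) 0 (𝟙_ (ModuleCat.{w} R))).symm
        ((IsProjective.iff_projective R).1 inferInstance : Projective (ModuleCat.of R R))
    · exact (HomologicalComplex.isZero_single_obj_X (.up ℤ) 0 _ n h).projective
  have : (𝟙_ (CochainComplex (ModuleCat.{w} R) ℤ)).IsStrictlyLE 0 := by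
    change CochainComplex.IsStrictlyLE ((CochainComplex.singleFunctor (ModuleCat.{w} R) 0).obj
      (𝟙_ (ModuleCat.{w} R))) 0
    infer_instance
  exact CochainComplex.isKProjective_of_projective _ 0

instance : (kproj R).IsMonoidal where
  prop_unit := ObjectProperty.prop_of_iso _ (Functor.Monoidal.εIso (HomotopyCategory.quotient (ModuleCat.{w} R) (.up ℤ))).symm
    ((kproj_iff _).2 inferInstance)
  prop_tensor K L hK hL := by
    obtain ⟨K, rfl⟩ := HomotopyCategory.quotient_obj_surjective K
    obtain ⟨L, rfl⟩ := HomotopyCategory.quotient_obj_surjective L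
    rw [kproj_iff] at hK hL
    exact ObjectProperty.prop_of_iso _ (Functor.Monoidal.μIso (HomotopyCategory.quotient (ModuleCat.{w} R) (.up ℤ)) K L).symm
      ((kproj_iff _).2 inferInstance)
variable (R) in
/-- The derived category `D(R)` of the commutative ring `R`, as the full subcategory of the homotopy
category on the K-projective complexes. It is triangulated as such a subcategory, and symmetric
monoidal with the tensor product of complexes, which on K-projective complexes is the derived
tensor product. -/
abbrev DR := (kproj R).FullSubcategory


end ComplexTensor

namespace WeakTannaka

/-- A coherent family of powers `O^i`, `i ∈ ℤ`, of an object `O` for the tensor product: a strong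
monoidal functor from the discrete monoidal category `ℤ`, with `O^1` identified with `O`. It exists
if and only if `O` is invertible for the tensor product (see `TensorPowers.nonempty` and
`TensorPowers.tensorInvertible`). -/
structure TensorPowers {C : Type u} [Category.{v} C] [MonoidalCategory C] (O : C) where
  obj : ℤ → C
  one : 𝟙_ C ≅ obj 0
  gen : O ≅ obj 1
  mul (j i : ℤ) : obj j ⊗ obj i ≅ obj (j + i)
  mul_assoc (k j i : ℤ) : (α_ _ _ _).hom ≫ obj k ◁ (mul j i).hom ≫ (mul k (j + i)).hom =
    (mul k j).hom ▷ obj i ≫ (mul (k + j) i).hom ≫ eqToHom (congrArg obj (add_assoc k j i))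
  one_mul (i : ℤ) : one.hom ▷ obj i ≫ (mul 0 i).hom ≫ eqToHom (congrArg obj (zero_add i)) =
    (λ_ _).hom
  mul_one (i : ℤ) : obj i ◁ one.hom ≫ (mul i 0).hom ≫ eqToHom (congrArg obj (add_zero i)) =
    (ρ_ _).hom

namespace TensorPowers
variable {C : Type u} [Category.{v} C] [MonoidalCategory C] {O : C} (P : TensorPowers O)

/-- The identification of two powers with equal exponents. -/
def cast {i j : ℤ} (h : i = j) : P.obj i ⟶ P.obj j := eqToHom (congrArg P.obj h)

@[simp] lemma cast_rfl (i : ℤ) : P.cast (rfl : i = i) = 𝟙 _ := rfl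

@[simp]
lemma cast_trans {i j k : ℤ} (h : i = j) (h' : j = k) :
  P.cast h ≫ P.cast h' = P.cast (h.trans h') := by
  subst h h'; simp

lemma cast_mul {i i' j j' : ℤ} (hi : i = i') (hj : j = j') :
    (P.cast hi ⊗ₘ P.cast hj) ≫ (P.mul i' j').hom = (P.mul i j).hom ≫ P.cast (by rw [hi, hj]) := by
  subst hi hj; simp

lemma cast_whiskerRight_mul {i i' : ℤ} (hi : i = i') (j : ℤ) :
    P.cast hi ▷ P.obj j ≫ (P.mul i' j).hom = (P.mul i j).hom ≫ P.cast (by rw [hi]) := by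
  subst hi; simp

lemma whiskerLeft_cast_mul {i i' : ℤ} (hi : i = i') (j : ℤ) :
    P.obj j ◁ P.cast hi ≫ (P.mul j i').hom = (P.mul j i).hom ≫ P.cast (by rw [hi]) := by
  subst hi; simp

lemma mul_assoc' (k j i : ℤ) : (α_ _ _ _).hom ≫ P.obj k ◁ (P.mul j i).hom ≫ (P.mul k (j + i)).hom =
    (P.mul k j).hom ▷ P.obj i ≫ (P.mul (k + j) i).hom ≫ P.cast (add_assoc k j i) := P.mul_assoc k j i

lemma one_mul' (i : ℤ) : P.one.hom ▷ P.obj i ≫ (P.mul 0 i).hom ≫ P.cast (zero_add i) = (λ_ _).hom :=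
  P.one_mul i

lemma mul_one' (i : ℤ) : P.obj i ◁ P.one.hom ≫ (P.mul i 0).hom ≫ P.cast (add_zero i) = (ρ_ _).hom :=
  P.mul_one i
end TensorPowers

/-- The objects of the orbit category of `C` with respect to `- ⊗ O` are the objects of `C`. -/
@[ext]
structure Orbit {C : Type u} [Category.{v} C] [MonoidalCategory C] {O : C} (P : TensorPowers O) where
  as : C

namespace Orbit
variable {C : Type u} [Category.{v} C] [MonoidalCategory C] [Preadditive C] [MonoidalPreadditive C]
 {O : C} (P : TensorPowers O)

/-- The morphisms of the orbit category: `⨁ i, Hom (a, b ⊗ O^i)`. -/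
abbrev Hom (a b : C) := DirectSum ℤ (fun i => a ⟶ b ⊗ P.obj i)

/-- The inclusion of the summand of index `i`. -/
abbrev single (a b : C) (i : ℤ) : (a ⟶ b ⊗ P.obj i) →+ Hom P a b :=
  DirectSum.of (fun i => a ⟶ b ⊗ P.obj i) i

/-- The composite `a ⟶ b ⊗ O^i ⟶ (c ⊗ O^j) ⊗ O^i ⟶ c ⊗ O^(j + i)`. -/
def compHom {a b c : C} (i j : ℤ) (f : a ⟶ b ⊗ P.obj i) (g : b ⟶ c ⊗ P.obj j) : a ⟶ c ⊗ P.obj (j + i) :=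
  f ≫ g ▷ P.obj i ≫ (α_ _ _ _).hom ≫ c ◁ (P.mul j i).hom

/-- The composition of the orbit category, extended biadditively. -/
def comp (a b c : C) : Hom P a b →+ Hom P b c →+ Hom P a c :=
  DirectSum.toAddMonoid fun i => AddMonoidHom.flip (DirectSum.toAddMonoid fun j =>
    AddMonoidHom.mk' (fun g => AddMonoidHom.mk' (fun f => single P a c (j + i) (compHom P i j f g))
      (by intro f f'; simp [compHom]))
      (by intro g g'; ext f : 1; simp [compHom]))

@[simp]
lemma comp_single {a b c : C} (i j : ℤ) (f : a ⟶ b ⊗ P.obj i) (g : b ⟶ c ⊗ P.obj j) :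
    comp P a b c (single P a b i f) (single P b c j g) = single P a c (j + i) (compHom P i j f g) := by
  simp only [comp, DirectSum.toAddMonoid_of, AddMonoidHom.flip_apply, AddMonoidHom.mk'_apply]
  rfl

/-- A morphism of `C` as a morphism of degree zero. -/
def pure {a b : C} (f : a ⟶ b) : a ⟶ b ⊗ P.obj 0 := f ≫ (ρ_ b).inv ≫ b ◁ P.one.hom

lemma single_cast {a b : C} {i j : ℤ} (h : i = j) (f : a ⟶ b ⊗ P.obj i) :
    single P a b j (f ≫ b ◁ P.cast h) = single P a b i f := by
  subst h
  simp

lemma unit_aux (c : C) (i : ℤ) : (ρ_ c).inv ▷ P.obj i ≫ (c ◁ P.one.hom) ▷ P.obj i ≫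
    (α_ c (P.obj 0) (P.obj i)).hom ≫ c ◁ ((P.mul 0 i).hom ≫ P.cast (zero_add i)) = 𝟙 _ := by
  have h := P.one_mul' i
  have h' : (ρ_ c).inv ▷ P.obj i ≫ (α_ _ _ _).hom ≫
        c ◁ (P.one.hom ▷ P.obj i ≫ (P.mul 0 i).hom ≫ P.cast (zero_add i)) = 𝟙 _ := by rw [h]; simp
  rw [← h']
  simp

lemma comp_pure {a b c : C} (i : ℤ) (f : a ⟶ b ⊗ P.obj i) (g : b ⟶ c) :
    comp P a b c (single P a b i f) (single P b c 0 (pure P g)) = single P a c i (f ≫ g ▷ _) := by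
  rw [comp_single, ← single_cast P (zero_add i)]
  congr 1
  simp only [compHom, pure, comp_whiskerRight, assoc, ← MonoidalCategory.whiskerLeft_comp, unit_aux,
    comp_id]

lemma pure_comp {a b c : C} (i : ℤ) (g : a ⟶ b) (f : b ⟶ c ⊗ P.obj i) :
    comp P a b c (single P a b 0 (pure P g)) (single P b c i f) = single P a c i (g ≫ f) := by
  rw [comp_single, ← single_cast P (add_zero i)]
  congr 1
  simp only [compHom, pure, assoc, ← MonoidalCategory.whiskerLeft_comp]
  congr 1
  have h := P.mul_one' i
  calc _ = f ≫ c ◁ ((ρ_ _).inv ≫ P.obj i ◁ P.one.hom ≫ (P.mul i 0).hom ≫ P.cast (add_zero i)) := by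
        simp [whisker_exchange_assoc]
    _ = _ := by rw [h]; simp

lemma comp_assoc {a b c d : C} (f : Hom P a b) (g : Hom P b c) (h : Hom P c d) :
    comp P a c d (comp P a b c f g) h = comp P a b d f (comp P b c d g h) := by
  induction f using DirectSum.induction_on with
  | zero => simp
  | add x y hx hy => simp [hx, hy]
  | of i f =>
  induction g using DirectSum.induction_on with
  | zero => simp
  | add x y hx hy => simp only [map_add, AddMonoidHom.add_apply, hx, hy]
  | of j g =>
  induction h using DirectSum.induction_on with
  | zero => simp
  | add x y hx hy => simp only [map_add, AddMonoidHom.add_apply, hx, hy]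
  | of k h =>
  rw [comp_single, comp_single, comp_single, comp_single, ← single_cast P (add_assoc k j i)]
  congr 1
  simp only [compHom, assoc, comp_whiskerRight, ← MonoidalCategory.whiskerLeft_comp]
  congr 2
  have h' := P.mul_assoc' k j i
  have h'' : (α_ _ _ _).hom ▷ P.obj i ≫ (α_ _ _ _).hom ≫
      d ◁ ((P.mul k j).hom ▷ P.obj i ≫ (P.mul (k + j) i).hom ≫ P.cast (add_assoc k j i)) =
      (α_ _ _ _).hom ≫ (d ⊗ P.obj k) ◁ (P.mul j i).hom ≫
      (α_ d (P.obj k) (P.obj (j + i))).hom ≫ d ◁ (P.mul k (j + i)).hom := by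
    rw [← h']
    simp
  have e : (d ◁ (P.mul k j).hom) ▷ P.obj i ≫ (α_ d (P.obj (k + j)) (P.obj i)).hom ≫
      d ◁ ((P.mul (k + j) i).hom ≫ P.cast (add_assoc k j i)) =
      (α_ _ _ _).hom ≫ d ◁ ((P.mul k j).hom ▷ P.obj i ≫ (P.mul (k + j) i).hom ≫
        P.cast (add_assoc k j i)) := by
    simp
  rw [e, h'', whisker_exchange_assoc]
  simp

/-- The orbit category of `C` with respect to `- ⊗ O`. -/
instance : Category (Orbit P) where
  Hom a b := Hom P a.as b.as
  id a := single P _ _ 0 (pure P (𝟙 a.as))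
  comp f g := comp P _ _ _ f g
  id_comp {a b} f := by
    induction f using DirectSum.induction_on with
    | zero => simp
    | add x y hx hy => rw [map_add, hx, hy]
    | of i f => rw [pure_comp, id_comp]
  comp_id {a b} f := by
    induction f using DirectSum.induction_on with
    | zero => simp
    | add x y hx hy => rw [map_add, AddMonoidHom.add_apply, hx, hy]
    | of i f => rw [comp_pure, id_whiskerRight, comp_id]
  assoc f g h := comp_assoc P f g h

instance : Preadditive (Orbit P) where
  homGroup a b := inferInstanceAs (AddCommGroup (Hom P a.as b.as))
  add_comp a b c f f' g :=
    (congrArg (fun φ : Hom P b.as c.as →+ Hom P a.as c.as => φ g)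
      ((comp P a.as b.as c.as).map_add f f') :)
  comp_add a b c f g g' := (comp P a.as b.as c.as f).map_add g g'

/-- The projection functor from `C` to the orbit category. -/
@[simps]
def π : C ⥤ Orbit P where
  obj a := ⟨a⟩
  map f := single P _ _ 0 (pure P f)
  map_comp f g := by
    change _ = comp P _ _ _ _ _
    rw [pure_comp]
    simp [pure]

lemma comp_def {a b c : Orbit P} (f : a ⟶ b) (g : b ⟶ c) :
    f ≫ g = comp P a.as b.as c.as f g := rfl

lemma powIso_aux₁ (i : ℤ) : compHom P i (-i) (λ_ (P.obj i)).inv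
    (P.one.hom ≫ P.cast (add_neg_cancel i).symm ≫ (P.mul i (-i)).inv) =
      pure P (𝟙 _) ≫ P.obj i ◁ P.cast (neg_add_cancel i).symm := by
  have h := P.mul_assoc' i (-i) i
  have h1 := P.one_mul' i
  have h2 := P.mul_one' i
  rw [← cancel_mono (P.mul i (-i + i)).hom]
  simp only [compHom, pure, assoc, comp_whiskerRight, id_comp]
  rw [h, MonoidalCategory.inv_hom_whiskerRight_assoc,
    reassoc_of% P.cast_whiskerRight_mul, P.cast_trans, P.whiskerLeft_cast_mul,
    Iso.inv_comp_eq]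
  rw [← P.cast_trans (zero_add i) (show i = i + (-i + i) by omega), reassoc_of% h1,
    ← P.cast_trans (add_zero i) (show i = i + (-i + i) by omega), reassoc_of% h2]
  simp

lemma powIso_aux₂ (i : ℤ) : compHom P (-i) i
    (P.one.hom ≫ P.cast (add_neg_cancel i).symm ≫ (P.mul i (-i)).inv) (λ_ (P.obj i)).inv =
      pure P (𝟙 _) ≫ 𝟙_ C ◁ P.cast (add_neg_cancel i).symm := by
  simp [compHom, pure, ← unitors_inv_equal]

/-- The canonical isomorphism, homogeneous of degree `i`, between `O^i` and the unit in the orbit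
category. -/
def powIso (i : ℤ) : (π P).obj (P.obj i) ≅ (π P).obj (𝟙_ C) where
  hom := single P (P.obj i) (𝟙_ C) i (λ_ (P.obj i)).inv
  inv := single P (𝟙_ C) (P.obj i) (-i) (P.one.hom ≫ P.cast (add_neg_cancel i).symm ≫
    (P.mul i (-i)).inv)
  hom_inv_id := by
    refine (comp_single P ..).trans (Eq.trans ?_ (single_cast P (neg_add_cancel i).symm _))
    exact congrArg _ (powIso_aux₁ P i)
  inv_hom_id := by
    refine (comp_single P ..).trans (Eq.trans ?_ (single_cast P (add_neg_cancel i).symm _))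
    exact congrArg _ (powIso_aux₂ P i)

/-- The canonical isomorphism, of degree one, between `O` and the unit in the orbit category. -/
def trivialization : (π P).obj O ≅ (π P).obj (𝟙_ C) :=
  (π P).mapIso P.gen ≪≫ powIso P 1

/-- The action `f ↦ a ⊗ f` of an object of `C` on the morphisms of the orbit category. -/
def whiskerHom (a b c : C) : Hom P b c →+ Hom P (a ⊗ b) (a ⊗ c) :=
  DirectSum.toAddMonoid fun i =>
    AddMonoidHom.mk' (fun f => single P (a ⊗ b) (a ⊗ c) i (a ◁ f ≫ (α_ _ _ _).inv))
      (by intro f f'; simp)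

end Orbit

/-- An object which is invertible for the tensor product. -/
def TensorInvertible {C : Type u} [Category.{v} C] [MonoidalCategory C] (O : C) : Prop :=
  ∃ O' : C, Nonempty (O ⊗ O' ≅ 𝟙_ C)

namespace TensorPowers
variable {C : Type u} [Category.{v} C] [MonoidalCategory C] 

lemma nat_aux {A B X Y : C} (f : X ⟶ Y) (e : A ⊗ B ≅ 𝟙_ C) :
    f ▷ A ▷ B ≫ (α_ Y A B ≪≫ whiskerLeftIso Y e ≪≫ ρ_ Y).hom =
      (α_ X A B ≪≫ whiskerLeftIso X e ≪≫ ρ_ X).hom ≫ f := by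
  simp only [Iso.trans_hom, whiskerLeftIso_hom, assoc]
  rw [← rightUnitor_naturality, whisker_exchange_assoc, associator_naturality_left_assoc]

lemma isEquivalence_tensorRight [SymmetricCategory C] {O : C} (hO : TensorInvertible O) : (tensorRight O).IsEquivalence := by
  obtain ⟨O', ⟨e⟩⟩ := hO
  exact (CategoryTheory.Equivalence.mk (tensorRight O) (tensorRight O')
    (NatIso.ofComponents (fun X => (α_ X O O' ≪≫ whiskerLeftIso X e ≪≫ ρ_ X))
      (fun f => nat_aux f e)).symm
    (NatIso.ofComponents (fun X => (α_ X O' O ≪≫ whiskerLeftIso X (β_ O' O ≪≫ e) ≪≫ ρ_ X))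
      (fun f => nat_aux f (β_ O' O ≪≫ e)))).isEquivalence_functor

section
variable (O : C) (A B D : ℤ → C) (a : ∀ n, A n ⊗ O ≅ A (n + 1)) (b : ∀ n, B n ⊗ O ≅ B (n + 1)) 

variable {A B} in
def IsSeqHom (f : ∀ n, A n ⟶ B n) : Prop := ∀ n, f n ▷ O ≫ (b n).hom = (a n).hom ≫ f (n + 1)

variable {O A B a b}

lemma IsSeqHom.ext [(tensorRight O).Faithful] {f g : ∀ n, A n ⟶ B n} (hf : IsSeqHom O a b f)
    (hg : IsSeqHom O a b g) (h : f 0 = g 0) (n : ℤ) : f n = g n := by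
  induction n using Int.induction_on with
  | zero => exact h
  | succ n hn => rw [← cancel_epi (a n).hom, ← hf, ← hg, hn]
  | pred n hn =>
    apply (tensorRight O).map_injective
    change f _ ▷ O = g _ ▷ O
    rw [← cancel_mono (b _).hom, hf, hg]
    have : -(n : ℤ) = -n - 1 + 1 := by omega
    rw [this] at hn
    rw [hn]

lemma IsSeqHom.isIso [(tensorRight O).IsEquivalence] {f : ∀ n, A n ⟶ B n} (hf : IsSeqHom O a b f)
    (h : IsIso (f 0)) (n : ℤ) : IsIso (f n) := by
  induction n using Int.induction_on with
  | zero => exact h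
  | succ n hn =>
    have : f (n + 1) = (a n).inv ≫ f n ▷ O ≫ (b n).hom := by rw [hf, Iso.inv_hom_id_assoc]
    rw [this]
    infer_instance
  | pred n hn =>
    have e : -(n : ℤ) = -n - 1 + 1 := by omega
    rw [e] at hn
    have : f (-n - 1) ▷ O = (a _).hom ≫ f (-n - 1 + 1) ≫ (b _).inv := by
      rw [← assoc, ← hf, assoc, Iso.hom_inv_id, comp_id]
    have : IsIso ((tensorRight O).map (f (-n - 1))) := by
      change IsIso (f _ ▷ O)
      rw [this]
      infer_instance
    exact isIso_of_reflects_iso _ (tensorRight O)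

variable (a b)
def seqUp (f : A 0 ⟶ B 0) : ∀ n : ℕ, A n ⟶ B n
  | 0 => f
  | n + 1 => (a n).inv ≫ seqUp f n ▷ O ≫ (b n).hom

def seqDown [(tensorRight O).Full] (f : A 0 ⟶ B 0) : ∀ n : ℕ, A (Int.negSucc n) ⟶ B (Int.negSucc n)
  | 0 => (tensorRight O).preimage ((a (Int.negSucc 0)).hom ≫ (show A (Int.negSucc 0 + 1) ⟶ B (Int.negSucc 0 + 1) from f) ≫ (b (Int.negSucc 0)).inv)
  | n + 1 => (tensorRight O).preimage ((a (Int.negSucc (n + 1))).hom ≫ seqDown f n ≫ (b (Int.negSucc (n + 1))).inv)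

def seqHom [(tensorRight O).Full] (f : A 0 ⟶ B 0) : ∀ n : ℤ, A n ⟶ B n
  | .ofNat n => seqUp a b f n
  | .negSucc n => seqDown a b f n

lemma isSeqHom_seqHom [(tensorRight O).Full] (f : A 0 ⟶ B 0) : IsSeqHom O a b (seqHom a b f) := by
  rintro (n | n)
  · change _ = (a n).hom ≫ (a n).inv ≫ seqUp a b f n ▷ O ≫ (b n).hom
    rw [Iso.hom_inv_id_assoc]
    rfl
  · cases n with
    | zero => 
      have : (tensorRight O).map (seqHom a b f (Int.negSucc 0)) = _ := (tensorRight O).map_preimage ((a (Int.negSucc 0)).hom ≫ (show A (Int.negSucc 0 + 1) ⟶ B (Int.negSucc 0 + 1) from f) ≫ (b (Int.negSucc 0)).inv)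
      change (tensorRight O).map (seqHom a b f (Int.negSucc 0)) ≫ (b (Int.negSucc 0)).hom = _
      rw [this, assoc, assoc]
      refine Eq.trans (congrArg _ (congrArg _ (Iso.inv_hom_id _))) ?_
      exact congrArg _ (comp_id f)
    | succ n =>
      have : (tensorRight O).map (seqHom a b f (Int.negSucc (n + 1))) = _ := 
        (tensorRight O).map_preimage ((a (Int.negSucc (n+1))).hom ≫ seqDown a b f n ≫ (b (Int.negSucc (n + 1))).inv)
      change (tensorRight O).map (seqHom a b f (Int.negSucc (n + 1))) ≫ (b _).hom = _
      rw [this, assoc, assoc]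
      refine Eq.trans (congrArg _ (congrArg _ (Iso.inv_hom_id _))) ?_
      exact congrArg _ (comp_id _)
end

section
variable (O O' : C) (e : O' ⊗ O ≅ 𝟙_ C)

def powUp : ℕ → C
  | 0 => 𝟙_ C
  | n + 1 => powUp n ⊗ O

def powObj : ℤ → C
  | .ofNat n => powUp O n
  | .negSucc n => powUp O' (n + 1)

variable {O O'}
def powStep : ∀ n : ℤ, powObj O O' n ⊗ O ≅ powObj O O' (n + 1)
  | .ofNat _ => Iso.refl _
  | .negSucc 0 => α_ _ _ _ ≪≫ whiskerLeftIso _ e ≪≫ ρ_ _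
  | .negSucc (_ + 1) => α_ _ _ _ ≪≫ whiskerLeftIso _ e ≪≫ ρ_ _

variable {C : Type u} [Category.{v} C] [MonoidalCategory C] {O : C} [(tensorRight O).IsEquivalence]
variable (X : ℤ → C) (s : ∀ n, X n ⊗ O ≅ X (n + 1)) (h₀ : 𝟙_ C ≅ X 0)

abbrev srcIso (Y : C) (n : ℤ) : (Y ⊗ X n) ⊗ O ≅ Y ⊗ X (n + 1) := α_ _ _ _ ≪≫ whiskerLeftIso Y (s n)

abbrev tgtIso (j n : ℤ) : X (j + n) ⊗ O ≅ X (j + (n + 1)) :=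
  s (j + n) ≪≫ eqToIso (congrArg X (add_assoc j n 1))

def mulHom (j : ℤ) : ∀ n, X j ⊗ X n ⟶ X (j + n) :=
  seqHom (srcIso X s (X j)) (tgtIso X s j) (X j ◁ h₀.inv ≫ (ρ_ _).hom ≫ eqToHom (congrArg X (add_zero j).symm))

lemma mulHom_zero (j : ℤ) : mulHom X s h₀ j 0 = X j ◁ h₀.inv ≫ (ρ_ _).hom ≫ eqToHom (congrArg X (add_zero j).symm) := rfl

lemma isSeqHom_mulHom (j : ℤ) : IsSeqHom O (srcIso X s (X j)) (tgtIso X s j) (mulHom X s h₀ j) :=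
  isSeqHom_seqHom _ _ _

lemma mulHom_step (j n : ℤ) : mulHom X s h₀ j n ▷ O ≫ (s (j + n)).hom =
    (α_ _ _ _).hom ≫ X j ◁ (s n).hom ≫ mulHom X s h₀ j (n + 1) ≫ eqToHom (congrArg X (add_assoc j n 1).symm) := by
  have := isSeqHom_mulHom X s h₀ j n
  simp only [tgtIso, srcIso, Iso.trans_hom, whiskerLeftIso_hom, eqToIso.hom, assoc] at this
  rw [← reassoc_of% this]
  simp

lemma mulHom_cast_right (j : ℤ) {n n' : ℤ} (h : n = n') : X j ◁ eqToHom (congrArg X h) ≫ mulHom X s h₀ j n' =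
    mulHom X s h₀ j n ≫ eqToHom (by rw [h]) := by subst h; simp

lemma step_cast {n n' : ℤ} (h : n = n') : eqToHom (congrArg X h) ▷ O ≫ (s n').hom =
    (s n).hom ≫ eqToHom (by rw [h]) := by subst h; simp

lemma mulHom_assoc (k j i : ℤ) :
    (α_ (X k) (X j) (X i)).hom ≫ X k ◁ mulHom X s h₀ j i ≫ mulHom X s h₀ k (j + i) =
    mulHom X s h₀ k j ▷ X i ≫ mulHom X s h₀ (k + j) i ≫ eqToHom (congrArg X (add_assoc k j i)) := by
  refine IsSeqHom.ext (O := O) (A := fun i => (X k ⊗ X j) ⊗ X i) (B := fun i => X (k + (j + i)))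
    (a := srcIso X s (X k ⊗ X j))
    (b := fun n => s (k + (j + n)) ≪≫ eqToIso (by rw [add_assoc, add_assoc]))
    (f := fun i => (α_ (X k) (X j) (X i)).hom ≫ X k ◁ mulHom X s h₀ j i ≫ mulHom X s h₀ k (j + i))
    (g := fun i => mulHom X s h₀ k j ▷ X i ≫ mulHom X s h₀ (k + j) i ≫ eqToHom (congrArg X (add_assoc k j i))) ?_ ?_ ?_ i
  · intro n
    simp only [srcIso, Iso.trans_hom, whiskerLeftIso_hom, eqToIso.hom, assoc, comp_whiskerRight]
    rw [reassoc_of% mulHom_step, associator_naturality_middle_assoc, ← whiskerLeft_comp_assoc, mulHom_step]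
    simp only [MonoidalCategory.whiskerLeft_comp, assoc]
    rw [reassoc_of% (mulHom_cast_right X s h₀ k (add_assoc j n 1).symm)]
    simp
  · intro n
    simp only [srcIso, Iso.trans_hom, whiskerLeftIso_hom, eqToIso.hom, assoc, comp_whiskerRight]
    rw [reassoc_of% (step_cast X s (add_assoc k j n)), reassoc_of% mulHom_step, associator_naturality_left_assoc,
      whisker_exchange_assoc]
    simp
  · simp only [mulHom_zero, MonoidalCategory.whiskerLeft_comp, assoc]
    rw [mulHom_cast_right X s h₀ k (add_zero j).symm, ← whisker_exchange_assoc]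
    simp

lemma mulHom_one (i : ℤ) :
    h₀.hom ▷ X i ≫ mulHom X s h₀ 0 i ≫ eqToHom (congrArg X (zero_add i)) = (λ_ _).hom := by
  refine IsSeqHom.ext (O := O) (A := fun i => 𝟙_ C ⊗ X i) (B := X)
    (a := srcIso X s (𝟙_ C))
    (b := s)
    (f := fun i => h₀.hom ▷ X i ≫ mulHom X s h₀ 0 i ≫ eqToHom (congrArg X (zero_add i)))
    (g := fun i => (λ_ (X i)).hom) ?_ ?_ ?_ i
  · intro n
    simp only [srcIso, Iso.trans_hom, whiskerLeftIso_hom, assoc, comp_whiskerRight]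
    rw [step_cast X s (zero_add n), reassoc_of% mulHom_step, associator_naturality_left_assoc,
      whisker_exchange_assoc]
    simp
  · intro n
    simp
  · simp only [mulHom_zero, assoc, eqToHom_trans]
    rw [← whisker_exchange_assoc]
    simp [← unitors_equal]

lemma isIso_mulHom (j n : ℤ) : IsIso (mulHom X s h₀ j n) :=
  (isSeqHom_mulHom X s h₀ j).isIso (by rw [mulHom_zero]; infer_instance) n

theorem nonempty [SymmetricCategory C] {O : C} (hO : TensorInvertible O) : Nonempty (TensorPowers O) := by
  have := isEquivalence_tensorRight hO
  obtain ⟨O', ⟨e⟩⟩ := hO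
  let s := powStep (β_ O' O ≪≫ e)
  have := isIso_mulHom (O := O) (powObj O O') s (Iso.refl _)
  exact ⟨{
    obj := powObj O O'
    one := Iso.refl _
    gen := (λ_ O).symm
    mul j i := asIso (mulHom (O := O) (powObj O O') s (Iso.refl _) j i)
    mul_assoc := mulHom_assoc _ _ _
    one_mul := mulHom_one (powObj O O') s (Iso.refl _)
    mul_one j := by
      have := mulHom_zero (O := O) (powObj O O') s (Iso.refl _) j
      simp only [asIso_hom]
      rw [this]
      simp [powObj, powUp] }⟩
end

end TensorPowers

theorem TensorPowers.tensorInvertible {C : Type u} [Category.{v} C] [MonoidalCategory C] {O : C}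
    (P : TensorPowers O) : TensorInvertible O :=
  ⟨P.obj (-1), ⟨whiskerRightIso P.gen _ ≪≫ P.mul 1 (-1) ≪≫ P.one.symm⟩⟩

/-- A factorization of the monoidal functor `F` through the projection `π` to the orbit category: an
additive functor from the orbit category whose composite with `π` is identified with `F`,
compatibly with tensor products. (The tensor product of the orbit category is determined on
morphisms by the operations `f ↦ a ⊗ f` and the symmetry, which lies in the image of `π`.) -/
structure OrbitFactorization {C : Type u₁} [Category.{v₁} C] [MonoidalCategory C] [Preadditive C]
    [MonoidalPreadditive C] {C' : Type u₂} [Category.{v₂} C'] [MonoidalCategory C'] [Preadditive C']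
    {O : C} (P : TensorPowers O) (F : C ⥤ C') [F.Monoidal] where
  functor : Orbit P ⥤ C'
  [additive : functor.Additive]
  iso : Orbit.π P ⋙ functor ≅ F
  whiskerLeft_eq (a b c : C) (f : (Orbit.π P).obj b ⟶ (Orbit.π P).obj c) :
    iso.inv.app (a ⊗ b) ≫ functor.map (Orbit.whiskerHom P a b c f : (Orbit.π P).obj (a ⊗ b) ⟶ (Orbit.π P).obj (a ⊗ c)) ≫ iso.hom.app (a ⊗ c) =
      Functor.OplaxMonoidal.δ F a b ≫ F.obj a ◁ (iso.inv.app b ≫ functor.map f ≫ iso.hom.app c) ≫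
        Functor.LaxMonoidal.μ F a c

namespace OrbitFactorization
variable {C : Type u₁} [Category.{v₁} C] [MonoidalCategory C] [Preadditive C]
    [MonoidalPreadditive C] {C' : Type u₂} [Category.{v₂} C'] [MonoidalCategory C'] [Preadditive C']
    {O : C} {P : TensorPowers O} {F : C ⥤ C'} [F.Monoidal] (E : OrbitFactorization P F)

/-- The map from morphisms in the orbit category to morphisms in `C'` given by the factorization. -/
def mapHom {a b : C} (f : (Orbit.π P).obj a ⟶ (Orbit.π P).obj b) : F.obj a ⟶ F.obj b :=
  E.iso.inv.app a ≫ E.functor.map f ≫ E.iso.hom.app b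

/-- The isomorphism between `F(O)` and the unit given by the factorization. -/
def objIso : F.obj O ≅ 𝟙_ C' :=
  E.iso.symm.app O ≪≫ E.functor.mapIso (Orbit.trivialization P) ≪≫ E.iso.app (𝟙_ C) ≪≫
    (Functor.Monoidal.εIso F).symm
end OrbitFactorization

section
variable {C : Type u₁} [Category.{v₁} C] [MonoidalCategory C] [SymmetricCategory C]
  {D : Type u₂} [Category.{v₂} D] [MonoidalCategory D] [SymmetricCategory D]

open Functor.OplaxMonoidal Functor.LaxMonoidal

/-- The coprojection morphism `G(M) ⊗ N ⟶ G(M ⊗ ω(N))`, for `G` right adjoint to `ω`. -/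
def coprojection {ω : C ⥤ D} [ω.Braided] {G : D ⥤ C} (adj : ω ⊣ G) (M : D) (N : C) :
    G.obj M ⊗ N ⟶ G.obj (M ⊗ ω.obj N) :=
  adj.homEquiv _ _ (δ ω (G.obj M) N ≫ adj.counit.app M ▷ ω.obj N)

/-- The data and conditions of the weak Tannakian formalism of Ayoub for a symmetric monoidal
functor `ω`: a right adjoint; a symmetric monoidal functor `sec` which is a section of `ω` up to a
monoidal isomorphism and which has a right adjoint; the coprojection morphisms are invertible. -/
structure WeakTannakian (ω : C ⥤ D) [ω.Braided] where
  right : D ⥤ C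
  adj : ω ⊣ right
  sec : D ⥤ C
  [braided_sec : sec.Braided]
  secIso : sec ⋙ ω ≅ 𝟭 D
  [isMonoidal_secIso : NatTrans.IsMonoidal secIso.hom]
  [isLeftAdjoint_sec : sec.IsLeftAdjoint]
  [isIso_coprojection (M : D) (N : C) : IsIso (coprojection adj M N)]

namespace WeakTannakian
attribute [instance] braided_sec isMonoidal_secIso isLeftAdjoint_sec isIso_coprojection
variable {ω : C ⥤ D} [ω.Braided] (A : WeakTannakian ω)

/-- The object `H = ω (right 𝟙)` underlying the Hopf algebra. -/
abbrev hopf : D := ω.obj (A.right.obj (𝟙_ D))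

/-- The unit of `H`, from the lax monoidal structures of `right` and `ω`. -/
def one : 𝟙_ D ⟶ A.hopf := ε ω ≫ ω.map (A.adj.homEquiv _ _ (η ω))

/-- The multiplication of `H`, from the lax monoidal structures of `right` and `ω`. -/
def mul : A.hopf ⊗ A.hopf ⟶ A.hopf :=
  μ ω _ _ ≫ ω.map (A.adj.homEquiv _ _
    (δ ω _ _ ≫ (A.adj.counit.app (𝟙_ D) ⊗ₘ A.adj.counit.app (𝟙_ D)) ≫ (λ_ (𝟙_ D)).hom))

/-- The counit of `H` is the counit of the adjunction. -/
def counit : A.hopf ⟶ 𝟙_ D := A.adj.counit.app (𝟙_ D)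

/-- The isomorphism `H ⊗ M ≅ ω (right M)` given by the section and the coprojection. -/
def hopfTensor (M : D) : A.hopf ⊗ M ≅ ω.obj (A.right.obj M) :=
  whiskerLeftIso _ (A.secIso.symm.app M) ≪≫ 
    Functor.Monoidal.μIso ω (A.right.obj (𝟙_ D)) (A.sec.obj M) ≪≫
    ω.mapIso (asIso (coprojection A.adj (𝟙_ D) (A.sec.obj M)) ≪≫
      A.right.mapIso (whiskerLeftIso _ (A.secIso.app M) ≪≫ λ_ M))

/-- The comultiplication of `H`: the comultiplication `ω right ⟶ ω right ω right` of the comonad of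
the adjunction, evaluated at the unit, with `ω right H` identified with `H ⊗ H`. -/
def comul : A.hopf ⟶ A.hopf ⊗ A.hopf :=
  ω.map (A.adj.unit.app (A.right.obj (𝟙_ D))) ≫ (A.hopfTensor A.hopf).inv

/-- A Hopf algebra structure on `H` is the one of the weak Tannakian formalism if its structure
morphisms are those above (the antipode is then uniquely determined). -/
structure IsHopfStructure (h : HopfObj A.hopf) : Prop where
  one_eq : h.one = A.one
  mul_eq : h.mul = A.mul
  counit_eq : h.counit = A.counit
  comul_eq : h.comul = A.comul

end WeakTannakian

section
variable {C' : Type u₃} [Category.{v₃} C'] [MonoidalCategory C'] [SymmetricCategory C']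
  {F : C ⥤ C'} [F.Braided] {ω' : C' ⥤ D} [ω'.Braided] (A : WeakTannakian (F ⋙ ω')) (A' : WeakTannakian ω')

/-- The sections for `F ⋙ ω'` and for `ω'` correspond to each other under `F`. -/
structure SectionCompat where
  iso : A.sec ⋙ F ≅ A'.sec
  [isMonoidal : NatTrans.IsMonoidal iso.hom]
  map_iso (M : D) : ω'.map (iso.hom.app M) ≫ A'.secIso.hom.app M = A.secIso.hom.app M

/-- The morphism `H(C) ⟶ H(C')` induced by `F`: the image under `ω'` of the morphism
`F (right 𝟙) ⟶ right' 𝟙` adjoint to the counit of `F ⋙ ω'`. -/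
def inducedHom : A.hopf ⟶ A'.hopf :=
  ω'.map (A'.adj.homEquiv (F.obj (A.right.obj (𝟙_ D))) (𝟙_ D) (A.adj.counit.app (𝟙_ D)))

/-- The element of `H(C)` defined by an object `O` of `C` with a trivialization `θ` of `F(O)`: the
coaction of `H(C)` on `ω(O)`, with `ω(O)` identified with the unit. -/
def groupLike {O : C} (θ : F.obj O ≅ 𝟙_ C') : 𝟙_ D ⟶ A.hopf :=
  ε ω' ≫ ω'.map θ.inv ≫ (F ⋙ ω').map (A.adj.unit.app O ≫ A.right.map (ω'.map θ.hom ≫ η ω'))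

variable {A} in
/-- Multiplication by the element `t` on `H(C)`. -/
def mulLeft (t : 𝟙_ D ⟶ A.hopf) : A.hopf ⟶ A.hopf := (λ_ _).inv ≫ t ▷ _ ≫ A.mul
end
end

open LaurentPolynomial in
section
variable (R : Type w) [CommRing R]

/-- The homomorphism `R[t, t⁻¹] → R` of `R`-algebras with `t ↦ 1`. -/
def aug : R[T;T⁻¹] →+* R := LaurentPolynomial.eval₂ (RingHom.id R) 1

/-- The complex of `R`-modules underlying a complex of `R[t, t⁻¹]`-modules. -/
abbrev resC : CochainComplex (ModuleCat.{w} R[T;T⁻¹]) ℤ ⥤ CochainComplex (ModuleCat.{w} R) ℤ :=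
  (ModuleCat.restrictScalars (C : R →+* R[T;T⁻¹])).mapHomologicalComplex _

/-- The tensor product `- ⊗ R` over `R[t, t⁻¹]`, along `t ↦ 1`. -/
abbrev extAug : CochainComplex (ModuleCat.{w} R[T;T⁻¹]) ℤ ⥤ CochainComplex (ModuleCat.{w} R) ℤ :=
  (ModuleCat.extendScalars (aug R)).mapHomologicalComplex _

lemma aug_C : (aug R).comp C = RingHom.id R := by
  ext r; simp [aug]

/-- The canonical morphism `m ↦ 1 ⊗ m` from `M` to the tensor product of `M` with `R` over `R[t, t⁻¹]`. -/
def unitAug : resC R ⟶ extAug R :=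
  NatTrans.mapHomologicalComplex 
   ((Functor.leftUnitor _).inv ≫ Functor.whiskerRight (ModuleCat.extendRestrictScalarsAdj (aug R)).unit (ModuleCat.restrictScalars C) ≫
    (Functor.associator _ _ _).hom ≫ Functor.whiskerLeft _ ((ModuleCat.restrictScalarsComp' C (aug R) _ rfl).inv ≫ 
      (ModuleCat.restrictScalarsId' _ (aug_C R)).hom) ≫ (Functor.rightUnitor _).hom) _

/-- Multiplication by `t`. -/
def tMul (M : CochainComplex (ModuleCat.{w} R[T;T⁻¹]) ℤ) : M ⟶ M := (T 1 : R[T;T⁻¹]) • 𝟙 M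

open ComplexTensor
variable {R}

/-- For `τ : H ⟶ H` in `D(R)`, regarded as multiplication by `t` of an `R[t, t⁻¹]`-linear structure
on `H`, the morphism `φ` exhibits `H'` as the derived tensor product of `H` and `R` over
`R[t, t⁻¹]`, along `t ↦ 1`: there is a K-projective complex `M` of `R[t, t⁻¹]`-modules and an
isomorphism `e` in `D(R)` (a quasi-isomorphism) between `H` and `M` carrying `τ` to multiplication
by `t`, and an isomorphism `ψ` in `D(R)` between `H'` and the tensor product of `M` and `R` over
`R[t, t⁻¹]`, carrying `φ` to the canonical morphism `m ↦ 1 ⊗ m`. -/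
structure IsDerivedBaseChange {H H' : DR R} (τ : H ⟶ H) (φ : H ⟶ H') : Prop where
  exists_model : ∃ (M : CochainComplex (ModuleCat.{w} R[T;T⁻¹]) ℤ) (_ : M.IsKProjective)
    (e : H.obj ⟶ (HomotopyCategory.quotient _ _).obj ((resC R).obj M))
    (ψ : H'.obj ⟶ (HomotopyCategory.quotient _ _).obj ((extAug R).obj M)),
    HomotopyCategory.quasiIso _ _ e ∧ HomotopyCategory.quasiIso _ _ ψ ∧
    τ.hom ≫ e = e ≫ (HomotopyCategory.quotient _ _).map ((resC R).map (tMul R M)) ∧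
    φ.hom ≫ ψ = e ≫ (HomotopyCategory.quotient _ _).map ((unitAug R).app M)
end

/-- The tensor product is exact in each variable (by symmetry it suffices to consider one of them). -/
class TensorExact (C : Type u) [Category.{v} C] [Preadditive C] [HasZeroObject C] [HasShift C ℤ]
   [∀ n : ℤ, (shiftFunctor C n).Additive] [Pretriangulated C] [MonoidalCategory C] : Prop where
  exists_isTriangulated (a : C) : ∃ _ : (tensorLeft a).CommShift ℤ, (tensorLeft a).IsTriangulated

/-- An object is compact if `Hom(a, -)` preserves arbitrary direct sums. -/
def IsCompactObject {C : Type u} [Category.{w} C] [Preadditive C] (a : C) : Prop :=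
  ∀ J : Type w, PreservesColimitsOfShape (Discrete J) (preadditiveCoyoneda.obj (Opposite.op a))

/-- A functor preserves arbitrary (small) direct sums. -/
def PreservesSums {C : Type u₁} [Category.{v₁} C] {D : Type u₂} [Category.{v₂} D] (F : C ⥤ D) : Prop :=
  ∀ J : Type w, PreservesColimitsOfShape (Discrete J) F

/-- A set of objects, closed under shifts up to isomorphism, which generates: an object receiving no
nonzero morphism from its members is zero. -/
structure IsGenerating {C : Type u} [Category.{v} C] [Preadditive C] [HasShift C ℤ] {I : Type w} (g : I → C) : Prop where
  shift_closed (i : I) (n : ℤ) : ∃ j, Nonempty (g j ≅ (g i)⟦n⟧)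
  isZero_of_hom_eq_zero (X : C) (h : ∀ i (f : g i ⟶ X), f = 0) : IsZero X

end WeakTannaka

end

open ComplexTensor WeakTannaka

/-!
Write `H = ω (right 𝟙)` and `H' = ω' (right' 𝟙)`.

*The Hopf algebras.* The coprojections give isomorphisms `H ⊗ M ≅ ω (right M)`, so that a morphism
`ω N ⟶ M` is the same as a morphism `ω N ⟶ H ⊗ M` which is *liftable*, that is, the image under `ω`
of a morphism `N ⟶ right 𝟙 ⊗ sec M`. A liftable morphism is therefore determined by its composite
with the counit of `H` (`WeakTannakian.Liftable.hom_ext`), and liftable morphisms are stable under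
composition, tensor products and iteration. The bialgebra axioms, the equation `Δ t = t ⊗ t` and the
compatibility of the induced morphism `φ : H ⟶ H'` with the comultiplications are identities between
liftable morphisms, and they are verified by applying counits. The antipode exists because the shear
endomorphism `x ⊗ y ↦ x y₁ ⊗ y₂` of `H ⊗ H` is invertible (`hopfObjOfShear`): it is the image of the
coprojection `right 𝟙 ⊗ right 𝟙 ⟶ right H` (`WeakTannakian.shear_eq`).

*The distinguished triangle.* Let `B = right 𝟙` and `B' = right' 𝟙`. The element `t` is the image of
a morphism `O ⟶ B`, multiplication by which is an isomorphism `B ⊗ O ≅ B`. Together with the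
trivialization of `F O` it gives an automorphism `t` of `F B`, which `ω'` sends to multiplication by
`t` (`twistIso`, `map_twistIso_hom`). Since the generators `g` are compact in `C`, and their images are
compact in `C'`, the factorization of `F` through the orbit category is bijective on morphisms from
`g` to every object, by devissage (`OrbitFactorization.bijective_mapAddHom`). Hence
`Hom(F g, F B)` is the direct sum over `i : ℤ` of the groups `Hom(g, B ⊗ O^i)`, and `t⁻¹` acts on it
by bijections from degree `i` to degree `i + 1`. By adjunction, the map from the degree zero part to
`Hom(F g, B') = Hom(ω g, 𝟙) = Hom(g, B)` is bijective, so that `Hom(F g, F B)` is `N[T, T⁻¹]`, with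
`N = Hom(F g, B')` and `T = t⁻¹`, and its map to `N` is evaluation at `T = 1`. As the objects `F g`
generate `C'`, it follows that there is a distinguished triangle `F B ⟶ F B ⟶ B' ⟶`, whose first
morphism is `t⁻¹ - 1` (`OrbitFactorization.exists_distinguished`). Applying `ω'` shows that `H'` is
the cone of `t⁻¹ - 1` on `H`.

*The model.* Let `X` be a K-projective complex representing `H`, and `f` an endomorphism of `X`
representing multiplication by `t`. The cone `M` of `t - f` on `X[t, t⁻¹]` is a K-projective complex of
`R[t, t⁻¹]`-modules (`laurentCone`). As a complex of `R`-modules it is homotopy equivalent to `X`, by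
an equivalence which carries `f` to multiplication by `t`, because `t - f` is a split monomorphism in
the homotopy category, with cokernel `X` (`isIso_of_laurent_triangle`). The base change of `M` along
`t ↦ 1` is the cone of `1 - f` on `X`, that is, the cone of `t⁻¹ - 1` on `H`
(`exists_laurent_model`).
-/

set_option linter.unusedSectionVars false

noncomputable section

/-! ### The algebra `right 𝟙` -/

namespace WeakTannaka

section
variable {D : Type u₂} [Category.{v₂} D] [MonoidalCategory D]

/-- The product of three morphisms to the unit object is associative. -/
lemma tensorHom_tensorHom_leftUnitor {X Y Z : D} (f : X ⟶ 𝟙_ D) (g : Y ⟶ 𝟙_ D) (h : Z ⟶ 𝟙_ D) :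
    (((f ⊗ₘ g) ≫ (λ_ (𝟙_ D)).hom) ⊗ₘ h) ≫ (λ_ (𝟙_ D)).hom =
      (α_ X Y Z).hom ≫ (f ⊗ₘ ((g ⊗ₘ h) ≫ (λ_ (𝟙_ D)).hom)) ≫ (λ_ (𝟙_ D)).hom := by
  rw [← tensorHom_comp_whiskerLeft, assoc, ← associator_naturality_assoc, ← tensorHom_comp_whiskerRight,
    assoc]
  congr 1
  monoidal

end

namespace WeakTannakian

open Functor.OplaxMonoidal Functor.LaxMonoidal

variable {C : Type u₁} [Category.{v₁} C] [MonoidalCategory C] [SymmetricCategory C]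
  {D : Type u₂} [Category.{v₂} D] [MonoidalCategory D] [SymmetricCategory D]
  {ω : C ⥤ D} [ω.Braided] (A : WeakTannakian ω)

/-- The algebra `right 𝟙` of `C`, whose image under `ω` is the Hopf algebra `H`. -/
abbrev alg : C := A.right.obj (𝟙_ D)

/-- The unit of `right 𝟙`. -/
def algOne : 𝟙_ C ⟶ A.alg := A.adj.homEquiv _ _ (η ω)

/-- The multiplication of `right 𝟙`. -/
def algMul : A.alg ⊗ A.alg ⟶ A.alg :=
  A.adj.homEquiv _ _
    (δ ω _ _ ≫ (A.adj.counit.app (𝟙_ D) ⊗ₘ A.adj.counit.app (𝟙_ D)) ≫ (λ_ (𝟙_ D)).hom)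

/-- Morphisms to `right M` are determined by their adjoints. -/
lemma right_hom_ext {N : C} {M : D} {u v : N ⟶ A.right.obj M}
    (h : ω.map u ≫ A.adj.counit.app M = ω.map v ≫ A.adj.counit.app M) : u = v :=
  (A.adj.homEquiv _ _).symm.injective (by simpa [Adjunction.homEquiv_counit] using h)

lemma map_homEquiv_counit {N : C} {M : D} (f : ω.obj N ⟶ M) :
    ω.map (A.adj.homEquiv _ _ f) ≫ A.adj.counit.app M = f := by
  simp [Adjunction.homEquiv_unit]

@[simp]
lemma map_algOne_counit : ω.map A.algOne ≫ A.counit = η ω := A.map_homEquiv_counit _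

@[simp]
lemma map_algMul_counit : ω.map A.algMul ≫ A.counit =
    δ ω _ _ ≫ (A.counit ⊗ₘ A.counit) ≫ (λ_ (𝟙_ D)).hom := A.map_homEquiv_counit _

@[simp]
lemma map_coprojection_counit (M : D) (N : C) :
    ω.map (coprojection A.adj M N) ≫ A.adj.counit.app (M ⊗ ω.obj N) =
      δ ω _ _ ≫ A.adj.counit.app M ▷ ω.obj N := A.map_homEquiv_counit _

lemma one_eq_map : A.one = ε ω ≫ ω.map A.algOne := rfl

lemma mul_eq_map : A.mul = μ ω _ _ ≫ ω.map A.algMul := rfl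

/-- The algebra structure on `right 𝟙`. -/
@[reducible] def monObjAlg : MonObj A.alg where
  one := A.algOne
  mul := A.algMul
  one_mul := by
    apply A.right_hom_ext
    change ω.map _ ≫ A.counit = ω.map _ ≫ A.counit
    rw [ω.map_comp, assoc, map_algMul_counit, ← δ_natural_left_assoc,
      MonoidalCategory.tensorHom_def, assoc, ← comp_whiskerRight_assoc, map_algOne_counit,
      Functor.Monoidal.map_leftUnitor]
    simp
  mul_one := by
    apply A.right_hom_ext
    change ω.map _ ≫ A.counit = ω.map _ ≫ A.counit
    rw [ω.map_comp, assoc, map_algMul_counit, ← δ_natural_right_assoc,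
      MonoidalCategory.tensorHom_def', assoc, ← whiskerLeft_comp_assoc, map_algOne_counit,
      Functor.Monoidal.map_rightUnitor]
    simp [unitors_equal]
  mul_assoc := by
    apply A.right_hom_ext
    change ω.map _ ≫ A.counit = ω.map _ ≫ A.counit
    simp only [ω.map_comp, assoc, map_algMul_counit]
    rw [← δ_natural_left_assoc, ← δ_natural_right_assoc, whiskerRight_comp_tensorHom_assoc,
      whiskerLeft_comp_tensorHom_assoc, map_algMul_counit, Functor.Monoidal.map_associator]
    simp only [assoc, Functor.Monoidal.μ_δ_assoc]
    rw [whiskerLeft_comp_tensorHom_assoc, Functor.Monoidal.μ_δ_assoc,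
      ← whiskerRight_comp_tensorHom_assoc, tensorHom_tensorHom_leftUnitor]

attribute [local instance] monObjAlg

lemma braiding_algMul : (β_ A.alg A.alg).hom ≫ A.algMul = A.algMul := by
  apply A.right_hom_ext
  change ω.map _ ≫ A.counit = ω.map _ ≫ A.counit
  rw [ω.map_comp, assoc, map_algMul_counit, Functor.map_braiding, assoc, assoc,
    Functor.Monoidal.μ_δ_assoc, ← BraidedCategory.braiding_naturality_assoc,
    braiding_leftUnitor, unitors_equal]

/-- The algebra structure on `H`. -/
@[reducible] def monObjHopf : MonObj A.hopf := ω.monObjObj A.alg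

end WeakTannakian
end WeakTannaka

/-! ### Liftable morphisms -/

namespace WeakTannaka
namespace WeakTannakian

open Functor.OplaxMonoidal Functor.LaxMonoidal

variable {C : Type u₁} [Category.{v₁} C] [MonoidalCategory C] [SymmetricCategory C]
  {D : Type u₂} [Category.{v₂} D] [MonoidalCategory D] [SymmetricCategory D]
  {ω : C ⥤ D} [ω.Braided] (A : WeakTannakian ω)

attribute [local instance] monObjAlg monObjHopf

/-- The isomorphism `right 𝟙 ⊗ sec M ≅ right M` in `C` underlying `hopfTensor`. -/
def algTensor (M : D) : A.alg ⊗ A.sec.obj M ≅ A.right.obj M :=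
  asIso (coprojection A.adj (𝟙_ D) (A.sec.obj M)) ≪≫
      A.right.mapIso (whiskerLeftIso _ (A.secIso.app M) ≪≫ λ_ M)

lemma hopfTensor_hom (M : D) : (A.hopfTensor M).hom =
    A.hopf ◁ A.secIso.inv.app M ≫ μ ω _ _ ≫ ω.map (A.algTensor M).hom := rfl

/-- The isomorphism `H ⊗ M ≅ ω (right M)` carries the counit of the comonad to the counit
of `H`. -/
lemma hopfTensor_hom_counit (M : D) : (A.hopfTensor M).hom ≫ A.adj.counit.app M =
    A.counit ▷ M ≫ (λ_ M).hom := by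
  have h : ω.map (A.right.map ((whiskerLeftIso (𝟙_ D) (A.secIso.app M) ≪≫ λ_ M).hom)) ≫
      A.adj.counit.app M = A.adj.counit.app _ ≫ (whiskerLeftIso _ (A.secIso.app M) ≪≫ λ_ M).hom :=
    A.adj.counit.naturality _
  rw [hopfTensor_hom, algTensor, Iso.trans_hom, asIso_hom, ω.map_comp, assoc, assoc, assoc,
    Functor.mapIso_hom, h]
  erw [reassoc_of% map_coprojection_counit]
  rw [Functor.Monoidal.μ_δ_assoc]
  change _ ◁ _ ≫ A.counit ▷ _ ≫ _ = _
  rw [whisker_exchange_assoc, Iso.trans_hom, whiskerLeftIso_hom, Iso.app_hom,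
    ← whiskerLeft_comp_assoc]
  simp

/-- The identification of `ω (right 𝟙 ⊗ sec M)` with `H ⊗ M`. -/
def toHopf (M : D) : ω.obj (A.alg ⊗ A.sec.obj M) ⟶ A.hopf ⊗ M :=
  δ ω _ _ ≫ A.hopf ◁ A.secIso.hom.app M

lemma toHopf_hopfTensor_hom (M : D) :
    A.toHopf M ≫ (A.hopfTensor M).hom = ω.map (A.algTensor M).hom := by
  rw [hopfTensor_hom, toHopf, assoc, ← whiskerLeft_comp_assoc, Iso.hom_inv_id_app]
  simp

lemma map_secUnit : ω.map (ε A.sec) ≫ A.secIso.hom.app (𝟙_ D) = η ω := by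
  have := NatTrans.IsMonoidal.unit (τ := A.secIso.hom)
  rw [Functor.LaxMonoidal.comp_ε] at this
  rw [← cancel_epi (ε ω), ← assoc, this]
  simp

lemma map_secMul (M M' : D) : μ ω _ _ ≫ ω.map (μ A.sec M M') ≫ A.secIso.hom.app (M ⊗ M') =
      (A.secIso.hom.app M ⊗ₘ A.secIso.hom.app M') := by
  have := NatTrans.IsMonoidal.tensor (τ := A.secIso.hom) M M'
  rw [Functor.LaxMonoidal.comp_μ, assoc] at this
  rw [this]
  exact comp_id _

lemma map_whiskerLeft_toHopf {M M' : D} (m : M ⟶ M') :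
    ω.map (A.alg ◁ A.sec.map m) ≫ A.toHopf M' = A.toHopf M ≫ A.hopf ◁ m := by
  have := A.secIso.hom.naturality m
  dsimp at this
  rw [toHopf, toHopf, assoc, ← MonoidalCategory.whiskerLeft_comp, ← this,
    ← δ_natural_right_assoc, MonoidalCategory.whiskerLeft_comp]

/-- A morphism `ω N ⟶ H ⊗ M` is liftable if it is the image under `ω` of a morphism
`N ⟶ right 𝟙 ⊗ sec M` of `C`. Liftable morphisms play the role of the coactions: by adjunction, they
correspond to morphisms `ω N ⟶ M`, by composition with the counit of `H`. -/
def Liftable {N : C} {M : D} (f : ω.obj N ⟶ A.hopf ⊗ M) : Prop :=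
  ∃ v : N ⟶ A.alg ⊗ A.sec.obj M, f = ω.map v ≫ A.toHopf M

variable {A}

lemma liftable_map_comp_hopfTensor_inv {N : C} {M : D} (u : N ⟶ A.right.obj M) :
    A.Liftable (ω.map u ≫ (A.hopfTensor M).inv) := by
  refine ⟨u ≫ (A.algTensor M).inv, ?_⟩
  rw [← cancel_mono (A.hopfTensor M).hom, assoc, assoc, Iso.inv_hom_id, toHopf_hopfTensor_hom, comp_id,
    ← ω.map_comp, assoc, Iso.inv_hom_id, comp_id]

/-- Identities between liftable morphisms may be verified after composition with the counit of `H`.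
All the axioms of a Hopf algebra are deduced from this principle. -/
lemma Liftable.hom_ext {N : C} {M : D} {f g : ω.obj N ⟶ A.hopf ⊗ M} (hf : A.Liftable f)
    (hg : A.Liftable g) (h : f ≫ A.counit ▷ M = g ≫ A.counit ▷ M) : f = g := by
  obtain ⟨v, rfl⟩ := hf
  obtain ⟨v', rfl⟩ := hg
  suffices v ≫ (A.algTensor M).hom = v' ≫ (A.algTensor M).hom by
    rw [(cancel_mono _).1 this]
  apply A.right_hom_ext
  rw [ω.map_comp, ω.map_comp, ← toHopf_hopfTensor_hom, assoc, assoc, assoc, assoc,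
    hopfTensor_hom_counit, reassoc_of% h]

lemma Liftable.precomp {N N' : C} {M : D} {f : ω.obj N ⟶ A.hopf ⊗ M} (hf : A.Liftable f)
    (n : N' ⟶ N) : A.Liftable (ω.map n ≫ f) := by
  obtain ⟨v, rfl⟩ := hf
  exact ⟨n ≫ v, by simp⟩

lemma Liftable.postcomp {N : C} {M M' : D} {f : ω.obj N ⟶ A.hopf ⊗ M} (hf : A.Liftable f)
    (m : M ⟶ M') : A.Liftable (f ≫ A.hopf ◁ m) := by
  obtain ⟨v, rfl⟩ := hf
  exact ⟨v ≫ _ ◁ A.sec.map m, by rw [ω.map_comp, assoc, assoc, map_whiskerLeft_toHopf]⟩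

/-- The images under `ω` of morphisms to `right 𝟙` are liftable, with the unit object as `M`. -/
lemma liftable_map_rightUnitor_inv {N : C} (n : N ⟶ A.alg) :
    A.Liftable (ω.map n ≫ (ρ_ A.hopf).inv) := by
  refine ⟨n ≫ (ρ_ _).inv ≫ A.alg ◁ ε A.sec, ?_⟩
  rw [ω.map_comp, ω.map_comp, assoc, assoc, toHopf, ← δ_natural_right_assoc,
    ← MonoidalCategory.whiskerLeft_comp, map_secUnit, Functor.OplaxMonoidal.right_unitality]

/-- The tensor product of two coactions: the factors in `H` are multiplied. -/
lemma Liftable.tensor {N N' : C} {M M' : D} {f : ω.obj N ⟶ A.hopf ⊗ M} (hf : A.Liftable f)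
    {f' : ω.obj N' ⟶ A.hopf ⊗ M'} (hf' : A.Liftable f') :
    A.Liftable (δ ω N N' ≫ (f ⊗ₘ f') ≫ tensorμ A.hopf M A.hopf M' ≫ A.mul ▷ (M ⊗ M')) := by
  obtain ⟨v, rfl⟩ := hf
  obtain ⟨v', rfl⟩ := hf'
  refine ⟨(v ⊗ₘ v') ≫ tensorμ _ _ _ _ ≫ (A.algMul ⊗ₘ μ A.sec M M'), ?_⟩
  have h' : ω.map (tensorμ A.alg (A.sec.obj M) A.alg (A.sec.obj M')) =
      δ ω _ _ ≫ (δ ω _ _ ⊗ₘ δ ω _ _) ≫ tensorμ _ _ _ _ ≫ (μ ω _ _ ⊗ₘ μ ω _ _) ≫ μ ω _ _ := by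
    rw [tensorμ_comp_μ_tensorHom_μ_comp_μ, tensorHom_comp_tensorHom_assoc]
    simp
  have h'' := tensorμ_natural (𝟙 A.hopf) (A.secIso.hom.app M) (𝟙 A.hopf) (A.secIso.hom.app M')
  rw [ω.map_comp, ω.map_comp, assoc, ← tensorHom_comp_tensorHom, assoc, δ_natural_assoc, h',
    toHopf, toHopf, ← tensorHom_comp_tensorHom]
  simp only [assoc]
  congr 3
  rw [Functor.Monoidal.map_tensor, toHopf]
  simp only [assoc, Functor.Monoidal.μ_δ_assoc]
  rw [← id_tensorHom, ← id_tensorHom, reassoc_of% h'', tensorHom_comp_tensorHom_assoc,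
    ← tensorHom_id, tensorHom_comp_tensorHom, ← id_tensorHom, tensorHom_comp_tensorHom,
    mul_eq_map]
  simp only [assoc, map_secMul]
  simp

/-- A coaction on `M` followed by a coaction on its coefficients. -/
lemma Liftable.comp_whiskerRight {N : C} {M L : D} {f : ω.obj N ⟶ A.hopf ⊗ M} (hf : A.Liftable f)
    {d : A.hopf ⟶ A.hopf ⊗ L} (hd : A.Liftable d) :
    A.Liftable (f ≫ d ▷ M ≫ (α_ _ _ _).hom) := by
  obtain ⟨v, rfl⟩ := hf
  obtain ⟨w, rfl⟩ := hd
  refine ⟨v ≫ w ▷ _ ≫ (α_ _ _ _).hom ≫ _ ◁ μ A.sec L M, ?_⟩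
  simp only [ω.map_comp, assoc, toHopf]
  congr 1
  rw [← δ_natural_right_assoc, Functor.Monoidal.map_associator, whisker_exchange_assoc,
    MonoidalCategory.comp_whiskerRight, assoc, δ_natural_left_assoc]
  simp only [assoc, Functor.Monoidal.μ_δ_assoc]
  rw [← MonoidalCategory.whiskerLeft_comp, ← MonoidalCategory.whiskerLeft_comp, map_secMul,
    MonoidalCategory.tensorHom_def]
  simp

/-- A coaction whose coefficients are multiplied on the left by the image of a morphism to
`right 𝟙`. -/
lemma Liftable.mulLeft {N N' : C} {M : D} (n : N' ⟶ A.alg) {f : ω.obj N ⟶ A.hopf ⊗ M}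
    (hf : A.Liftable f) :
    A.Liftable (δ ω N' N ≫ (ω.map n ⊗ₘ f) ≫ (α_ _ _ _).inv ≫ A.mul ▷ M) := by
  obtain ⟨v, rfl⟩ := hf
  refine ⟨(n ⊗ₘ v) ≫ (α_ _ _ _).inv ≫ A.algMul ▷ _, ?_⟩
  rw [← tensorHom_comp_whiskerLeft, assoc, δ_natural_assoc]
  simp only [ω.map_comp, assoc, toHopf]
  congr 1
  rw [← δ_natural_left_assoc, Functor.Monoidal.map_associator_inv]
  simp only [assoc, Functor.Monoidal.μ_δ_assoc]
  rw [← comp_whiskerRight_assoc, ← mul_eq_map, ← whisker_exchange]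
  simp

end WeakTannakian
end WeakTannaka

/-! ### Hopf monoids and the shear endomorphism -/

namespace WeakTannaka

section Shear
open MonObj ComonObj

variable {D : Type u₂} [Category.{v₂} D] [MonoidalCategory D] [BraidedCategory D]
  (H : D) [BimonObj H]

/-- The shear endomorphism `x ⊗ y ↦ x y₁ ⊗ y₂` of `H ⊗ H`. -/
def shear : H ⊗ H ⟶ H ⊗ H := H ◁ Δ[H] ≫ (α_ H H H).inv ≫ μ[H] ▷ H

/-- The shear is linear for the action of `H` on the left factor. -/
lemma shear_linear : H ◁ shear H ≫ (α_ H H H).inv ≫ μ[H] ▷ H =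
    (α_ H H H).inv ≫ μ[H] ▷ H ≫ shear H := by
  simp only [shear, MonoidalCategory.whiskerLeft_comp, assoc]
  rw [← whisker_exchange_assoc, associator_inv_naturality_left_assoc, ← comp_whiskerRight,
    MonObj.mul_assoc]
  simp

/-- The shear is colinear for the coaction of `H` on the right factor. -/
lemma shear_colinear : shear H ≫ H ◁ Δ[H] ≫ (α_ H H H).inv =
    H ◁ Δ[H] ≫ (α_ H H H).inv ≫ shear H ▷ H := by
  simp only [shear, comp_whiskerRight, assoc]
  rw [← whisker_exchange_assoc, associator_inv_naturality_left,
    ← associator_inv_naturality_right_assoc, ← whiskerLeft_comp_assoc, ComonObj.comul_assoc]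
  simp

lemma unit_shear : (λ_ H).inv ≫ η[H] ▷ H ≫ shear H = Δ[H] := by
  simp only [shear]
  rw [← whisker_exchange_assoc, associator_inv_naturality_left_assoc, ← comp_whiskerRight,
    MonObj.one_mul]
  simp

lemma shear_counit : shear H ≫ H ◁ ε[H] ≫ (ρ_ H).hom = μ[H] := by
  simp only [shear, assoc]
  rw [← whisker_exchange_assoc, ← associator_inv_naturality_right_assoc, ← whiskerLeft_comp_assoc,
    ComonObj.comul_counit]
  simp

/-- A bimonoid whose shear endomorphism is invertible is a Hopf monoid: the antipode sends `y` to the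
image of `1 ⊗ y` under the inverse of the shear, followed by the counit on the right factor. -/
abbrev hopfObjOfShear [IsIso (shear H)] : HopfObj H where
  antipode := (λ_ H).inv ≫ η[H] ▷ H ≫ inv (shear H) ≫ H ◁ ε[H] ≫ (ρ_ H).hom
  antipode_left := by
    -- the inverse of the shear is colinear
    have h : inv (shear H) ≫ H ◁ Δ[H] ≫ (α_ H H H).inv =
        H ◁ Δ[H] ≫ (α_ H H H).inv ≫ inv (shear H) ▷ H := by
      rw [IsIso.inv_comp_eq, reassoc_of% shear_colinear, ← comp_whiskerRight, IsIso.hom_inv_id]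
      simp
    have h' : Δ[H] ≫ ((λ_ H).inv ≫ η[H] ▷ H ≫ inv (shear H) ≫ H ◁ ε[H] ≫ (ρ_ H).hom) ▷ H =
        (λ_ H).inv ≫ η[H] ▷ H ≫ inv (shear H) := by
      have h₁ : Δ[H] ≫ ((λ_ H).inv ≫ η[H] ▷ H ≫ inv (shear H)) ▷ H =
          (λ_ H).inv ≫ η[H] ▷ H ≫ inv (shear H) ≫ H ◁ Δ[H] ≫ (α_ H H H).inv := by
        rw [h, ← whisker_exchange_assoc, associator_inv_naturality_left_assoc]
        simp
      have h₂ : H ◁ Δ[H] ≫ (α_ H H H).inv ≫ (H ◁ ε[H] ≫ (ρ_ H).hom) ▷ H = 𝟙 _ := by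
        rw [comp_whiskerRight, ← associator_inv_naturality_middle_assoc, ← whiskerLeft_comp_assoc,
          ComonObj.counit_comul]
        simp
      calc _ = (Δ[H] ≫ ((λ_ H).inv ≫ η[H] ▷ H ≫ inv (shear H)) ▷ H) ≫
            (H ◁ ε[H] ≫ (ρ_ H).hom) ▷ H := by simp
        _ = _ := by rw [h₁]; simp only [assoc]; rw [h₂, comp_id]
    rw [reassoc_of% h', ← shear_counit, IsIso.inv_hom_id_assoc, ← whisker_exchange_assoc]
    simp [← unitors_equal]
  antipode_right := by
    -- the inverse of the shear is linear
    have h : H ◁ inv (shear H) ≫ (α_ H H H).inv ≫ μ[H] ▷ H =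
        (α_ H H H).inv ≫ μ[H] ▷ H ≫ inv (shear H) := by
      simp only [← assoc]
      rw [IsIso.eq_comp_inv]
      simp only [assoc]
      rw [← shear_linear, ← whiskerLeft_comp_assoc, IsIso.inv_hom_id]
      simp
    have h' : H ◁ ((λ_ H).inv ≫ η[H] ▷ H ≫ inv (shear H) ≫ H ◁ ε[H] ≫ (ρ_ H).hom) ≫ μ[H] =
        inv (shear H) ≫ H ◁ ε[H] ≫ (ρ_ H).hom := by
      have h₁ : H ◁ (H ◁ ε[H] ≫ (ρ_ H).hom) ≫ μ[H] =
          (α_ H H H).inv ≫ μ[H] ▷ H ≫ H ◁ ε[H] ≫ (ρ_ H).hom := by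
        rw [← whisker_exchange_assoc]
        simp
      simp only [MonoidalCategory.whiskerLeft_comp, assoc] at h₁ ⊢
      rw [h₁, reassoc_of% h, associator_inv_naturality_middle_assoc, ← comp_whiskerRight_assoc,
        MonObj.mul_one]
      simp
    rw [h', ← unit_shear, assoc, assoc, IsIso.hom_inv_id_assoc, ← whisker_exchange_assoc]
    simp [← unitors_equal]

end Shear
end WeakTannaka

/-! ### The Hopf algebra of a weak Tannakian functor -/

namespace WeakTannaka
namespace WeakTannakian

open Functor.OplaxMonoidal Functor.LaxMonoidal

variable {C : Type u₁} [Category.{v₁} C] [MonoidalCategory C] [SymmetricCategory C]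
  {D : Type u₂} [Category.{v₂} D] [MonoidalCategory D] [SymmetricCategory D]
  {ω : C ⥤ D} [ω.Braided] (A : WeakTannakian ω)

attribute [local instance] monObjAlg monObjHopf

lemma liftable_comul : A.Liftable A.comul := liftable_map_comp_hopfTensor_inv _

lemma comul_counit : A.comul ≫ A.counit ▷ A.hopf = (λ_ A.hopf).inv := by
  rw [← cancel_mono (λ_ A.hopf).hom, assoc, ← hopfTensor_hom_counit, comul, assoc,
    Iso.inv_hom_id_assoc, Iso.inv_hom_id]
  exact A.adj.left_triangle_components _

lemma mul_counit : A.mul ≫ A.counit = (A.counit ⊗ₘ A.counit) ≫ (λ_ (𝟙_ D)).hom := by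
  rw [mul_eq_map, assoc, map_algMul_counit, Functor.Monoidal.μ_δ_assoc]

lemma one_counit : A.one ≫ A.counit = 𝟙 _ := by
  rw [one_eq_map, assoc, map_algOne_counit, Functor.Monoidal.ε_η]

variable {A} in
/-- The counit applied to a product of two coactions; this is the multiplicativity of the counit. -/
lemma tensor_counit {X X' : D} {M M' : D} (f : X ⟶ A.hopf ⊗ M) (f' : X' ⟶ A.hopf ⊗ M') :
    ((f ⊗ₘ f') ≫ tensorμ A.hopf M A.hopf M' ≫ A.mul ▷ (M ⊗ M')) ≫ A.counit ▷ (M ⊗ M') =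
      ((f ≫ A.counit ▷ M ≫ (λ_ M).hom) ⊗ₘ (f' ≫ A.counit ▷ M' ≫ (λ_ M').hom)) ≫
        (λ_ (M ⊗ M')).inv := by
  have h := tensorμ_natural A.counit (𝟙 M) A.counit (𝟙 M')
  rw [assoc, assoc, ← comp_whiskerRight, mul_counit, comp_whiskerRight, ← tensorHom_id _ (M ⊗ M'),
    ← id_tensorHom_id, ← reassoc_of% h, tensorHom_id, tensorHom_id, ← tensorHom_comp_tensorHom,
    ← tensorHom_comp_tensorHom, leftUnitor_monoidal]
  simp

/-- The coalgebra structure on `H`. -/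
@[reducible] def comonObjHopf : ComonObj A.hopf where
  counit := A.counit
  comul := A.comul
  counit_comul := A.comul_counit
  comul_counit := by
    refine (A.liftable_comul.postcomp _).hom_ext ?_ ?_
    · simpa using A.liftable_map_rightUnitor_inv (𝟙 A.alg)
    · rw [assoc, whisker_exchange, reassoc_of% comul_counit]
      simp [← unitors_inv_equal]
  comul_assoc := by
    refine (A.liftable_comul.postcomp _).hom_ext
      (A.liftable_comul.comp_whiskerRight A.liftable_comul) ?_
    rw [assoc, whisker_exchange, reassoc_of% comul_counit, assoc, assoc,
      ← associator_naturality_left, ← comp_whiskerRight_assoc, comul_counit,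
      ← leftUnitor_inv_naturality]
    congr 1
    monoidal

attribute [local instance] comonObjHopf

lemma mul_comul : A.mul ≫ A.comul =
    (A.comul ⊗ₘ A.comul) ≫ tensorμ _ _ _ _ ≫ (A.mul ⊗ₘ A.mul) := by
  rw [← cancel_epi (δ ω A.alg A.alg)]
  refine Liftable.hom_ext (A := A) (N := A.alg ⊗ A.alg) ?_ ?_ ?_
  · rw [mul_eq_map, assoc, Functor.Monoidal.δ_μ_assoc]
    exact A.liftable_comul.precomp _
  · have := (A.liftable_comul.tensor A.liftable_comul).postcomp A.mul
    simpa only [assoc, ← MonoidalCategory.tensorHom_def] using this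
  · have := tensor_counit A.comul A.comul
    simp only [assoc] at this ⊢
    rw [comul_counit, MonoidalCategory.tensorHom_def A.mul A.mul, assoc, whisker_exchange,
      reassoc_of% this, reassoc_of% comul_counit]
    simp

lemma one_comul : A.one ≫ A.comul = (λ_ _).inv ≫ (A.one ⊗ₘ A.one) := by
  rw [← cancel_epi (η ω)]
  refine Liftable.hom_ext (A := A) (N := 𝟙_ C) ?_ ?_ ?_
  · rw [one_eq_map, assoc, Functor.Monoidal.η_ε_assoc]
    exact A.liftable_comul.precomp _
  · have := (A.liftable_map_rightUnitor_inv A.algOne).postcomp A.one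
    rw [unitors_inv_equal, rightUnitor_inv_comp_tensorHom, one_eq_map, assoc,
      Functor.Monoidal.η_ε_assoc, ← one_eq_map, ← assoc]
    exact this
  · rw [assoc, assoc, comul_counit, assoc, assoc, tensorHom_comp_whiskerRight, one_counit]
    simp

/-- The bialgebra structure on `H`. -/
@[reducible] def bimonObjHopf : BimonObj A.hopf where
  mul_comul := A.mul_comul
  one_comul := A.one_comul
  mul_counit := A.mul_counit
  one_counit := A.one_counit

attribute [local instance] bimonObjHopf

/-- The shear endomorphism of `H ⊗ H` is the image under `ω` of the coprojection isomorphism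
`right 𝟙 ⊗ right 𝟙 ≅ right (H)`, up to the identifications given by `hopfTensor`. -/
lemma shear_eq : shear A.hopf = μ ω A.alg A.alg ≫
      ω.map (coprojection A.adj (𝟙_ D) A.alg ≫ A.right.map (λ_ A.hopf).hom) ≫
        (A.hopfTensor A.hopf).inv := by
  rw [← cancel_epi (δ ω A.alg A.alg), Functor.Monoidal.δ_μ_assoc]
  refine Liftable.hom_ext (A := A) (N := A.alg ⊗ A.alg) ?_ (liftable_map_comp_hopfTensor_inv _) ?_
  · have := A.liftable_comul.mulLeft (𝟙 A.alg)
    rw [ω.map_id, id_tensorHom] at this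
    exact this
  · rw [shear]
    change (_ ≫ _ ◁ A.comul ≫ (α_ _ _ _).inv ≫ A.mul ▷ _) ≫ A.counit ▷ _ = _
    have h : ω.map (A.right.map (λ_ A.hopf).hom) ≫ A.adj.counit.app _ =
      A.adj.counit.app _ ≫ (λ_ A.hopf).hom := A.adj.counit.naturality _
    rw [← cancel_mono (λ_ A.hopf).hom, assoc, assoc, assoc, assoc, assoc, assoc,
      ← hopfTensor_hom_counit, Iso.inv_hom_id_assoc, ω.map_comp, assoc, h,
      reassoc_of% map_coprojection_counit, hopfTensor_hom_counit, ← comp_whiskerRight_assoc, mul_counit,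
      MonoidalCategory.tensorHom_def]
    change _ = _ ≫ A.counit ▷ _ ≫ _
    simp only [comp_whiskerRight, assoc]
    rw [← associator_inv_naturality_left_assoc, whisker_exchange_assoc,
      ← associator_inv_naturality_middle_assoc, ← whiskerLeft_comp_assoc, comul_counit]
    congr 2
    monoidal

instance : IsIso (shear A.hopf) := by
  rw [shear_eq]
  infer_instance

/-- The Hopf algebra structure on `H`. -/
abbrev hopfObj : HopfObj A.hopf := hopfObjOfShear A.hopf

lemma isHopfStructure_hopfObj : A.IsHopfStructure A.hopfObj := ⟨rfl, rfl, rfl, rfl⟩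

end WeakTannakian
end WeakTannaka

/-! ### The induced morphism and the group-like element -/

namespace WeakTannaka

open Functor.OplaxMonoidal Functor.LaxMonoidal WeakTannakian

attribute [local instance] monObjAlg monObjHopf comonObjHopf bimonObjHopf

variable {C : Type u₁} [Category.{v₁} C] [MonoidalCategory C] [SymmetricCategory C]
  {D : Type u₂} [Category.{v₂} D] [MonoidalCategory D] [SymmetricCategory D]
  {C' : Type u₃} [Category.{v₃} C'] [MonoidalCategory C'] [SymmetricCategory C']
  {F : C ⥤ C'} [F.Braided] {ω' : C' ⥤ D} [ω'.Braided]
  (A : WeakTannakian (F ⋙ ω')) (A' : WeakTannakian ω')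

/-- The morphism of algebras `F (right 𝟙) ⟶ right' 𝟙` underlying the morphism induced by `F`. -/
def algHom : F.obj A.alg ⟶ A'.alg :=
  A'.adj.homEquiv (F.obj (A.right.obj (𝟙_ D))) (𝟙_ D) (A.adj.counit.app (𝟙_ D))

lemma inducedHom_eq_map : inducedHom A A' = ω'.map (algHom A A') := rfl

lemma map_algHom_counit : ω'.map (algHom A A') ≫ A'.counit = A.counit := A'.map_homEquiv_counit _

lemma inducedHom_counit : inducedHom A A' ≫ A'.counit = A.counit := map_algHom_counit A A'

lemma map_algOne_algHom : ε F ≫ F.map A.algOne ≫ algHom A A' = A'.algOne := by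
  apply A'.right_hom_ext
  change ω'.map _ ≫ A'.counit = ω'.map _ ≫ A'.counit
  have h : ω'.map (F.map A.algOne) ≫ A.counit = η (F ⋙ ω') := A.map_algOne_counit
  rw [ω'.map_comp, ω'.map_comp, assoc, assoc, map_algHom_counit, h, map_algOne_counit]
  simp

lemma map_algMul_algHom :
    F.map A.algMul ≫ algHom A A' = δ F _ _ ≫ (algHom A A' ⊗ₘ algHom A A') ≫ A'.algMul := by
  apply A'.right_hom_ext
  change ω'.map _ ≫ A'.counit = ω'.map _ ≫ A'.counit
  have h : ω'.map (F.map A.algMul) ≫ A.counit = δ (F ⋙ ω') _ _ ≫ _ := A.map_algMul_counit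
  rw [ω'.map_comp, ω'.map_comp, ω'.map_comp, assoc, assoc, assoc, map_algHom_counit, h,
    map_algMul_counit, ← δ_natural_assoc, tensorHom_comp_tensorHom_assoc, map_algHom_counit]
  simp

variable {A A'} in
/-- Liftable morphisms for `F ⋙ ω'` yield liftable morphisms for `ω'`. -/
lemma WeakTannakian.Liftable.comp_inducedHom (σ : SectionCompat A A') {N : C} {M : D}
    {f : (F ⋙ ω').obj N ⟶ A.hopf ⊗ M} (hf : A.Liftable f) :
    A'.Liftable (N := F.obj N) (f ≫ inducedHom A A' ▷ M) := by
  obtain ⟨v, rfl⟩ := hf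
  refine ⟨F.map v ≫ δ F _ _ ≫ (algHom A A' ⊗ₘ σ.iso.hom.app M), ?_⟩
  rw [ω'.map_comp, ω'.map_comp, toHopf, toHopf, assoc, assoc, assoc, assoc, ← δ_natural_assoc,
    tensorHom_comp_whiskerLeft, σ.map_iso, MonoidalCategory.tensorHom_def',
    Functor.OplaxMonoidal.comp_δ, assoc]
  rfl

lemma isBimonHom_inducedHom (σ : SectionCompat A A') :
    IsBimonHom (inducedHom A A') where
  one_hom := by
    change A.one ≫ _ = A'.one
    rw [one_eq_map, one_eq_map, inducedHom_eq_map, ← map_algOne_algHom A A']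
    simp
  mul_hom := by
    change A.mul ≫ _ = _ ≫ A'.mul
    rw [mul_eq_map, mul_eq_map, inducedHom_eq_map, assoc, Functor.comp_map, ← ω'.map_comp,
      map_algMul_algHom, μ_natural_assoc]
    simp
  hom_counit := inducedHom_counit A A'
  hom_comul := by
    change _ ≫ A'.comul = A.comul ≫ _
    refine Liftable.hom_ext (A := A') (N := F.obj A.alg) ?_ ?_ ?_
    · exact A'.liftable_comul.precomp _
    · rw [MonoidalCategory.tensorHom_def, ← assoc]
      exact (A.liftable_comul.comp_inducedHom σ).postcomp _
    · rw [assoc, comul_counit, assoc, tensorHom_comp_whiskerRight, inducedHom_counit,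
        MonoidalCategory.tensorHom_def, reassoc_of% comul_counit, leftUnitor_inv_naturality]
      rfl

variable {A} in
/-- The morphism `O ⟶ right 𝟙` underlying the element defined by a trivialization of `F O`. -/
def trivHom (A : WeakTannakian (F ⋙ ω')) {O : C} (θ : F.obj O ≅ 𝟙_ C') : O ⟶ A.alg :=
  A.adj.homEquiv _ _ (ω'.map θ.hom ≫ η ω')

section
variable {O : C} (θ : F.obj O ≅ 𝟙_ C')

lemma map_trivHom_counit : ω'.map (F.map (trivHom A θ)) ≫ A.counit = ω'.map θ.hom ≫ η ω' :=
  A.map_homEquiv_counit _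

/-- The image of `trivHom` under `ω` is the group-like element, up to the trivialization of `ω O`. In
particular the group-like element is liftable, when regarded as a morphism from `ω O`. -/
lemma map_trivHom : ω'.map (F.map (trivHom A θ)) = ω'.map θ.hom ≫ η ω' ≫ groupLike A θ := by
  simp only [groupLike, Functor.Monoidal.η_ε_assoc, trivHom, Adjunction.homEquiv_unit]
  rw [← ω'.map_comp_assoc, Iso.hom_inv_id]
  simp

lemma groupLike_counit : groupLike A θ ≫ A.counit = 𝟙 _ := by
  have h := map_trivHom_counit A θ
  rw [map_trivHom] at h
  rw [← cancel_epi (η ω'), ← cancel_epi (ω'.map θ.hom), comp_id, ← h, assoc, assoc]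

/-- Both sides are liftable as morphisms from `ω O`, and they agree after composition with the
counit. -/
lemma groupLike_comul : groupLike A θ ≫ A.comul =
    (λ_ _).inv ≫ (groupLike A θ ⊗ₘ groupLike A θ) := by
  rw [← cancel_epi (η ω'), ← cancel_epi (ω'.map θ.hom)]
  refine Liftable.hom_ext (A := A) (N := O) ?_ ?_ ?_
  · have := A.liftable_comul.precomp (trivHom A θ)
    rw [Functor.comp_map, map_trivHom] at this
    simpa only [assoc] using this
  · have := (A.liftable_map_rightUnitor_inv (trivHom A θ)).postcomp (groupLike A θ)
    rw [Functor.comp_map, map_trivHom] at this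
    rw [unitors_inv_equal, rightUnitor_inv_comp_tensorHom]
    simpa only [assoc] using this
  · simp only [assoc]
    rw [comul_counit, tensorHom_comp_whiskerRight, groupLike_counit]
    simp

end

end WeakTannaka

/-! ### The automorphism of `F (right 𝟙)` given by a trivialization of `F O` -/

namespace WeakTannaka

open Functor.OplaxMonoidal Functor.LaxMonoidal WeakTannakian

attribute [local instance] monObjAlg monObjHopf comonObjHopf bimonObjHopf

section
variable {C : Type u₁} [Category.{v₁} C] [MonoidalCategory C] [SymmetricCategory C]
  {D : Type u₂} [Category.{v₂} D] [MonoidalCategory D] [SymmetricCategory D]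
  {ω : C ⥤ D} [ω.Braided] (A : WeakTannakian ω)

/-- Multiplication by an element of `right 𝟙` of degree `O` is invertible as soon as the element
corresponds to a trivialization of `ω O`: it is then a coprojection, up to isomorphism. -/
lemma WeakTannakian.isIso_whiskerLeft_algMul {O : C} (x : O ⟶ A.alg) [IsIso (ω.map x ≫ A.counit)] :
    IsIso (A.alg ◁ x ≫ A.algMul) := by
  have : A.alg ◁ x ≫ A.algMul = coprojection A.adj (𝟙_ D) O ≫
      A.right.map (_ ◁ (ω.map x ≫ A.counit) ≫ (λ_ _).hom) := by
    apply A.right_hom_ext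
    have h : ω.map (A.right.map (𝟙_ D ◁ (ω.map x ≫ A.counit) ≫ (λ_ _).hom)) ≫ A.adj.counit.app _ =
      A.adj.counit.app _ ≫ 𝟙_ D ◁ (ω.map x ≫ A.counit) ≫ (λ_ _).hom := A.adj.counit.naturality _
    change ω.map _ ≫ A.counit = _
    rw [ω.map_comp, ω.map_comp, assoc, assoc, h, map_algMul_counit, reassoc_of% map_coprojection_counit,
      ← δ_natural_right_assoc, whiskerLeft_comp_tensorHom_assoc, MonoidalCategory.tensorHom_def,
      assoc]
    rfl
  rw [this]
  infer_instance

end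

variable {C : Type u₁} [Category.{v₁} C] [MonoidalCategory C] [SymmetricCategory C]
  {D : Type u₂} [Category.{v₂} D] [MonoidalCategory D] [SymmetricCategory D]
  {C' : Type u₃} [Category.{v₃} C'] [MonoidalCategory C'] [SymmetricCategory C']
  {F : C ⥤ C'} [F.Braided] {ω' : C' ⥤ D} [ω'.Braided]
  (A : WeakTannakian (F ⋙ ω')) (A' : WeakTannakian ω') {O : C} (θ : F.obj O ≅ 𝟙_ C')

/-- The isomorphism `right 𝟙 ⊗ O ≅ right 𝟙` given by a trivialization of `F O`. -/
def actIso : A.alg ⊗ O ≅ A.alg :=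
  have : IsIso ((F ⋙ ω').map (trivHom A θ) ≫ A.counit) := by
    rw [Functor.comp_map, map_trivHom_counit]; infer_instance
  have := A.isIso_whiskerLeft_algMul (trivHom A θ)
  asIso (A.alg ◁ trivHom A θ ≫ A.algMul)

lemma actIso_hom : (actIso A θ).hom = A.alg ◁ trivHom A θ ≫ A.algMul := rfl

/-- The automorphism of `F (right 𝟙)` given by a trivialization of `F O`; its image under `ω'` is
multiplication by the corresponding element of `H`. -/
def twistIso : F.obj A.alg ≅ F.obj A.alg :=
  (ρ_ _).symm ≪≫ whiskerLeftIso _ θ.symm ≪≫ Functor.Monoidal.μIso F _ _ ≪≫ F.mapIso (actIso A θ)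

lemma twistIso_hom : (twistIso A θ).hom =
    (ρ_ _).inv ≫ F.obj A.alg ◁ θ.inv ≫ μ F _ _ ≫ F.map (actIso A θ).hom := rfl

lemma twistIso_inv : (twistIso A θ).inv =
    F.map (actIso A θ).inv ≫ δ F _ _ ≫ F.obj A.alg ◁ θ.hom ≫ (ρ_ _).hom := by
  simp [twistIso]

lemma map_trivHom_algHom : F.map (trivHom A θ) ≫ algHom A A' = θ.hom ≫ A'.algOne := by
  apply A'.right_hom_ext
  change ω'.map _ ≫ A'.counit = ω'.map _ ≫ A'.counit
  rw [ω'.map_comp, assoc, map_algHom_counit, map_trivHom_counit, ω'.map_comp, assoc,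
    map_algOne_counit]

/-- The element defined by the trivialization of `F O` becomes `1` in `right' 𝟙`. -/
lemma twistIso_hom_algHom : (twistIso A θ).hom ≫ algHom A A' = algHom A A' := by
  have h : A'.alg ◁ A'.algOne ≫ A'.algMul = (ρ_ _).hom := MonObj.mul_one A'.alg
  rw [twistIso_hom, actIso_hom, F.map_comp]
  simp only [assoc]
  rw [map_algMul_algHom, ← δ_natural_right_assoc, Functor.Monoidal.μ_δ_assoc,
    whiskerLeft_comp_tensorHom_assoc, map_trivHom_algHom, whiskerLeft_comp_tensorHom_assoc,
    Iso.inv_hom_id_assoc, MonoidalCategory.tensorHom_def, assoc, h, rightUnitor_naturality,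
    Iso.inv_hom_id_assoc]

lemma twistIso_inv_algHom : (twistIso A θ).inv ≫ algHom A A' = algHom A A' := by
  rw [Iso.inv_comp_eq, twistIso_hom_algHom]

lemma map_twistIso_hom : ω'.map (twistIso A θ).hom = mulLeft (groupLike A θ) := by
  have h : ω'.map (F.map A.algMul) = δ (F ⋙ ω') _ _ ≫ A.mul := by
    rw [mul_eq_map, Functor.Monoidal.δ_μ_assoc]; rfl
  have h' : (β_ A.hopf A.hopf).hom ≫ A.mul = A.mul := by
    rw [mul_eq_map, ← Functor.LaxBraided.braided_assoc, ← Functor.map_comp, braiding_algMul]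
  rw [twistIso_hom, actIso_hom, mulLeft, ← h', BraidedCategory.braiding_naturality_left_assoc,
    leftUnitor_inv_braiding_assoc]
  have h'' : groupLike A θ = ε ω' ≫ ω'.map θ.inv ≫ ω'.map (F.map (trivHom A θ)) := by
    rw [map_trivHom, ← ω'.map_comp_assoc, Iso.inv_hom_id, ω'.map_id, id_comp,
      Functor.Monoidal.ε_η_assoc]
  rw [F.map_comp, ← μ_natural_right_assoc, h'']
  simp only [ω'.map_comp, h, Functor.OplaxMonoidal.comp_δ, assoc, MonoidalCategory.whiskerLeft_comp,
    Functor.Monoidal.map_μ_δ_assoc]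
  rw [Functor.Monoidal.map_rightUnitor_inv]
  simp only [Functor.Monoidal.map_whiskerLeft, assoc, Functor.Monoidal.μ_δ_assoc]
  rfl

end WeakTannaka

/-! ### Compact generators and localizing subcategories -/

namespace WeakTannaka

section HomSum
variable {T : Type u} [Category.{v} T] [Preadditive T]

/-- The canonical map from the direct sum of the groups `Hom(a, X j)` to `Hom(a, ⨁ X j)`. -/
def homSum (a : T) {J : Type*} [DecidableEq J] {X : J → T} (c : Cofan X) :
    DirectSum J (fun j => a ⟶ X j) →+ (a ⟶ c.pt) :=
  DirectSum.toAddMonoid (fun j => Preadditive.rightComp a (c.inj j))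

@[simp]
lemma homSum_of (a : T) {J : Type*} [DecidableEq J] {X : J → T} (c : Cofan X) (j : J)
    (f : a ⟶ X j) : homSum a c (DirectSum.of (fun j => a ⟶ X j) j f) = f ≫ c.inj j := by
  simp [homSum, Preadditive.rightComp]

end HomSum

section
variable {T : Type u} [Category.{w} T] [Preadditive T]

/-- The definition of compactness in terms of elements: morphisms from a compact object to a direct
sum are finite sums of morphisms to the summands. -/
theorem IsCompactObject.bijective_homSum {a : T} (ha : IsCompactObject a) {J : Type w}
    [DecidableEq J] {X : J → T} (c : Cofan X) (hc : IsColimit c) :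
    Function.Bijective (homSum a c) := by
  have := ha J
  let P := preadditiveCoyoneda.obj (Opposite.op a)
  have hc' : IsColimit (P.mapCocone c) := isColimitOfPreserves P hc
  let s : Cocone (Discrete.functor X ⋙ P) :=
    { pt := AddCommGrpCat.of (DirectSum J (fun j => a ⟶ X j))
      ι := Discrete.natTrans fun j =>
        AddCommGrpCat.ofHom (DirectSum.of (fun j => a ⟶ X j) j.as) }
  let r' : P.obj c.pt ⟶ s.pt := hc'.desc s
  let r : (a ⟶ c.pt) →+ DirectSum J (fun j => a ⟶ X j) := r'.hom
  have h₁ (j : J) (f : a ⟶ X j) : r (f ≫ c.inj j) = DirectSum.of (fun j => a ⟶ X j) j f :=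
    ConcreteCategory.congr_hom (hc'.fac s ⟨j⟩) f
  have h₂ : r' ≫ AddCommGrpCat.ofHom (homSum a c) = 𝟙 _ := by
    refine hc'.hom_ext fun ⟨j⟩ => ?_
    apply AddCommGrpCat.ext
    intro (f : a ⟶ X j)
    exact (congrArg (homSum a c) (h₁ j f)).trans (homSum_of a c j f)
  refine Function.bijective_iff_has_inverse.2 ⟨r, fun x => ?_, fun y => ?_⟩
  · induction x using DirectSum.induction_on with
    | zero => simp
    | add x y hx hy => rw [map_add, map_add, hx, hy]
    | of j f => rw [homSum_of, h₁]
  · exact ConcreteCategory.congr_hom h₂ y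

end

section
open Pretriangulated
variable {T : Type u} [Category.{v} T] [Preadditive T] [HasZeroObject T] [HasShift T ℤ]
    [∀ n : ℤ, (shiftFunctor T n).Additive] [Pretriangulated T] {I : Type w} {g : I → T}

namespace Dist
variable {X Y Z : T} {f : X ⟶ Y} {p : Y ⟶ Z} {q : Z ⟶ X⟦(1 : ℤ)⟧}

lemma comp₁₂ (hT : Triangle.mk f p q ∈ distTriang T) : f ≫ p = 0 :=
  comp_distTriang_mor_zero₁₂ _ hT

lemma comp₃₁ (hT : Triangle.mk f p q ∈ distTriang T) : q ≫ f⟦(1 : ℤ)⟧' = 0 :=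
  comp_distTriang_mor_zero₃₁ _ hT

lemma lift₂ (hT : Triangle.mk f p q ∈ distTriang T) {a : T} (x : a ⟶ Y) (hx : x ≫ p = 0) :
    ∃ y, y ≫ f = x :=
  (Triangle.coyoneda_exact₂ _ hT x hx).imp fun _ h => h.symm

lemma lift₃ (hT : Triangle.mk f p q ∈ distTriang T) {a : T} (x : a ⟶ Z) (hx : x ≫ q = 0) :
    ∃ y, y ≫ p = x :=
  (Triangle.coyoneda_exact₃ _ hT x hx).imp fun _ h => h.symm

lemma desc₂ (hT : Triangle.mk f p q ∈ distTriang T) {a : T} (x : Y ⟶ a) (hx : f ≫ x = 0) :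
    ∃ y, p ≫ y = x :=
  (Triangle.yoneda_exact₂ _ hT x hx).imp fun _ h => h.symm

end Dist

/-- A morphism which induces injections on morphisms from all the `g i` has the same property
after a shift, if the family `g` is closed under shifts. -/
lemma IsGenerating.shift_injective (hg : IsGenerating g) {X Y : T} (f : X ⟶ Y)
    (hf : ∀ i (x : g i ⟶ X), x ≫ f = 0 → x = 0) (n : ℤ) (i : I) (x : g i ⟶ X⟦n⟧)
    (hx : x ≫ f⟦n⟧' = 0) : x = 0 := by
  obtain ⟨j, ⟨e⟩⟩ := hg.shift_closed i (-n)
  let e' : (g j)⟦n⟧ ≅ g i := (shiftFunctor T n).mapIso e ≪≫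
    (shiftFunctorCompIsoId T (-n) n (neg_add_cancel n)).app _
  obtain ⟨y, hy⟩ := (shiftFunctor T n).map_surjective (e'.hom ≫ x)
  have : y = 0 := by
    apply hf
    apply (shiftFunctor T n).map_injective
    rw [Functor.map_comp, hy, assoc, hx, comp_zero, Functor.map_zero]
  rw [← cancel_epi e'.hom, ← hy, this, Functor.map_zero, comp_zero]

/-- A generating family detects isomorphisms. -/
lemma IsGenerating.isIso (hg : IsGenerating g) {X Y : T} (f : X ⟶ Y)
    (inj : ∀ i (x : g i ⟶ X), x ≫ f = 0 → x = 0)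
    (surj : ∀ i (y : g i ⟶ Y), ∃ x : g i ⟶ X, x ≫ f = y) : IsIso f := by
  obtain ⟨Z, p, q, hT⟩ := distinguished_cocone_triangle f
  refine (Triangle.isZero₃_iff_isIso₁ _ hT).1 (hg.isZero_of_hom_eq_zero _ fun i (z : g i ⟶ Z) => ?_)
  have hz : z ≫ q = 0 := hg.shift_injective f inj 1 i _ (by
    rw [assoc, Dist.comp₃₁ hT, comp_zero])
  obtain ⟨y, rfl⟩ := Dist.lift₃ hT z hz
  obtain ⟨x, rfl⟩ := surj i y
  rw [assoc, Dist.comp₁₂ hT, comp_zero]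
  rfl

end

section Tower
open Pretriangulated
variable {T : Type u} [Category.{w} T] [Preadditive T] [HasZeroObject T] [HasShift T ℤ]
    [∀ n : ℤ, (shiftFunctor T n).Additive] [Pretriangulated T] [HasCoproducts.{w} T]
    {I : Type w} (g : I → T)

/-- The direct sum of the objects `g i` over all morphisms `g i ⟶ W`. -/
abbrev cover (W : T) : T := ∐ fun p : Σ i, (g i ⟶ W) => g p.1

/-- The canonical morphism to `W` from the direct sum of the objects `g i` over all
morphisms `g i ⟶ W`. -/
abbrev coverHom (W : T) : cover g W ⟶ W := Sigma.desc fun p => p.2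

lemma exists_comp_coverHom {W : T} {i : I} (x : g i ⟶ W) :
    ∃ y, y ≫ coverHom g W = x :=
  ⟨Sigma.ι (fun p : Σ i, (g i ⟶ W) => g p.1) ⟨i, x⟩, by simp⟩

variable (S : ObjectProperty T)

/-- One step of the approximation of `X` by objects of `S`: an object `Z` over `X` is modified by
coning off a direct sum of generators, which kills all the morphisms from generators to `Z` that
become zero in `X`. -/
lemma exists_next (hS : ∀ {J : Type w} (X : J → T), (∀ j, S (X j)) → S (∐ X))
    (hcone : ∀ Δ ∈ distTriang T, S Δ.obj₁ → S Δ.obj₂ → S Δ.obj₃) (hSg : ∀ i, S (g i))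
    {X : T} (Z : Over X) : ∃ (Z' : Over X) (b : Z ⟶ Z'), (S Z.left → S Z'.left) ∧
      ∀ i (x : g i ⟶ Z.left), x ≫ Z.hom = 0 → x ≫ b.left = 0 := by
  obtain ⟨W, k, _, hT⟩ := distinguished_cocone_triangle₁ Z.hom
  obtain ⟨Z', b, _, hT'⟩ := distinguished_cocone_triangle (coverHom g W ≫ k)
  obtain ⟨f', hf'⟩ := Dist.desc₂ hT' Z.hom (by
    rw [assoc, Dist.comp₁₂ hT, comp_zero])
  refine ⟨Over.mk f', Over.homMk b hf', fun h => hcone _ hT' (hS _ fun p => hSg _) h,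
    fun i x hx => ?_⟩
  obtain ⟨y, rfl⟩ := Dist.lift₂ hT x hx
  obtain ⟨z, rfl⟩ := exists_comp_coverHom g y
  change _ ≫ b = 0
  rw [assoc, assoc, ← assoc (coverHom g W), Dist.comp₁₂ hT', comp_zero]

variable {g}

section Telescope
variable {Z : ℕ → T} (b : ∀ n, Z n ⟶ Z (n + 1)) {c : Cofan fun n : ULift.{w} ℕ => Z n.down}
  (hc : IsColimit c)

/-- The endomorphism of `⨁ Z n` given by the transition morphisms of a sequence `Z`. -/
def transition : c.pt ⟶ c.pt := Cofan.IsColimit.desc hc fun n => b n.down ≫ c.inj ⟨n.down + 1⟩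

lemma inj_transition (n : ℕ) : c.inj ⟨n⟩ ≫ transition b hc = b n ≫ c.inj ⟨n + 1⟩ :=
  Cofan.IsColimit.fac ..

/-- The effect of the transition morphisms on the direct sum of the groups `Hom(a, Z n)`. -/
def transitionHom (a : T) : DirectSum (ULift.{w} ℕ) (fun n => a ⟶ Z n.down) →+
    DirectSum (ULift.{w} ℕ) (fun n => a ⟶ Z n.down) :=
  DirectSum.toAddMonoid fun n => (DirectSum.of (fun n : ULift.{w} ℕ => a ⟶ Z n.down) ⟨n.down + 1⟩).comp
    (Preadditive.rightComp a (b n.down))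

lemma transitionHom_zero {a : T} (x) : transitionHom b a x ⟨0⟩ = 0 := by
  induction x using DirectSum.induction_on with
  | zero => simp
  | add x y hx hy => rw [map_add, DirectSum.add_apply, hx, hy, add_zero]
  | of n f =>
    rw [transitionHom, DirectSum.toAddMonoid_of]
    exact DirectSum.of_eq_of_ne _ _ _ (by simp)

lemma transitionHom_succ {a : T} (x) (n : ℕ) : transitionHom b a x ⟨n + 1⟩ = x ⟨n⟩ ≫ b n := by
  induction x using DirectSum.induction_on with
  | zero => simp
  | add x y hx hy => rw [map_add, DirectSum.add_apply, hx, hy, DirectSum.add_apply, Preadditive.add_comp]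
  | of m f =>
    rw [transitionHom, DirectSum.toAddMonoid_of]
    obtain ⟨m⟩ := m
    by_cases h : m = n
    · subst h
      simp [Preadditive.rightComp]
    · rw [DirectSum.of_eq_of_ne _ _ _ (by simpa using fun h' => h h'.symm)]
      simp only [AddMonoidHom.comp_apply]
      rw [DirectSum.of_eq_of_ne _ _ _ (by simpa using fun h' => h h'.symm)]
      simp

lemma homSum_transitionHom {a : T} (x) :
    homSum a c (transitionHom b a x) = homSum a c x ≫ transition b hc := by
  induction x using DirectSum.induction_on with
  | zero => simp
  | add x y hx hy => rw [map_add, map_add, map_add, hx, hy, Preadditive.add_comp]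
  | of n f =>
    rw [transitionHom, DirectSum.toAddMonoid_of, homSum_of, assoc]
    simp only [AddMonoidHom.comp_apply]
    rw [homSum_of, show c.inj n ≫ transition b hc = _ from inj_transition b hc n.down]
    simp [Preadditive.rightComp]

/-- On morphisms from a compact object, `1 - transition` is injective: the components of an element
of the direct sum fixed by the transition morphisms vanish inductively. -/
lemma telescope_injective {a : T} (ha : IsCompactObject a) (y : a ⟶ c.pt)
    (hy : y ≫ (𝟙 _ - transition b hc) = 0) : y = 0 := by
  obtain ⟨x, rfl⟩ := (ha.bijective_homSum c hc).2 y
  rw [Preadditive.comp_sub, comp_id, ← homSum_transitionHom, sub_eq_zero] at hy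
  have hx := (ha.bijective_homSum c hc).1 hy
  suffices x = 0 by rw [this, map_zero]
  ext ⟨n⟩
  induction n with
  | zero => rw [hx, transitionHom_zero]; rfl
  | succ n ih =>
    rw [hx, transitionHom_succ, ih]
    exact zero_comp

/-- Modulo the image of `1 - transition`, a morphism to a term of the sequence may be moved to any
later term. -/
lemma telescope_step {a : T} (n : ℕ) (x : a ⟶ Z n) (k : ℕ) : ∃ (x' : a ⟶ Z (n + k)) (z : a ⟶ c.pt),
    x ≫ c.inj ⟨n⟩ = x' ≫ c.inj ⟨n + k⟩ + z ≫ (𝟙 _ - transition b hc) := by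
  induction k with
  | zero => exact ⟨x, 0, by simp⟩
  | succ k ih =>
    obtain ⟨x', z, h⟩ := ih
    refine ⟨x' ≫ b _, z + x' ≫ c.inj ⟨n + k⟩, ?_⟩
    have := inj_transition b hc (n + k)
    change _ = (x' ≫ b _) ≫ c.inj ⟨n + k + 1⟩ + _
    rw [h, Preadditive.add_comp, assoc, assoc, ← this, Preadditive.comp_sub,
      Preadditive.comp_sub, Preadditive.comp_sub]
    simp only [comp_id]
    abel

/-- Modulo the image of `1 - transition`, a morphism from a compact object to the direct sum comes
from a single term of the sequence. -/
lemma telescope_surjective {a : T} (ha : IsCompactObject a) (y : a ⟶ c.pt) :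
    ∃ (n : ℕ) (x : a ⟶ Z n) (z : a ⟶ c.pt),
      y = x ≫ c.inj ⟨n⟩ + z ≫ (𝟙 _ - transition b hc) := by
  obtain ⟨x, rfl⟩ := (ha.bijective_homSum c hc).2 y
  induction x using DirectSum.induction_on with
  | zero => exact ⟨0, 0, 0, by simp⟩
  | of n f => exact ⟨n.down, f, 0, by simp⟩
  | add x y hx hy =>
    obtain ⟨n, x₁, z₁, h₁⟩ := hx
    obtain ⟨m, x₂, z₂, h₂⟩ := hy
    obtain ⟨x₁', z₁', h₁'⟩ := telescope_step b hc n x₁ m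
    obtain ⟨x₂', z₂', h₂'⟩ : ∃ (x' : a ⟶ Z (n + m)) (z : a ⟶ c.pt),
        x₂ ≫ c.inj ⟨m⟩ = x' ≫ c.inj ⟨n + m⟩ + z ≫ (𝟙 _ - transition b hc) := by
      rw [add_comm n m]
      exact telescope_step b hc m x₂ n
    refine ⟨n + m, x₁' + x₂', z₁ + z₂ + z₁' + z₂', ?_⟩
    rw [map_add, h₁, h₂, h₁', h₂']
    simp only [Preadditive.add_comp]
    abel

end Telescope

variable (g)

/-- A compact generating family generates as a localizing subcategory: a property of objects which
is stable under direct sums and cones and holds for the generators holds for all objects. -/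
theorem IsGenerating.of_localizing (hgen : IsGenerating g) (hg : ∀ i, IsCompactObject (g i))
    [S.IsClosedUnderIsomorphisms]
    (hS : ∀ {J : Type w} (X : J → T), (∀ j, S (X j)) → S (∐ X))
    (hcone : ∀ Δ ∈ distTriang T, S Δ.obj₁ → S Δ.obj₂ → S Δ.obj₃) (hSg : ∀ i, S (g i)) (X : T) :
    S X := by
  -- `X` is the homotopy colimit `L` of a sequence `Z` of objects over `X` which satisfy `S`
  choose next b hnext hb using @exists_next T _ _ _ _ _ _ _ _ g S hS hcone hSg X
  let Z : ℕ → Over X := fun n => Nat.rec (Over.mk (coverHom g X)) (fun _ => next) n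
  have hSZ (n : ℕ) : S (Z n).left := by
    induction n with
    | zero => exact hS _ fun _ => hSg _
    | succ n ih => exact hnext _ ih
  let bZ (n : ℕ) : (Z n).left ⟶ (Z (n + 1)).left := (b (Z n)).left
  have hbZ (n : ℕ) : bZ n ≫ (Z (n + 1)).hom = (Z n).hom := Over.w (b (Z n))
  let hc := coproductIsCoproduct fun n : ULift.{w} ℕ => (Z n.down).left
  let c : Cofan (fun n : ULift.{w} ℕ => (Z n.down).left) := Cofan.mk _ (Sigma.ι _)
  obtain ⟨L, q, r, hT⟩ := distinguished_cocone_triangle (𝟙 _ - transition bZ hc)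
  let f : c.pt ⟶ X := Cofan.IsColimit.desc hc fun n => (Z n.down).hom
  have hf (n : ℕ) : c.inj ⟨n⟩ ≫ f = (Z n).hom := Cofan.IsColimit.fac hc _ _
  have hqf : (𝟙 _ - transition bZ hc) ≫ f = 0 := by
    refine Cofan.IsColimit.hom_ext hc _ _ fun n => ?_
    have := (reassoc_of% inj_transition bZ hc n.down) f
    rw [Preadditive.sub_comp, Preadditive.comp_sub, id_comp, comp_zero, sub_eq_zero]
    refine (hf n.down).trans (Eq.trans ?_ this.symm)
    exact ((congrArg (bZ n.down ≫ ·) (hf (n.down + 1))).trans (hbZ _)).symm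
  obtain ⟨f', hf'⟩ := Dist.desc₂ hT f hqf
  have hq := Dist.comp₁₂ hT
  have : IsIso f' := by
    refine hgen.isIso f' (fun i x hx => ?_) (fun i y => ?_)
    · have h₀ : x ≫ r = 0 := hgen.shift_injective (𝟙 _ - transition bZ hc)
        (fun j y hy => telescope_injective bZ hc (hg j) y hy) 1 i _ (by
          rw [assoc, Dist.comp₃₁ hT, comp_zero])
      obtain ⟨y, rfl⟩ := Dist.lift₃ hT x h₀
      obtain ⟨n, z, z', rfl⟩ := telescope_surjective bZ hc (hg i) y
      rw [Preadditive.add_comp, assoc, assoc, hq, comp_zero, add_zero] at hx ⊢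
      rw [assoc, assoc, hf'] at hx
      have h₁ := hb _ i z ((congrArg (z ≫ ·) (hf n)).symm.trans hx)
      have h₂ : c.inj ⟨n⟩ ≫ q = bZ n ≫ c.inj ⟨n + 1⟩ ≫ q := by
        have := c.inj ⟨n⟩ ≫= hq
        rw [Preadditive.sub_comp, Preadditive.comp_sub, id_comp, comp_zero, sub_eq_zero] at this
        exact this.trans ((reassoc_of% inj_transition bZ hc n) q)
      refine (congrArg (z ≫ ·) h₂).trans ?_
      rw [← assoc]
      exact (congrArg (· ≫ c.inj ⟨n + 1⟩ ≫ q) h₁).trans zero_comp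
    · obtain ⟨x, rfl⟩ := exists_comp_coverHom g y
      refine ⟨x ≫ c.inj ⟨0⟩ ≫ q, ?_⟩
      rw [assoc, assoc, hf']
      exact congrArg (x ≫ ·) (hf 0)
  refine S.prop_of_iso (asIso f') (hcone _ hT ?_ ?_) <;> exact hS _ fun n => hSZ _

end Tower
end WeakTannaka

/-! ### The orbit category and its functor to `C'` -/

namespace WeakTannaka
open Pretriangulated

/-- A left adjoint preserves compact objects if its right adjoint preserves direct sums. -/
lemma IsCompactObject.of_adjunction {T : Type u₁} [Category.{w} T] [Preadditive T] {T' : Type u₂}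
    [Category.{w} T'] [Preadditive T'] {F : T ⥤ T'} [F.Additive] {G : T' ⥤ T} (adj : F ⊣ G)
    (hG : PreservesSums.{w} G) {a : T} (ha : IsCompactObject a) : IsCompactObject (F.obj a) := by
  intro J
  have := ha J
  have := hG J
  have hadd (X : T') (f f' : F.obj a ⟶ X) :
      adj.homEquiv a X (f + f') = adj.homEquiv a X f + adj.homEquiv a X f' := by
    have := adj.right_adjoint_additive
    simp only [Adjunction.homEquiv_unit]
    rw [G.map_add, Preadditive.comp_add]
  let e : G ⋙ preadditiveCoyoneda.obj (Opposite.op a) ≅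
      preadditiveCoyoneda.obj (Opposite.op (F.obj a)) :=
    (NatIso.ofComponents (fun X => AddEquiv.toAddCommGrpIso
      (AddEquiv.mk' (adj.homEquiv a X) (hadd X))) (fun {X Y} f => by
        apply AddCommGrpCat.ext
        intro (x : F.obj a ⟶ X)
        exact adj.homEquiv_naturality_right x f)).symm
  exact preservesColimitsOfShape_of_natIso e

namespace Orbit
variable {C : Type u} [Category.{v} C] [MonoidalCategory C] [Preadditive C] [MonoidalPreadditive C]
  {O : C} (P : TensorPowers O)

/-- Composition in the orbit category with the image of a morphism of `C`. -/
def postHom (a : C) {b c : C} (g : b ⟶ c) : Hom P a b →+ Hom P a c :=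
  DirectSum.map fun i => Preadditive.rightComp a (g ▷ P.obj i)

lemma postHom_single (a : C) {b c : C} (g : b ⟶ c) (i : ℤ) (f : a ⟶ b ⊗ P.obj i) :
    postHom P a g (single P a b i f) = single P a c i (f ≫ g ▷ P.obj i) := by
  simp only [postHom, DirectSum.map_of]
  rfl

lemma postHom_eq_comp (a : C) {b c : C} (g : b ⟶ c) (x : Hom P a b) :
    postHom P a g x = comp P a b c x (single P b c 0 (pure P g)) := by
  induction x using DirectSum.induction_on with
  | zero => simp
  | add x y hx hy => rw [map_add, map_add, AddMonoidHom.add_apply, hx, hy]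
  | of i f => rw [comp_pure, postHom_single]

lemma postHom_comp (a : C) {b c d : C} (g : b ⟶ c) (h : c ⟶ d) (x : Hom P a b) :
    postHom P a (g ≫ h) x = postHom P a h (postHom P a g x) := by
  induction x using DirectSum.induction_on with
  | zero => simp
  | add x y hx hy => rw [map_add, map_add, map_add, hx, hy]
  | of i f => rw [postHom_single, postHom_single, postHom_single, comp_whiskerRight, assoc]

lemma postHom_zero (a b c : C) (x : Hom P a b) : postHom P a (0 : b ⟶ c) x = 0 := by
  induction x using DirectSum.induction_on with
  | zero => simp
  | add x y hx hy => rw [map_add, hx, hy, add_zero]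
  | of i f =>
    rw [postHom_single, MonoidalPreadditive.zero_whiskerRight, comp_zero, map_zero]

end Orbit

section
variable {C : Type u} [Category.{v} C] [Preadditive C] [HasZeroObject C] [HasShift C ℤ]
    [∀ n : ℤ, (shiftFunctor C n).Additive] [Pretriangulated C]
    [MonoidalCategory C] [SymmetricCategory C] [TensorExact C]

/-- Exactness of `Hom(a, - ⊗ b)` on a distinguished triangle. -/
lemma TensorExact.lift₂ {X Y Z : C} {f : X ⟶ Y} {p : Y ⟶ Z} {q : Z ⟶ X⟦(1 : ℤ)⟧}
    (hT : Triangle.mk f p q ∈ distTriang C) {a : C} (b : C) (x : a ⟶ Y ⊗ b) (hx : x ≫ p ▷ b = 0) :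
    ∃ y, y ≫ f ▷ b = x := by
  obtain ⟨_, _⟩ := TensorExact.exists_isTriangulated b
  obtain ⟨y, hy⟩ : ∃ y : a ⟶ b ⊗ X, y ≫ b ◁ f = x ≫ (β_ Y b).hom :=
    Dist.lift₂ ((tensorLeft b).map_distinguished _ hT) (x ≫ (β_ Y b).hom) (by
      change (x ≫ (β_ Y b).hom) ≫ b ◁ p = 0
      rw [assoc, ← BraidedCategory.braiding_naturality_left, reassoc_of% hx, zero_comp])
  refine ⟨y ≫ (β_ X b).inv, ?_⟩
  rw [assoc, ← BraidedCategory.braiding_inv_naturality_right, reassoc_of% hy, Iso.hom_inv_id,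
    comp_id]

variable [MonoidalPreadditive C] {O : C} (P : TensorPowers O)

open Classical in
/-- Morphisms in the orbit category are exact on the distinguished triangles of `C`. -/
lemma Orbit.exact_postHom {X Y Z : C} {f : X ⟶ Y} {p : Y ⟶ Z} {q : Z ⟶ X⟦(1 : ℤ)⟧}
    (hT : Triangle.mk f p q ∈ distTriang C) (a : C) :
    Function.Exact (postHom P a f) (postHom P a p) := by
  intro x
  constructor
  · intro hx
    have (i : ℤ) : ∃ y, y ≫ f ▷ P.obj i = x i := TensorExact.lift₂ hT _ _ (by
      exact (DirectSum.map_apply _ i x).symm.trans (congrArg (· i) hx))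
    choose y hy using this
    refine ⟨∑ i ∈ DFinsupp.support x, single P a X i (y i), ?_⟩
    rw [map_sum]
    refine Eq.trans (Finset.sum_congr rfl fun i _ => ?_) (DirectSum.sum_support_of x)
    rw [postHom_single, hy]
  · rintro ⟨y, rfl⟩
    rw [← postHom_comp, Dist.comp₁₂ hT, postHom_zero]

end

namespace OrbitFactorization
section
variable {C : Type u₁} [Category.{v₁} C] [MonoidalCategory C] [Preadditive C]
    [MonoidalPreadditive C] {C' : Type u₂} [Category.{v₂} C'] [MonoidalCategory C'] [Preadditive C']
    {O : C} {P : TensorPowers O} {F : C ⥤ C'} [F.Monoidal] (E : OrbitFactorization P F)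

lemma mapHom_comp {a b c : C} (f : (Orbit.π P).obj a ⟶ (Orbit.π P).obj b)
    (g : (Orbit.π P).obj b ⟶ (Orbit.π P).obj c) :
    E.mapHom (f ≫ g) = E.mapHom f ≫ E.mapHom g := by
  simp [mapHom]

lemma mapHom_map {a b : C} (f : a ⟶ b) : E.mapHom ((Orbit.π P).map f) = F.map f := by
  have := E.iso.hom.naturality f
  simp only [mapHom]
  refine (congrArg (E.iso.inv.app a ≫ ·) this).trans ?_
  simp

/-- The map on morphisms given by the factorization, as a group homomorphism. -/
def mapAddHom (a b : C) : Orbit.Hom P a b →+ (F.obj a ⟶ F.obj b) :=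
  AddMonoidHom.mk' (fun f => E.mapHom (a := a) (b := b) f) fun f f' => by
    have := E.additive
    have h := E.functor.map_add (f := (f : (Orbit.π P).obj a ⟶ (Orbit.π P).obj b)) (g := f')
    simp only [mapHom]
    refine (congrArg (fun z => E.iso.inv.app a ≫ z ≫ E.iso.hom.app b) h).trans ?_
    exact (congrArg _ (Preadditive.add_comp _ _ _ _ _ _)).trans (Preadditive.comp_add _ _ _ _ _ _)

lemma mapAddHom_comp {a b c : C} (x : Orbit.Hom P a b) (y : Orbit.Hom P b c) :
    E.mapAddHom a c (Orbit.comp P a b c x y) = E.mapAddHom a b x ≫ E.mapAddHom b c y :=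
  E.mapHom_comp (a := a) (b := b) (c := c) x y

lemma mapAddHom_pure {a b : C} (f : a ⟶ b) :
    E.mapAddHom a b (Orbit.single P a b 0 (Orbit.pure P f)) = F.map f :=
  E.mapHom_map f

lemma mapAddHom_postHom {a b c : C} (x : Orbit.Hom P a b) (g : b ⟶ c) :
    E.mapAddHom a c (Orbit.postHom P a g x) = E.mapAddHom a b x ≫ F.map g := by
  rw [Orbit.postHom_eq_comp, mapAddHom_comp, mapAddHom_pure]

lemma bijective_mapAddHom_of_iso {a a' b b' : C} (e : a ≅ a') (e' : b ≅ b')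
    (h : Function.Bijective (E.mapAddHom a b)) : Function.Bijective (E.mapAddHom a' b') := by
  let i := (Orbit.π P).mapIso e
  let i' := (Orbit.π P).mapIso e'
  let U : (F.obj a ⟶ F.obj b) ≃ (F.obj a' ⟶ F.obj b') := Iso.homCongr (F.mapIso e) (F.mapIso e')
  let V : ((Orbit.π P).obj a' ⟶ (Orbit.π P).obj b') ≃ ((Orbit.π P).obj a ⟶ (Orbit.π P).obj b) :=
    Iso.homCongr i.symm i'.symm
  suffices key : ⇑(E.mapAddHom a' b') = (U ∘ E.mapAddHom a b) ∘ V by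
    rw [key]
    exact (U.bijective.comp h).comp V.bijective
  funext x
  have hx (x : (Orbit.π P).obj a' ⟶ (Orbit.π P).obj b') :
      E.mapHom x = F.map e.inv ≫ E.mapHom (i.hom ≫ x ≫ i'.inv) ≫ F.map e'.hom := by
    rw [mapHom_comp, mapHom_comp]
    simp only [i, i', Functor.mapIso_hom, Functor.mapIso_inv, mapHom_map, assoc]
    simp only [← F.map_comp, ← F.map_comp_assoc, Iso.inv_hom_id, F.map_id, comp_id, id_comp]
  exact hx x

end

section
variable {C : Type u₁} [Category.{v₁} C] [Preadditive C] [HasZeroObject C] [HasShift C ℤ]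
    [∀ n : ℤ, (shiftFunctor C n).Additive] [Pretriangulated C]
    [MonoidalCategory C] [SymmetricCategory C] [MonoidalPreadditive C] [TensorExact C]
    {C' : Type u₂} [Category.{v₂} C'] [Preadditive C'] [HasZeroObject C'] [HasShift C' ℤ]
    [∀ n : ℤ, (shiftFunctor C' n).Additive] [Pretriangulated C'] [MonoidalCategory C']
    {O : C} {P : TensorPowers O} {F : C ⥤ C'} [F.CommShift ℤ] [F.IsTriangulated] [F.Monoidal]
    (E : OrbitFactorization P F)

/-- The five lemma for the maps from morphisms in the orbit category to morphisms in `C'`. -/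
lemma bijective_mapAddHom_obj₃ (Δ : Triangle C) (hΔ : Δ ∈ distTriang C) (a : C)
    (h₁ : Function.Bijective (E.mapAddHom a Δ.obj₁))
    (h₂ : Function.Bijective (E.mapAddHom a Δ.obj₂))
    (h₄ : Function.Bijective (E.mapAddHom a (Δ.obj₁⟦(1 : ℤ)⟧)))
    (h₅ : Function.Bijective (E.mapAddHom a (Δ.obj₂⟦(1 : ℤ)⟧))) :
    Function.Bijective (E.mapAddHom a Δ.obj₃) := by
  have hR := rot_of_distTriang _ hΔ
  have hRR := rot_of_distTriang _ hR
  have exact' {X Y Z : C} {f : X ⟶ Y} {p : Y ⟶ Z} {q : Z ⟶ X⟦(1 : ℤ)⟧}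
      (hT : Triangle.mk f p q ∈ distTriang C) : Function.Exact
      (Preadditive.rightComp (F.obj a) (F.map f)) (Preadditive.rightComp (F.obj a) (F.map p)) :=
    fun x => ⟨fun hx => Dist.lift₂ (F.map_distinguished _ hT) x hx, by
      rintro ⟨y, rfl⟩
      change (y ≫ F.map f) ≫ F.map p = 0
      rw [assoc, ← F.map_comp, Dist.comp₁₂ hT, F.map_zero, comp_zero]⟩
  have sq {b c : C} (f : b ⟶ c) : (Preadditive.rightComp (F.obj a) (F.map f)).comp
      (E.mapAddHom a b) = (E.mapAddHom a c).comp (Orbit.postHom P a f) := by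
    refine AddMonoidHom.ext fun x => ?_
    exact (E.mapAddHom_postHom x f).symm
  exact AddMonoidHom.bijective_of_surjective_of_bijective_of_bijective_of_injective
    _ _ _ _ _ _ _ _ _ _ _ _ _
    (sq Δ.mor₁) (sq Δ.mor₂) (sq Δ.mor₃) (sq (-Δ.mor₁⟦(1 : ℤ)⟧'))
    (Orbit.exact_postHom P hΔ a) (Orbit.exact_postHom P hR a) (Orbit.exact_postHom P hRR a)
    (exact' hΔ) (exact' hR) (exact' hRR) h₁.2 h₂ h₄ h₅.1

end

section
variable {C : Type u₁} [Category.{w} C] [Preadditive C]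
    [MonoidalCategory C] [SymmetricCategory C] [MonoidalPreadditive C]
    {C' : Type u₂} [Category.{w} C'] [Preadditive C'] [MonoidalCategory C']
    {O : C} {P : TensorPowers O} {F : C ⥤ C'} [F.Additive] [F.Monoidal]
    (E : OrbitFactorization P F)

/-- Tensor products with the powers of `O` are equivalences, so that they preserve direct sums. -/
lemma _root_.WeakTannaka.TensorPowers.isEquivalence_tensorRight_obj (P : TensorPowers O) (i : ℤ) :
    (tensorRight (P.obj i)).IsEquivalence :=
  TensorPowers.isEquivalence_tensorRight ⟨P.obj (-i), ⟨P.mul i (-i) ≪≫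
    eqToIso (congrArg P.obj (add_neg_cancel i)) ≪≫ P.one.symm⟩⟩

/-- Morphisms in the orbit category from a compact object to a direct sum are sums of morphisms
to the summands. -/
lemma exists_sum_postHom {a : C} (ha : IsCompactObject a) {J : Type w} [DecidableEq J] {X : J → C}
    (c : Cofan X) (hc : IsColimit c) (x : Orbit.Hom P a c.pt) :
    ∃ y : DirectSum J (fun j => Orbit.Hom P a (X j)),
      DirectSum.toAddMonoid (fun j => Orbit.postHom P a (c.inj j)) y = x := by
  induction x using DirectSum.induction_on with
  | zero => exact ⟨0, map_zero _⟩
  | add x y hx hy =>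
    obtain ⟨x, rfl⟩ := hx
    obtain ⟨y, rfl⟩ := hy
    exact ⟨x + y, map_add _ _ _⟩
  | of i f =>
    have := P.isEquivalence_tensorRight_obj i
    let d : Cofan fun j => X j ⊗ P.obj i := Cofan.mk (c.pt ⊗ P.obj i) fun j => c.inj j ▷ P.obj i
    have hd : IsColimit d := isColimitCofanMkObjOfIsColimit (tensorRight (P.obj i)) X c.inj
      (hc.ofIsoColimit (Cofan.ext (Iso.refl _)))
    obtain ⟨z, rfl⟩ := (ha.bijective_homSum d hd).2 f
    induction z using DirectSum.induction_on with
    | zero => exact ⟨0, by rw [map_zero, map_zero, map_zero]⟩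
    | add x y hx hy =>
      obtain ⟨x', hx⟩ := hx
      obtain ⟨y', hy⟩ := hy
      exact ⟨x' + y', by rw [map_add, map_add, map_add, hx, hy]⟩
    | of j f =>
      refine ⟨DirectSum.of (fun j => Orbit.Hom P a (X j)) j (Orbit.single P a (X j) i f), ?_⟩
      rw [DirectSum.toAddMonoid_of, Orbit.postHom_single, homSum_of]
      rfl

/-- Bijectivity on morphisms from a compact object passes to direct sums in the target. -/
lemma bijective_mapAddHom_sum {a : C} (ha : IsCompactObject a) (ha' : IsCompactObject (F.obj a))
    (hF : PreservesSums.{w} F) {J : Type w} {X : J → C} (c : Cofan X) (hc : IsColimit c)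
    (h : ∀ j, Function.Bijective (E.mapAddHom a (X j))) :
    Function.Bijective (E.mapAddHom a c.pt) := by
  classical
  have := hF J
  let d : Cofan fun j => F.obj (X j) := Cofan.mk (F.obj c.pt) fun j => F.map (c.inj j)
  have hd : IsColimit d := isColimitCofanMkObjOfIsColimit F X c.inj
    (hc.ofIsoColimit (Cofan.ext (Iso.refl _)))
  have key (y : DirectSum J (fun j => Orbit.Hom P a (X j))) :
      E.mapAddHom a c.pt (DirectSum.toAddMonoid (fun j => Orbit.postHom P a (c.inj j)) y) =
        homSum (F.obj a) d (DirectSum.map (fun j => E.mapAddHom a (X j)) y) := by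
    induction y using DirectSum.induction_on with
    | zero => simp
    | add x y hx hy => simp only [map_add, hx, hy]
    | of j f =>
      rw [DirectSum.toAddMonoid_of, DirectSum.map_of, homSum_of, mapAddHom_postHom]
      rfl
  constructor
  · rw [injective_iff_map_eq_zero]
    intro x hx
    obtain ⟨y, rfl⟩ := exists_sum_postHom (P := P) ha c hc x
    rw [key, map_eq_zero_iff _ (ha'.bijective_homSum d hd).1, map_eq_zero_iff _
      ((DirectSum.map_injective _).2 fun j => (h j).1)] at hx
    rw [hx, map_zero]
  · intro z
    obtain ⟨z, rfl⟩ := (ha'.bijective_homSum d hd).2 z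
    obtain ⟨y, rfl⟩ := (DirectSum.map_surjective _).2 (fun j => (h j).2) z
    exact ⟨_, key y⟩

end

section
variable {C : Type u₁} [Category.{w} C] [Preadditive C] [HasZeroObject C] [HasShift C ℤ]
    [∀ n : ℤ, (shiftFunctor C n).Additive] [Pretriangulated C]
    [MonoidalCategory C] [SymmetricCategory C] [MonoidalPreadditive C] [TensorExact C]
    [HasCoproducts.{w} C]
    {C' : Type u₂} [Category.{w} C'] [Preadditive C'] [HasZeroObject C'] [HasShift C' ℤ]
    [∀ n : ℤ, (shiftFunctor C' n).Additive] [Pretriangulated C'] [MonoidalCategory C']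
    {O : C} {P : TensorPowers O} {F : C ⥤ C'} [F.CommShift ℤ] [F.IsTriangulated] [F.Monoidal]
    (E : OrbitFactorization P F)

/-- If the factorization is fully faithful on compact generators, then it is bijective on the
morphisms from a generator to an arbitrary object. -/
theorem bijective_mapAddHom {G : C' ⥤ C} (adj : F ⊣ G) (hF : PreservesSums.{w} F)
    (hG : PreservesSums.{w} G) {I : Type w} (g : I → C) (hg : ∀ i, IsCompactObject (g i))
    (hgen : IsGenerating g) (hE : ∀ i j, Function.Bijective (E.mapAddHom (g i) (g j)))
    (i : I) (b : C) : Function.Bijective (E.mapAddHom (g i) b) := by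
  let S : ObjectProperty C := fun b =>
    ∀ (n : ℤ) (i : I), Function.Bijective (E.mapAddHom (g i) (b⟦n⟧))
  have : S.IsClosedUnderIsomorphisms := ⟨fun e h n i =>
    E.bijective_mapAddHom_of_iso (Iso.refl _) ((shiftFunctor C n).mapIso e) (h n i)⟩
  have hb : S b := by
    refine hgen.of_localizing g S hg (fun {J} X hX n i => ?_) (fun Δ hΔ h₁ h₂ n i => ?_)
      (fun j n i => ?_) b
    -- `F (g i)` is compact because the right adjoint of `F` preserves direct sums
    · exact E.bijective_mapAddHom_sum (hg i) ((hg i).of_adjunction adj hG) hF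
        (Cofan.mk ((∐ X)⟦n⟧) fun j => (Sigma.ι X j)⟦n⟧')
        (isColimitCofanMkObjOfIsColimit (shiftFunctor C n) X _ (coproductIsCoproduct X))
        fun j => hX j n i
    · exact E.bijective_mapAddHom_obj₃ _ (Triangle.shift_distinguished Δ hΔ n) (g i)
        (h₁ n i) (h₂ n i)
        (E.bijective_mapAddHom_of_iso (Iso.refl _) ((shiftFunctorAdd C n 1).app _) (h₁ (n + 1) i))
        (E.bijective_mapAddHom_of_iso (Iso.refl _) ((shiftFunctorAdd C n 1).app _) (h₂ (n + 1) i))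
    · obtain ⟨k, ⟨e⟩⟩ := hgen.shift_closed j n
      exact E.bijective_mapAddHom_of_iso (Iso.refl _) e (hE i k)
  exact E.bijective_mapAddHom_of_iso (Iso.refl _) ((shiftFunctorZero C ℤ).app b) (hb 0 i)

end
end OrbitFactorization
end WeakTannaka

/-! ### The distinguished triangle of `t⁻¹ - 1` -/

namespace WeakTannaka
open Pretriangulated

/-- A short exact sequence on morphisms from generators comes from a distinguished triangle. -/
lemma IsGenerating.exists_distinguished {T : Type u} [Category.{v} T] [Preadditive T]
    [HasZeroObject T] [HasShift T ℤ] [∀ n : ℤ, (shiftFunctor T n).Additive] [Pretriangulated T]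
    {I : Type w} {g : I → T} (hg : IsGenerating g) {X Y Z : T} (d : X ⟶ Y) (f : Y ⟶ Z)
    (w : d ≫ f = 0) (inj : ∀ i (x : g i ⟶ X), x ≫ d = 0 → x = 0)
    (ex : ∀ i (y : g i ⟶ Y), y ≫ f = 0 → ∃ x, x ≫ d = y)
    (surj : ∀ i (z : g i ⟶ Z), ∃ y, y ≫ f = z) :
    ∃ r : Z ⟶ X⟦(1 : ℤ)⟧, Triangle.mk d f r ∈ distTriang T := by
  obtain ⟨Z', p, q, hT⟩ := distinguished_cocone_triangle d
  obtain ⟨k, hk⟩ := Dist.desc₂ hT f w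
  have : IsIso k := by
    refine hg.isIso k (fun i (x : g i ⟶ Z') hx => ?_) (fun i z => ?_)
    · obtain ⟨y, rfl⟩ := Dist.lift₃ hT x (hg.shift_injective d inj 1 i _ (by
        rw [assoc, Dist.comp₃₁ hT, comp_zero]))
      rw [assoc, hk] at hx
      obtain ⟨z, rfl⟩ := ex i y hx
      rw [assoc, Dist.comp₁₂ hT, comp_zero]
    · obtain ⟨y, rfl⟩ := surj i z
      exact ⟨y ≫ p, by rw [assoc, hk]⟩
  refine ⟨inv k ≫ q, isomorphic_distinguished _ hT _ ?_⟩
  refine Triangle.isoMk _ _ (Iso.refl _) (Iso.refl _) (asIso k).symm ?_ ?_ ?_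
  · change d ≫ 𝟙 _ = 𝟙 _ ≫ d
    rw [comp_id, id_comp]
  · change f ≫ inv k = 𝟙 _ ≫ p
    rw [id_comp, ← hk, assoc, IsIso.hom_inv_id, comp_id]
  · change (inv k ≫ q) ≫ (𝟙 X)⟦(1 : ℤ)⟧' = inv k ≫ q
    rw [(shiftFunctor T (1 : ℤ)).map_id, comp_id]

section
variable {L : ℤ → Type*} [∀ i, AddCommGroup (L i)] {N : Type*} [AddCommGroup N]
  (S : ∀ i, L i →+ L (1 + i)) (c : ∀ i, L i →+ N)

/-- For homomorphisms `L i → L (1 + i)`, the difference between the induced endomorphism of the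
direct sum of the groups `L i` and the identity. -/
def stepSubId : DirectSum ℤ L →+ DirectSum ℤ L :=
  DirectSum.toAddMonoid (fun i => (DirectSum.of L (1 + i)).comp (S i)) - AddMonoidHom.id _

lemma stepSubId_of (i : ℤ) (x : L i) : stepSubId S (DirectSum.of L i x) =
    DirectSum.of L (1 + i) (S i x) - DirectSum.of L i x := by
  simp [stepSubId]

/-- The component of index `1 + i` of the endomorphism of `⨁ L i` induced by `S`. -/
lemma step_apply (x : DirectSum ℤ L) (i : ℤ) :
    DirectSum.toAddMonoid (fun i => (DirectSum.of L (1 + i)).comp (S i)) x (1 + i) = S i (x i) := by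
  induction x using DirectSum.induction_on with
  | zero => simp
  | add x y hx hy => rw [map_add, DirectSum.add_apply, hx, hy, DirectSum.add_apply, map_add]
  | of j f =>
    rw [DirectSum.toAddMonoid_of]
    by_cases h : j = i
    · subst h
      simp
    · rw [DirectSum.of_eq_of_ne _ _ _ (Ne.symm h)]
      simp only [AddMonoidHom.comp_apply]
      rw [DirectSum.of_eq_of_ne _ _ _ (by omega), map_zero]

variable {S c}
variable (hS : ∀ i, Function.Bijective (S i)) (hc : ∀ i x, c (1 + i) (S i x) = c i x)
  (h₀ : Function.Bijective (c 0))

include hS hc h₀ in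
lemma bijective_of_step (i : ℤ) : Function.Bijective (c i) := by
  have h (i : ℤ) : Function.Bijective (c (1 + i)) ↔ Function.Bijective (c i) := by
    rw [← Function.Bijective.of_comp_iff _ (hS i)]
    exact iff_of_eq (congrArg _ (funext fun x => hc i x))
  induction i using Int.induction_on with
  | zero => exact h₀
  | succ n hn => rwa [add_comm, h]
  | pred n hn => rwa [← h, add_sub_cancel]

include hS hc h₀ in
/-- If the maps `S i : L i → L (1 + i)` are bijective and identify all the groups `L i` with `N`
through `c`, then `stepSubId` is multiplication by `T - 1` on `N[T, T⁻¹]`, and hence injective. -/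
lemma stepSubId_injective (x : DirectSum ℤ L) (hx : stepSubId S x = 0) : x = 0 := by
  classical
  have hb := bijective_of_step hS hc h₀
  have h (i : ℤ) : c (1 + i) (x (1 + i)) = c i (x i) := by
    have hx' := sub_eq_zero.1 hx
    have : x (1 + i) = S i (x i) := by
      rw [← step_apply S]
      exact (congrArg (· (1 + i)) hx').symm
    rw [this, hc]
  have hconst (i : ℤ) : c i (x i) = c 0 (x 0) := by
    induction i using Int.induction_on with
    | zero => rfl
    | succ n hn => rw [add_comm, h, hn]
    | pred n hn =>
      have := h (-n - 1)
      rw [add_sub_cancel] at this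
      rw [← this, hn]
  -- the value of `c i (x i)` is independent of `i`, and it vanishes for some `i`
  obtain ⟨k, hk⟩ := Infinite.exists_notMem_finset (DFinsupp.support x)
  have hk' : x k = 0 := by simpa using hk
  refine DFinsupp.ext fun i => (hb i).1 ?_
  rw [hconst, ← hconst k, hk', map_zero]
  exact (map_zero (c i)).symm

include hS hc h₀ in
/-- The cokernel of multiplication by `T - 1` on `N[T, T⁻¹]` is `N`, by evaluation at `1`. -/
lemma exists_stepSubId_eq (x : DirectSum ℤ L) (hx : DirectSum.toAddMonoid c x = 0) :
    ∃ y, stepSubId S y = x := by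
  have h (y) : DirectSum.toAddMonoid c (stepSubId S y) = 0 := by
    induction y using DirectSum.induction_on with
    | zero => simp
    | add x y hx hy => rw [map_add, map_add, hx, hy, add_zero]
    | of i f => simp [stepSubId_of, hc]
  -- modulo the image of `stepSubId`, everything comes from `L 0`
  have h' (i : ℤ) : ∀ f : L i, ∃ (f₀ : L 0) (y : DirectSum ℤ L),
      DirectSum.of L i f = DirectSum.of L 0 f₀ + stepSubId S y := by
    induction i using Int.induction_on with
    | zero => exact fun f => ⟨f, 0, by simp⟩
    | succ n hn =>
      rw [add_comm]
      intro f
      obtain ⟨f, rfl⟩ := (hS n).2 f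
      obtain ⟨f₀, y, hy⟩ := hn f
      refine ⟨f₀, y + DirectSum.of L n f, ?_⟩
      rw [map_add, stepSubId_of, ← add_assoc, ← hy]
      abel
    | pred n hn =>
      intro f
      have e : -(n : ℤ) = 1 + (-n - 1) := by omega
      rw [e] at hn
      obtain ⟨f₀, y, hy⟩ := hn (S _ f)
      refine ⟨f₀, y - DirectSum.of L _ f, ?_⟩
      rw [map_sub, stepSubId_of, ← add_sub_assoc, ← hy]
      abel
  have h'' (x : DirectSum ℤ L) : ∃ (f₀ : L 0) (y : DirectSum ℤ L),
      x = DirectSum.of L 0 f₀ + stepSubId S y := by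
    induction x using DirectSum.induction_on with
    | zero => exact ⟨0, 0, by simp⟩
    | add x y hx hy =>
      obtain ⟨f₁, y₁, h₁⟩ := hx
      obtain ⟨f₂, y₂, h₂⟩ := hy
      exact ⟨f₁ + f₂, y₁ + y₂, by rw [h₁, h₂, map_add, map_add]; abel⟩
    | of i f => exact h' i f
  obtain ⟨f₀, y, rfl⟩ := h'' x
  rw [map_add, h, add_zero, DirectSum.toAddMonoid_of] at hx
  rw [(map_eq_zero_iff _ h₀.1).1 hx]
  exact ⟨y, by simp⟩
end

namespace OrbitFactorization
open Functor.OplaxMonoidal Functor.LaxMonoidal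

section
variable {C : Type u₁} [Category.{v₁} C] [MonoidalCategory C] [Preadditive C]
    [MonoidalPreadditive C] {C' : Type u₂} [Category.{v₂} C'] [MonoidalCategory C'] [Preadditive C']
    {O : C} {P : TensorPowers O} {F : C ⥤ C'} [F.Monoidal] (E : OrbitFactorization P F)

lemma _root_.WeakTannaka.Orbit.trivialization_hom (P : TensorPowers O) :
    (Orbit.trivialization P).hom = Orbit.single P O (𝟙_ C) 1 (P.gen.hom ≫ (λ_ _).inv) :=
  Orbit.pure_comp P 1 P.gen.hom (λ_ (P.obj 1)).inv

lemma objIso_hom :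
    E.objIso.hom = E.mapAddHom O (𝟙_ C) (Orbit.single P O (𝟙_ C) 1 (P.gen.hom ≫ (λ_ _).inv)) ≫ η F := by
  rw [← Orbit.trivialization_hom]
  change _ = (E.iso.inv.app O ≫ _ ≫ E.iso.hom.app _) ≫ η F
  simp [objIso]

/-- The isomorphism `π (B ⊗ O) ≅ π B` of degree `1` is sent to the one given by the trivialization of
`F O`. -/
lemma mapAddHom_whiskerLeft_gen (B : C) :
    E.mapAddHom (B ⊗ O) B (Orbit.single P (B ⊗ O) B 1 (B ◁ P.gen.hom)) =
      δ F B O ≫ F.obj B ◁ E.objIso.hom ≫ (ρ_ _).hom := by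
  have h := E.whiskerLeft_eq B O (𝟙_ C) (Orbit.single P O (𝟙_ C) 1 (P.gen.hom ≫ (λ_ _).inv))
  change E.mapAddHom (B ⊗ O) (B ⊗ 𝟙_ C) (Orbit.whiskerHom P B O (𝟙_ C)
    (Orbit.single P O (𝟙_ C) 1 (P.gen.hom ≫ (λ_ _).inv))) = δ F B O ≫ F.obj B ◁ (E.mapAddHom O (𝟙_ C)
      (Orbit.single P O (𝟙_ C) 1 (P.gen.hom ≫ (λ_ _).inv))) ≫ μ F _ _ at h
  have h' := E.mapAddHom_postHom (Orbit.whiskerHom P B O (𝟙_ C)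
    (Orbit.single P O (𝟙_ C) 1 (P.gen.hom ≫ (λ_ _).inv))) (ρ_ B).hom
  rw [h] at h'
  have e : Orbit.postHom P (B ⊗ O) (ρ_ B).hom (Orbit.whiskerHom P B O (𝟙_ C)
      (Orbit.single P O (𝟙_ C) 1 (P.gen.hom ≫ (λ_ _).inv))) =
      Orbit.single P (B ⊗ O) B 1 (B ◁ P.gen.hom) := by
    rw [Orbit.whiskerHom, DirectSum.toAddMonoid_of, AddMonoidHom.mk'_apply, Orbit.postHom_single]
    simp
  rw [e] at h'
  rw [h', E.objIso_hom, Functor.Monoidal.map_rightUnitor]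
  simp

end

section
variable {C : Type u₁} [Category.{v₁} C] [MonoidalCategory C] [SymmetricCategory C] [Preadditive C]
    [MonoidalPreadditive C] {C' : Type u₂} [Category.{v₂} C'] [MonoidalCategory C']
    [SymmetricCategory C'] [Preadditive C']
    {D : Type u₃} [Category.{v₃} D] [MonoidalCategory D] [SymmetricCategory D]
    {O : C} {P : TensorPowers O} {F : C ⥤ C'} [F.Braided] (E : OrbitFactorization P F)
    {ω' : C' ⥤ D} [ω'.Braided] (A : WeakTannakian (F ⋙ ω')) (A' : WeakTannakian ω')

/-- The isomorphism `right 𝟙 ≅ right 𝟙 ⊗ O`, with target the first power of `O`. -/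
def actPow (E : OrbitFactorization P F) : A.alg ≅ A.alg ⊗ P.obj 1 :=
  (actIso A E.objIso).symm ≪≫ whiskerLeftIso _ P.gen

/-- The automorphism of `F (right 𝟙)` given by the trivialization of `F O` comes from the orbit
category, where its inverse is homogeneous of degree `1`. -/
lemma mapAddHom_actPow : E.mapAddHom A.alg A.alg
    (Orbit.single P A.alg A.alg 1 (E.actPow A).hom) = (twistIso A E.objIso).inv := by
  have := Orbit.pure_comp P 1 (actIso A E.objIso).inv (A.alg ◁ P.gen.hom)
  change _ = Orbit.single P A.alg A.alg 1 (E.actPow A).hom at this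
  rw [← this, mapAddHom_comp, mapAddHom_pure, mapAddHom_whiskerLeft_gen, twistIso_inv]

/-- Composition with `actPow` in the orbit category, on homogeneous morphisms. -/
def actStep (a : C) (i : ℤ) : (a ⟶ A.alg ⊗ P.obj i) →+ (a ⟶ A.alg ⊗ P.obj (1 + i)) :=
  AddMonoidHom.mk' (fun f => Orbit.compHom P i 1 f (E.actPow A).hom) (by simp [Orbit.compHom])

lemma bijective_actStep (a : C) (i : ℤ) : Function.Bijective (E.actStep A a i) :=
  ((whiskerRightIso (E.actPow A) (P.obj i) ≪≫ α_ _ _ _ ≪≫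
    whiskerLeftIso A.alg (P.mul 1 i)).homToEquiv (Z := a)).bijective

lemma mapAddHom_actStep (a : C) (i : ℤ) (f : a ⟶ A.alg ⊗ P.obj i) :
    E.mapAddHom a A.alg (Orbit.single P a A.alg (1 + i) (E.actStep A a i f)) =
      E.mapAddHom a A.alg (Orbit.single P a A.alg i f) ≫ (twistIso A E.objIso).inv := by
  rw [← mapAddHom_actPow, ← mapAddHom_comp, Orbit.comp_single]
  rfl

lemma mapAddHom_stepSubId (a : C) (x : Orbit.Hom P a A.alg) :
    E.mapAddHom a A.alg (stepSubId (E.actStep A a) x) =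
      E.mapAddHom a A.alg x ≫ ((twistIso A E.objIso).inv - 𝟙 _) := by
  induction x using DirectSum.induction_on with
  | zero => simp
  | add x y hx hy => simp only [map_add, hx, hy, Preadditive.add_comp]
  | of i f =>
    rw [stepSubId_of, map_sub, mapAddHom_actStep, Preadditive.comp_sub, comp_id]

/-- The maps `Hom(a, right 𝟙 ⊗ O^i) ⟶ Hom(F a, right' 𝟙)`. -/
def algHomPart (a : C) (i : ℤ) : (a ⟶ A.alg ⊗ P.obj i) →+ (F.obj a ⟶ A'.alg) :=
  (Preadditive.rightComp (F.obj a) (algHom A A')).comp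
    ((E.mapAddHom a A.alg).comp (Orbit.single P a A.alg i))

lemma algHomPart_actStep (a : C) (i : ℤ) (f : a ⟶ A.alg ⊗ P.obj i) :
    E.algHomPart A A' a (1 + i) (E.actStep A a i f) = E.algHomPart A A' a i f := by
  change E.mapAddHom a A.alg (Orbit.single P a A.alg (1 + i) (E.actStep A a i f)) ≫ algHom A A' =
    E.mapAddHom a A.alg (Orbit.single P a A.alg i f) ≫ algHom A A'
  rw [mapAddHom_actStep, assoc, twistIso_inv_algHom]

lemma toAddMonoid_algHomPart (a : C) (x : Orbit.Hom P a A.alg) :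
    DirectSum.toAddMonoid (E.algHomPart A A' a) x = E.mapAddHom a A.alg x ≫ algHom A A' := by
  induction x using DirectSum.induction_on with
  | zero => simp
  | add x y hx hy => simp only [map_add, hx, hy, Preadditive.add_comp]
  | of i f =>
    rw [DirectSum.toAddMonoid_of]
    rfl

/-- In degree zero, the maps are the bijections `Hom(a, right 𝟙) = Hom(ω a, 𝟙) = Hom(F a, right' 𝟙)`
of the adjunctions. -/
lemma bijective_algHomPart_zero (a : C) : Function.Bijective (E.algHomPart A A' a 0) := by
  let e : (a ⟶ A.alg) ≃ (F.obj a ⟶ A'.alg) :=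
    (A.adj.homEquiv a (𝟙_ D)).symm.trans (A'.adj.homEquiv (F.obj a) (𝟙_ D))
  have he (f : a ⟶ A.alg) : e f = F.map f ≫ algHom A A' := by
    apply A'.right_hom_ext
    change ω'.map (A'.adj.homEquiv (F.obj a) (𝟙_ D) ((A.adj.homEquiv a (𝟙_ D)).symm f)) ≫ _ =
      ω'.map _ ≫ A'.counit
    rw [A'.map_homEquiv_counit, ω'.map_comp, assoc, map_algHom_counit, Adjunction.homEquiv_counit]
    rfl
  let u : A.alg ≅ A.alg ⊗ P.obj 0 := (ρ_ _).symm ≪≫ whiskerLeftIso A.alg P.one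
  have hu : (E.algHomPart A A' a 0) ∘ u.homToEquiv (Z := a) = e := by
    funext f
    rw [he, ← E.mapAddHom_pure]
    rfl
  rw [← Function.Bijective.of_comp_iff _ (u.homToEquiv (Z := a)).bijective, hu]
  exact e.bijective

end

section
variable {C : Type u₁} [Category.{w} C] [Preadditive C]
    [MonoidalCategory C] [SymmetricCategory C] [MonoidalPreadditive C]
    {C' : Type u₂} [Category.{w} C'] [Preadditive C'] [HasZeroObject C'] [HasShift C' ℤ]
    [∀ n : ℤ, (shiftFunctor C' n).Additive] [Pretriangulated C'] [MonoidalCategory C']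
    [SymmetricCategory C']
    {D : Type u₃} [Category.{v₃} D] [MonoidalCategory D] [SymmetricCategory D]
    {O : C} {P : TensorPowers O} {F : C ⥤ C'} [F.Braided]
    (E : OrbitFactorization P F)
    {ω' : C' ⥤ D} [ω'.Braided] (A : WeakTannakian (F ⋙ ω')) (A' : WeakTannakian ω')

/-- The algebra `right' 𝟙` is the quotient of `F (right 𝟙)` by the difference of the identity and
the action of the trivialization of `O`. -/
theorem exists_distinguished {I : Type w} (g : I → C)
    (hgen' : IsGenerating (fun i => F.obj (g i)))
    (hE : ∀ i b, Function.Bijective (E.mapAddHom (g i) b)) :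
    ∃ r, Triangle.mk ((twistIso A E.objIso).inv - 𝟙 _) (algHom A A') r ∈ distTriang C' := by
  have hS (i : I) := E.bijective_actStep A (g i)
  have hc (i : I) := E.algHomPart_actStep A A' (g i)
  have h₀ (i : I) := E.bijective_algHomPart_zero A A' (g i)
  refine hgen'.exists_distinguished _ _ ?_ (fun i x hx => ?_) (fun i y hy => ?_) (fun i z => ?_)
  · rw [Preadditive.sub_comp, twistIso_inv_algHom, id_comp, sub_self]
  · obtain ⟨x, rfl⟩ := (hE i _).2 x
    rw [← mapAddHom_stepSubId, map_eq_zero_iff _ (hE i _).1] at hx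
    rw [stepSubId_injective (hS i) (hc i) (h₀ i) x hx, map_zero]
  · obtain ⟨y, rfl⟩ := (hE i _).2 y
    rw [← toAddMonoid_algHomPart] at hy
    obtain ⟨x, rfl⟩ := exists_stepSubId_eq (hS i) (hc i) (h₀ i) y hy
    exact ⟨_, (E.mapAddHom_stepSubId A (g i) x).symm⟩
  · obtain ⟨x, rfl⟩ := (h₀ i).2 z
    exact ⟨_, rfl⟩

end
end OrbitFactorization
end WeakTannaka

/-! ### Laurent polynomials with coefficients in a module -/

namespace WeakTannaka
open LaurentPolynomial

section
variable (R : Type w) [CommRing R]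

/-- Extension of scalars to `R[t, t⁻¹]`. -/
abbrev extMod : ModuleCat.{w} R ⥤ ModuleCat.{w} R[T;T⁻¹] := ModuleCat.extendScalars C

/-- Restriction of scalars from `R[t, t⁻¹]`. -/
abbrev resMod : ModuleCat.{w} R[T;T⁻¹] ⥤ ModuleCat.{w} R := ModuleCat.restrictScalars C

/-- The adjunction between extension and restriction of scalars along `R → R[t, t⁻¹]`. -/
abbrev extResAdj : extMod R ⊣ resMod R := ModuleCat.extendRestrictScalarsAdj C

/-- The inclusion `x ↦ t^i x` of the summand of index `i` of `N[t, t⁻¹]`. -/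
def powIncl (i : ℤ) : 𝟭 (ModuleCat.{w} R) ⟶ extMod R ⋙ resMod R where
  app N := (extResAdj R).unit.app N ≫ (resMod R).map ((T i : R[T;T⁻¹]) • 𝟙 _)
  naturality N N' f := by
    have h := (extResAdj R).unit.naturality f
    rw [← assoc, h, assoc, assoc, Functor.comp_map, ← Functor.map_comp, ← Functor.map_comp]
    simp

end

section
variable {R : Type w} [CommRing R] {N Z : ModuleCat.{w} R}

open ChangeOfRings

/-- The element `p x` of `N[t, t⁻¹]`. -/
def laurentTmul (p : R[T;T⁻¹]) (x : N) : (extMod R).obj N := p ⊗ₜ[R, C] x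

lemma smul_laurentTmul (q p : R[T;T⁻¹]) (x : N) :
    q • laurentTmul p x = laurentTmul (q * p) x := rfl

lemma add_laurentTmul (p q : R[T;T⁻¹]) (x : N) :
    laurentTmul (p + q) x = laurentTmul p x + laurentTmul q x := TensorProduct.add_tmul _ _ _

/-- Scalars may be moved across the tensor product. -/
lemma laurentTmul_smul (r : R) (p : R[T;T⁻¹]) (x : N) :
    laurentTmul p (r • x) = laurentTmul (C r * p) x :=
  (TensorProduct.smul_tmul (R := R) (M := (resMod R).obj (ModuleCat.of R[T;T⁻¹] R[T;T⁻¹])) (N := N)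
    r p x).symm

lemma powIncl_apply (i : ℤ) (x : N) : (powIncl R i).app N x = laurentTmul (T i) x :=
  (smul_laurentTmul (T i) 1 x).trans (by rw [mul_one])

lemma laurentTmul_C_mul_T (r : R) (i : ℤ) (x : N) :
    laurentTmul (C r * T i) x = (powIncl R i).app N (r • x) := by
  rw [powIncl_apply, laurentTmul_smul]

lemma laurent_induction {motive : (extMod R).obj N → Prop} (z : (extMod R).obj N)
    (zero : motive 0) (add : ∀ y z, motive y → motive z → motive (y + z))
    (powIncl : ∀ i x, motive ((powIncl R i).app N x)) : motive z := by
  induction z using TensorProduct.induction_on with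
  | zero => exact zero
  | add y z hy hz => exact add y z hy hz
  | tmul p x =>
    change motive (laurentTmul p x)
    induction p using LaurentPolynomial.induction_on' with
    | add p q hp hq =>
      rw [add_laurentTmul]
      exact add _ _ hp hq
    | C_mul_T n r =>
      rw [laurentTmul_C_mul_T]
      exact powIncl n _

/-- As an `R`-module, `N[t, t⁻¹]` is spanned by the images of the inclusions `powIncl i`. -/
lemma laurent_hom_ext {f g : (resMod R).obj ((extMod R).obj N) ⟶ Z}
    (h : ∀ i, (powIncl R i).app N ≫ f = (powIncl R i).app N ≫ g) : f = g := by
  ext z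
  induction z using laurent_induction with
  | zero => exact (map_zero f.hom).trans (map_zero g.hom).symm
  | add y z hy hz => exact (map_add f.hom _ _).trans ((congrArg₂ _ hy hz).trans (map_add g.hom _ _).symm)
  | powIncl i x => exact ConcreteCategory.congr_hom (h i) x

/-- Pairing of a Laurent polynomial with a family of homomorphisms. -/
def laurentPairing (g : ℤ → (N ⟶ Z)) : R[T;T⁻¹] →+ N →+ Z :=
  AddMonoidHom.comp (Finsupp.liftAddHom fun i => AddMonoidHom.mk'
    (fun r : R => (r • (g i).hom).toAddMonoidHom) (fun r s => by ext x; simp [add_smul]))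
    AddMonoidAlgebra.coeffAddEquiv.toAddMonoidHom

lemma laurentPairing_C_mul_T (g : ℤ → (N ⟶ Z)) (r : R) (i : ℤ) (x : N) :
    laurentPairing g (C r * T i) x = r • g i x := by
  have h : (C r * T i : R[T;T⁻¹]).coeff = Finsupp.single i r := by
    rw [← LaurentPolynomial.single_eq_C_mul_T]
    rfl
  simp [laurentPairing, h]

lemma laurentPairing_C_mul (g : ℤ → (N ⟶ Z)) (r : R) (p : R[T;T⁻¹]) (x : N) :
    laurentPairing g (C r * p) x = r • laurentPairing g p x := by
  induction p using LaurentPolynomial.induction_on' with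
  | add p q hp hq =>
    rw [mul_add, map_add, map_add, AddMonoidHom.add_apply, AddMonoidHom.add_apply, hp, hq, smul_add]
  | C_mul_T n s =>
    rw [← mul_assoc, ← map_mul, laurentPairing_C_mul_T, laurentPairing_C_mul_T, mul_smul]

lemma laurentPairing_smul (g : ℤ → (N ⟶ Z)) (r : R) (p : R[T;T⁻¹]) (x : N) :
    laurentPairing g p (r • x) = r • laurentPairing g p x := by
  induction p using LaurentPolynomial.induction_on' with
  | add p q hp hq =>
    rw [map_add, AddMonoidHom.add_apply, AddMonoidHom.add_apply, hp, hq, smul_add]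
  | C_mul_T n s =>
    rw [laurentPairing_C_mul_T, laurentPairing_C_mul_T, map_smul, smul_comm]

/-- The homomorphism on `N[t, t⁻¹]` given by its restrictions to the summands. -/
def laurentLift (g : ℤ → (N ⟶ Z)) : (extMod R).obj N →+ Z :=
  TensorProduct.liftAddHom (R := R) (M := (resMod R).obj (ModuleCat.of R[T;T⁻¹] R[T;T⁻¹])) (N := N)
    (laurentPairing g) fun r p x =>
      (laurentPairing_C_mul g r p x).trans (laurentPairing_smul g r p x).symm

lemma laurentLift_laurentTmul (g : ℤ → (N ⟶ Z)) (p : R[T;T⁻¹]) (x : N) :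
    laurentLift g (laurentTmul p x) = laurentPairing g p x := rfl

lemma laurentLift_powIncl (g : ℤ → (N ⟶ Z)) (i : ℤ) (x : N) :
    laurentLift g ((powIncl R i).app N x) = g i x := by
  have := laurentPairing_C_mul_T g 1 i x
  rw [map_one, one_mul, one_smul] at this
  rw [powIncl_apply, laurentLift_laurentTmul, this]

lemma laurentLift_C_smul (g : ℤ → (N ⟶ Z)) (r : R) (z : (extMod R).obj N) :
    laurentLift g ((C r : R[T;T⁻¹]) • z) = r • laurentLift g z := by
  induction z using laurent_induction with
  | zero => rw [smul_zero, map_zero, smul_zero]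
  | add y z hy hz => rw [smul_add, map_add, map_add, hy, hz, smul_add]
  | powIncl i x =>
    rw [powIncl_apply, smul_laurentTmul, laurentLift_laurentTmul, laurentLift_laurentTmul,
      laurentPairing_C_mul]

/-- The morphism on `N[t, t⁻¹]` given by its restrictions to the summands. -/
def laurentDesc (g : ℤ → (N ⟶ Z)) : (resMod R).obj ((extMod R).obj N) ⟶ Z :=
  ModuleCat.ofHom (X := (resMod R).obj ((extMod R).obj N))
    { laurentLift g with map_smul' := laurentLift_C_smul g }

lemma powIncl_laurentDesc (g : ℤ → (N ⟶ Z)) (i : ℤ) :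
    (powIncl R i).app N ≫ laurentDesc g = g i := by
  ext x
  exact laurentLift_powIncl g i x

end

section
variable (R : Type w) [CommRing R]

/-- Extension of scalars along `R[t, t⁻¹] → R`, `t ↦ 1`. -/
abbrev augMod : ModuleCat.{w} R[T;T⁻¹] ⥤ ModuleCat.{w} R := ModuleCat.extendScalars (aug R)

/-- The canonical morphisms `m ↦ 1 ⊗ m` for modules. -/
def unitAugMod : resMod R ⟶ augMod R :=
  (Functor.leftUnitor _).inv ≫ Functor.whiskerRight (ModuleCat.extendRestrictScalarsAdj (aug R)).unit
    (ModuleCat.restrictScalars C) ≫ (Functor.associator _ _ _).hom ≫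
    Functor.whiskerLeft _ ((ModuleCat.restrictScalarsComp' C (aug R) _ rfl).inv ≫
      (ModuleCat.restrictScalarsId' _ (aug_C R)).hom) ≫ (Functor.rightUnitor _).hom

/-- The canonical morphisms from `N` to the base change of `N[t, t⁻¹]` along `t ↦ 1`. -/
def toAugExt : 𝟭 (ModuleCat.{w} R) ⟶ extMod R ⋙ augMod R :=
  powIncl R 0 ≫ Functor.whiskerLeft (extMod R) (unitAugMod R)

variable {R}
lemma aug_T (i : ℤ) : aug R (T i) = 1 := by
  simp [aug]

lemma unitAugMod_smul {M : ModuleCat.{w} R[T;T⁻¹]} (p : R[T;T⁻¹]) (y : M) :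
    (unitAugMod R).app M (p • y) = aug R p • (unitAugMod R).app M y :=
  map_smul ((ModuleCat.extendRestrictScalarsAdj (aug R)).unit.app M).hom p y

variable (N : ModuleCat.{w} R)

/-- The morphism `N[t, t⁻¹] ⟶ N` with `t ↦ 1`. -/
def evalOne : (extMod R).obj N ⟶ (ModuleCat.restrictScalars (aug R)).obj N :=
  ((extResAdj R).homEquiv N ((ModuleCat.restrictScalars (aug R)).obj N)).symm
    (((ModuleCat.restrictScalarsId' _ (aug_C R)).inv ≫
      (ModuleCat.restrictScalarsComp' C (aug R) _ rfl).hom).app N)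

lemma evalOne_powIncl (i : ℤ) (x : N) : evalOne N ((powIncl R i).app N x) = x := by
  have h : evalOne N (laurentTmul 1 x) = x :=
    ConcreteCategory.congr_hom (Equiv.apply_symm_apply ((extResAdj R).homEquiv N
      ((ModuleCat.restrictScalars (aug R)).obj N)) _) x
  have h' : evalOne N ((T i : R[T;T⁻¹]) • laurentTmul 1 x) =
    aug R (T i) • (show N from evalOne N (laurentTmul 1 x)) := map_smul (evalOne N).hom _ _
  rw [powIncl_apply, ← mul_one (T i), ← smul_laurentTmul, h', aug_T, one_smul, h]

/-- The composite `R → R[t, t⁻¹] → R` being the identity, the base change of `N[t, t⁻¹]` is `N`. -/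
instance : IsIso ((toAugExt R).app N) := by
  let k : (augMod R).obj ((extMod R).obj N) ⟶ N :=
    ((ModuleCat.extendRestrictScalarsAdj (aug R)).homEquiv _ _).symm (evalOne N)
  have hk (y : (extMod R).obj N) : k ((unitAugMod R).app ((extMod R).obj N) y) = evalOne N y :=
    ConcreteCategory.congr_hom (Equiv.apply_symm_apply
      ((ModuleCat.extendRestrictScalarsAdj (aug R)).homEquiv _ _) (evalOne N)) y
  refine ⟨k, ?_, ?_⟩
  · ext x
    exact (hk _).trans (evalOne_powIncl N 0 x)
  · refine ModuleCat.ExtendScalars.hom_ext fun y => ?_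
    change (toAugExt R).app N (k ((unitAugMod R).app ((extMod R).obj N) y)) =
      (unitAugMod R).app ((extMod R).obj N) y
    rw [hk]
    induction y using laurent_induction with
    | zero =>
      exact (congrArg ((toAugExt R).app N).hom (map_zero (evalOne N).hom)).trans
        ((map_zero ((toAugExt R).app N).hom).trans
          (map_zero ((unitAugMod R).app ((extMod R).obj N)).hom).symm)
    | add y z hy hz =>
      exact (congrArg ((toAugExt R).app N).hom (map_add (evalOne N).hom y z)).trans
        ((map_add ((toAugExt R).app N).hom _ _).trans ((congrArg₂ (· + ·) hy hz).trans
          (map_add ((unitAugMod R).app ((extMod R).obj N)).hom y z).symm))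
    | powIncl i x =>
      rw [evalOne_powIncl]
      change (unitAugMod R).app ((extMod R).obj N) ((powIncl R 0).app N x) = _
      rw [powIncl_apply, powIncl_apply, ← mul_one (T i), ← smul_laurentTmul, unitAugMod_smul,
        ← mul_one (T 0), ← smul_laurentTmul, unitAugMod_smul, aug_T, aug_T]
end
end WeakTannaka

/-! ### Complexes of Laurent polynomials -/

namespace WeakTannaka
open LaurentPolynomial

section
variable (R : Type w) [CommRing R]

instance : (extMod R).Additive := (extResAdj R).left_adjoint_additive

instance : (augMod R).Additive :=
  (ModuleCat.extendRestrictScalarsAdj (aug R)).left_adjoint_additive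

/-- Extension of scalars to `R[t, t⁻¹]`, for complexes. -/
abbrev extC : CochainComplex (ModuleCat.{w} R) ℤ ⥤ CochainComplex (ModuleCat.{w} R[T;T⁻¹]) ℤ :=
  (extMod R).mapHomologicalComplex _

end

variable {R : Type w} [CommRing R] {X Y Z : CochainComplex (ModuleCat.{w} R) ℤ}

/-- The inclusion `x ↦ t^i x` of the summand of index `i` of the complex `X[t, t⁻¹]`. -/
def inclC (i : ℤ) (X : CochainComplex (ModuleCat.{w} R) ℤ) : X ⟶ (resC R).obj ((extC R).obj X) where
  f n := (powIncl R i).app (X.X n)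
  comm' n m _ := ((powIncl R i).naturality (X.d n m)).symm

lemma inclC_naturality (i : ℤ) (f : X ⟶ Y) :
    f ≫ inclC i Y = inclC i X ≫ (resC R).map ((extC R).map f) := by
  ext1 n
  exact (powIncl R i).naturality (f.f n)

lemma powIncl_tMul (i : ℤ) (N : ModuleCat.{w} R) : (powIncl R i).app N ≫
    (resMod R).map ((T 1 : R[T;T⁻¹]) • 𝟙 _) = (powIncl R (i + 1)).app N := by
  ext x
  change (T 1 : R[T;T⁻¹]) • (show (extMod R).obj N from (powIncl R i).app N x) =
    (powIncl R (i + 1)).app N x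
  rw [powIncl_apply, powIncl_apply, smul_laurentTmul, add_comm i 1, T_add]

lemma inclC_tMul (i : ℤ) : inclC i X ≫ (resC R).map (tMul R ((extC R).obj X)) = inclC (i + 1) X := by
  ext1 n
  exact powIncl_tMul i (X.X n)

lemma tMul_naturality {M M' : CochainComplex (ModuleCat.{w} R[T;T⁻¹]) ℤ} (f : M ⟶ M') :
    f ≫ tMul R M' = tMul R M ≫ f := by
  simp [tMul]

/-- In degree `n`, a morphism on `X[t, t⁻¹]` is given by its restrictions to the summands. -/
def descX {n : ℤ} {N : ModuleCat.{w} R} (g : ℤ → (X.X n ⟶ N)) :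
    ((resC R).obj ((extC R).obj X)).X n ⟶ N := laurentDesc g

lemma inclC_f_descX {n : ℤ} {N : ModuleCat.{w} R} (g : ℤ → (X.X n ⟶ N)) (i : ℤ) :
    (inclC i X).f n ≫ descX g = g i := powIncl_laurentDesc g i

lemma resC_extC_hom_ext {n : ℤ} {N : ModuleCat.{w} R}
    {f g : ((resC R).obj ((extC R).obj X)).X n ⟶ N}
    (h : ∀ i, (inclC i X).f n ≫ f = (inclC i X).f n ≫ g) : f = g := laurent_hom_ext h

/-- A morphism of complexes on `X[t, t⁻¹]` is given by its restrictions to the summands. -/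
def descC (g : ℤ → (X ⟶ Z)) : (resC R).obj ((extC R).obj X) ⟶ Z where
  f n := descX fun i => (g i).f n
  comm' n m _ := resC_extC_hom_ext fun i => by
    rw [reassoc_of% inclC_f_descX, HomologicalComplex.Hom.comm_assoc, inclC_f_descX, (g i).comm]

lemma inclC_descC (g : ℤ → (X ⟶ Z)) (i : ℤ) : inclC i X ≫ descC g = g i := by
  ext1 n
  exact inclC_f_descX _ i

/-- A homotopy on `X[t, t⁻¹]` is given by its restrictions to the summands. -/
def homotopyDesc {g : (resC R).obj ((extC R).obj X) ⟶ Z} (h : ∀ i, Homotopy (inclC i X ≫ g) 0) :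
    Homotopy g 0 where
  hom n m := descX fun i => (h i).hom n m
  zero n m hnm := resC_extC_hom_ext fun i => by
    rw [inclC_f_descX, (h i).zero n m hnm, comp_zero]
  comm n := resC_extC_hom_ext fun i => by
    have hc := (h i).comm n
    rw [dNext_eq _ (show (ComplexShape.up ℤ).Rel n (n + 1) from rfl),
      prevD_eq _ (show (ComplexShape.up ℤ).Rel (n - 1) n from sub_add_cancel n 1)] at hc ⊢
    rw [HomologicalComplex.comp_f] at hc
    rw [hc, Preadditive.comp_add, Preadditive.comp_add, reassoc_of% inclC_f_descX,
      HomologicalComplex.Hom.comm_assoc, inclC_f_descX]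
    simp

/-- The inclusion of the summand of index `0` is the unit of the adjunction; this is one of the
triangle identities. -/
lemma map_powIncl_zero_counit {N : ModuleCat.{w} R} {L : ModuleCat.{w} R[T;T⁻¹]}
    (f : (extMod R).obj N ⟶ L) :
    (extMod R).map ((powIncl R 0).app N ≫ (resMod R).map f) ≫ (extResAdj R).counit.app L = f := by
  have h : (powIncl R 0).app N = (extResAdj R).unit.app N := by
    ext x
    exact (powIncl_apply 0 x).trans (by rw [T_zero]; rfl)
  have h' : (powIncl R 0).app N ≫ (resMod R).map f = (extResAdj R).homEquiv N L f := by
    rw [Adjunction.homEquiv_unit, h]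
  refine (congrArg (fun z => (extMod R).map z ≫ (extResAdj R).counit.app L) h').trans ?_
  exact ((extResAdj R).homEquiv_counit N L _).symm.trans (Equiv.symm_apply_apply _ f)

section
open CochainComplex

/-- The complexes `X[t, t⁻¹]`, for `X` K-projective, are K-projective. -/
instance [X.IsKProjective] : ((extC R).obj X).IsKProjective where
  nonempty_homotopy_zero {L} f hL := by
    have hL' : ((resC R).obj L).Acyclic := fun n => ShortComplex.Exact.map (hL n) (resMod R)
    obtain ⟨h⟩ := IsKProjective.nonempty_homotopy_zero (inclC 0 X ≫ (resC R).map f) hL'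
    let c : (extC R).obj ((resC R).obj L) ⟶ L :=
      { f n := (extResAdj R).counit.app (L.X n)
        comm' n m _ := ((extResAdj R).counit.naturality (L.d n m)).symm }
    have hf : (extC R).map (inclC 0 X ≫ (resC R).map f) ≫ c = f := by
      ext1 n
      exact map_powIncl_zero_counit (f.f n)
    rw [← hf]
    exact ⟨(((extMod R).mapHomotopy h).compRight c).trans (.ofEq (by simp))⟩

/-- The mapping cone of a morphism of K-projective complexes is K-projective. -/
lemma isKProjective_mappingCone {A : Type*} [Category* A] [Abelian A] {K L : CochainComplex A ℤ}
    [K.IsKProjective] [L.IsKProjective] (f : K ⟶ L) : (mappingCone f).IsKProjective := by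
  rw [isKProjective_iff_leftOrthogonal]
  exact ObjectProperty.ext_of_isTriangulatedClosed₃ _ _
    (HomotopyCategory.mappingCone_triangleh_distinguished f)
    (IsKProjective.leftOrthogonal K) (IsKProjective.leftOrthogonal L)

end

/-- The canonical morphism from `X` to the base change of `X[t, t⁻¹]` along `t ↦ 1`. -/
def toAugExtC (X : CochainComplex (ModuleCat.{w} R) ℤ) : X ⟶ (extAug R).obj ((extC R).obj X) :=
  inclC 0 X ≫ (unitAug R).app ((extC R).obj X)

instance : IsIso (toAugExtC X) := by
  have (n : ℤ) : IsIso ((toAugExtC X).f n) :=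
    inferInstanceAs (IsIso ((toAugExt R).app (X.X n)))
  exact HomologicalComplex.Hom.isIso_of_components _

lemma toAugExtC_naturality (f : X ⟶ Y) :
    f ≫ toAugExtC Y = toAugExtC X ≫ (extAug R).map ((extC R).map f) := by
  rw [toAugExtC, ← assoc, inclC_naturality, assoc, (unitAug R).naturality, toAugExtC, assoc]

/-- The base change of multiplication by `t` along `t ↦ 1` is the identity. -/
lemma extAug_tMul (M : CochainComplex (ModuleCat.{w} R[T;T⁻¹]) ℤ) :
    (extAug R).map (tMul R M) = 𝟙 _ := by
  ext1 n
  refine ModuleCat.ExtendScalars.hom_ext fun (m : M.X n) => ?_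
  have := unitAugMod_smul (T 1) m
  rw [aug_T, one_smul] at this
  exact this
end WeakTannaka

/-! ### Derived base change along `t ↦ 1` -/

namespace WeakTannaka
open Pretriangulated

/-- Every sequence indexed by `ℤ` is the difference sequence of a sequence `s` with `s 0 = 0`. -/
lemma exists_int_primitive {G : Type*} [AddCommGroup G] (a : ℤ → G) :
    ∃ s : ℤ → G, s 0 = 0 ∧ ∀ i, s (i + 1) = s i + a i := by
  refine ⟨fun n => ∑ k ∈ Finset.range n.toNat, a k -
    ∑ k ∈ Finset.range (-n).toNat, a (-(k + 1 : ℤ)), by simp, fun i => ?_⟩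
  obtain ⟨n, rfl | rfl⟩ : ∃ n : ℕ, i = n ∨ i = -(n + 1 : ℤ) := by
    rcases i with n | n
    · exact ⟨n, Or.inl rfl⟩
    · exact ⟨n, Or.inr (by rw [Int.negSucc_eq])⟩
  · have h₁ : ((n : ℤ) + 1).toNat = n + 1 := by omega
    have h₂ : (-((n : ℤ) + 1)).toNat = 0 := by omega
    have h₃ : (-(n : ℤ)).toNat = 0 := by omega
    simp only [h₁, h₂, h₃, Finset.sum_range_succ, Finset.range_zero, Finset.sum_empty, sub_zero,
      Int.toNat_natCast]
  · have h₁ : (-(n + 1 : ℤ) + 1).toNat = 0 := by omega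
    have h₂ : (-(-(n + 1 : ℤ) + 1)).toNat = n := by omega
    have h₃ : (-(n + 1 : ℤ)).toNat = 0 := by omega
    have h₄ : (-(-(n + 1 : ℤ))).toNat = n + 1 := by omega
    simp only [h₁, h₂, h₃, h₄, Finset.sum_range_succ, Finset.range_zero, Finset.sum_empty]
    abel

/-- If `Y` is the direct sum of copies of `X` indexed by `ℤ`, with inclusions `ι i`, and `f` is an
automorphism of `X`, then the cone of the endomorphism of `Y` which is `ι (i + 1) - f ≫ ι i` on the
summand of index `i` is isomorphic to `X`: the endomorphism is a split monomorphism, and `f ^ i` on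
the summands defines its cokernel. -/
lemma isIso_of_laurent_triangle {T : Type u} [Category.{v} T] [Preadditive T]
    [HasZeroObject T] [HasShift T ℤ] [∀ n : ℤ, (shiftFunctor T n).Additive] [Pretriangulated T]
    {X Y Z : T} (f : X ≅ X) (ι : ℤ → (X ⟶ Y)) {d : Y ⟶ Y} {q : Y ⟶ Z} {r : Z ⟶ Y⟦(1 : ℤ)⟧}
    (hT : Triangle.mk d q r ∈ distTriang T) (hd : ∀ i, ι i ≫ d = ι (i + 1) - f.hom ≫ ι i)
    (desc : ∀ (W : T) (g : ℤ → (X ⟶ W)), ∃ k, ∀ i, ι i ≫ k = g i)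
    (ext : ∀ (W : T) (k k' : Y ⟶ W), (∀ i, ι i ≫ k = ι i ≫ k') → k = k') :
    IsIso (ι 0 ≫ q) := by
  -- `p i = f ^ i`, and `s` is the retraction `σ` of `d` on the summands: it satisfies the recursion
  -- `s (i + 1) = f ≫ s i + ι i`, which is solved by writing `s i = p i ≫ s' i`
  let p (i : ℤ) : X ≅ X := (show Aut X from f) ^ i
  have hp₀ : (p 0).hom = 𝟙 _ := rfl
  have hp (i : ℤ) : (p (i + 1)).hom = f.hom ≫ (p i).hom :=
    congrArg Iso.hom (zpow_add_one (show Aut X from f) i)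
  obtain ⟨s', hs'₀, hs'⟩ := exists_int_primitive fun i => (p (i + 1)).inv ≫ ι i
  let s (i : ℤ) : X ⟶ Y := (p i).hom ≫ s' i
  have hs₀ : s 0 = 0 := by simp only [s, hs'₀, comp_zero]
  have hs (i : ℤ) : s (i + 1) = f.hom ≫ s i + ι i := by
    simp only [s]
    rw [hs', Preadditive.comp_add, Iso.hom_inv_id_assoc, hp, assoc]
  obtain ⟨σ, hσ⟩ := desc _ s
  obtain ⟨ρ, hρ⟩ := desc _ fun i => (p i).hom
  have hdσ : d ≫ σ = 𝟙 _ := ext _ _ _ fun i => by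
    rw [← assoc, hd, Preadditive.sub_comp, assoc, hσ, hσ, hs, comp_id, add_sub_cancel_left]
  have hσd : σ ≫ d = 𝟙 _ - ρ ≫ ι 0 := by
    refine ext _ _ _ fun i => ?_
    rw [← assoc, hσ, Preadditive.comp_sub, comp_id, ← assoc, hρ]
    have step (i : ℤ) : s (i + 1) ≫ d - (ι (i + 1) - (p (i + 1)).hom ≫ ι 0) =
        f.hom ≫ (s i ≫ d - (ι i - (p i).hom ≫ ι 0)) := by
      rw [hs, Preadditive.add_comp, hd, hp]
      simp only [Preadditive.comp_sub, assoc]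
      abel
    rw [← sub_eq_zero]
    induction i using Int.induction_on with
    | zero => rw [hs₀, zero_comp, hp₀, id_comp, sub_self, sub_zero]
    | succ n hn => rw [step, hn, comp_zero]
    | pred n hn =>
      have := step (-n - 1)
      rw [sub_add_cancel, hn] at this
      rw [← cancel_epi f.hom, ← this, comp_zero]
  have hρι : ρ ≫ ι 0 = 𝟙 _ - σ ≫ d := by rw [hσd, sub_sub_cancel]
  have hdρ : d ≫ ρ = 0 := ext _ _ _ fun i => by
    rw [← assoc, hd, Preadditive.sub_comp, assoc, hρ, hρ, hp, sub_self, comp_zero]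
  obtain ⟨ρ', hρ'⟩ := Dist.desc₂ hT ρ hdρ
  have hr : r = 0 := by
    have h := Dist.comp₃₁ hT =≫ σ⟦(1 : ℤ)⟧'
    rw [assoc, ← Functor.map_comp, hdσ, zero_comp] at h
    rw [← h, (shiftFunctor T (1 : ℤ)).map_id, comp_id]
  have hdq := Dist.comp₁₂ hT
  refine ⟨ρ', ?_, ?_⟩
  · rw [assoc, hρ', hρ, hp₀]
  · obtain ⟨y, hy⟩ := Dist.lift₃ hT (𝟙 Z) (by rw [hr, comp_zero])
    have h : q ≫ ρ' ≫ ι 0 ≫ q = q := by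
      rw [reassoc_of% hρ', ← assoc, hρι, Preadditive.sub_comp,
        id_comp, assoc, hdq, comp_zero, sub_zero]
    rw [← id_comp (ρ' ≫ ι 0 ≫ q), ← hy, assoc, h]

section
open LaurentPolynomial ComplexTensor HomotopyCategory CochainComplex
variable {R : Type w} [CommRing R]

variable (R) in
/-- The quotient functor from complexes to the homotopy category. -/
abbrev quot : CochainComplex (ModuleCat.{w} R) ℤ ⥤ HomotopyCategory (ModuleCat.{w} R) (.up ℤ) :=
  HomotopyCategory.quotient _ _

/-- In the homotopy category, morphisms on `X[t, t⁻¹]` are given by their restrictions to the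
summands: existence. -/
lemma exists_quotient_desc (X : CochainComplex (ModuleCat.{w} R) ℤ)
    (W : HomotopyCategory (ModuleCat.{w} R) (.up ℤ)) (g : ℤ → ((quot R).obj X ⟶ W)) :
    ∃ k : (quot R).obj ((resC R).obj ((extC R).obj X)) ⟶ W, ∀ i, (quot R).map (inclC i X) ≫ k = g i := by
  obtain ⟨W, rfl⟩ := quotient_obj_surjective W
  choose g' hg' using fun i => (quot R).map_surjective (g i)
  refine ⟨(quot R).map (descC g'), fun i => ?_⟩
  rw [← Functor.map_comp, inclC_descC, hg']

/-- In the homotopy category, morphisms on `X[t, t⁻¹]` are given by their restrictions to the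
summands: uniqueness. -/
lemma quotient_hom_ext (X : CochainComplex (ModuleCat.{w} R) ℤ)
    (W : HomotopyCategory (ModuleCat.{w} R) (.up ℤ))
    (k k' : (quot R).obj ((resC R).obj ((extC R).obj X)) ⟶ W)
    (h : ∀ i, (quot R).map (inclC i X) ≫ k = (quot R).map (inclC i X) ≫ k') : k = k' := by
  obtain ⟨W, rfl⟩ := quotient_obj_surjective W
  rw [← sub_eq_zero]
  obtain ⟨l, hl⟩ := (quot R).map_surjective (k - k')
  rw [← hl]
  refine (eq_of_homotopy _ _ (homotopyDesc fun i => homotopyOfEq _ _ ?_)).trans (Functor.map_zero _ _ _)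
  rw [Functor.map_comp, hl, Preadditive.comp_sub, h, sub_self, Functor.map_zero]

variable {X : CochainComplex (ModuleCat.{w} R) ℤ} (f : X ⟶ X)

/-- The complex of `R[t, t⁻¹]`-modules given by a complex `X` of `R`-modules with an endomorphism
`f`: the mapping cone of `t - f` on `X[t, t⁻¹]`. -/
abbrev laurentCone : CochainComplex (ModuleCat.{w} R[T;T⁻¹]) ℤ :=
  mappingCone (tMul R ((extC R).obj X) - (extC R).map f)

/-- The morphism from `X` to the cone of `t - f` on `X[t, t⁻¹]`. -/
def toLaurentCone : X ⟶ (resC R).obj (laurentCone f) :=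
  inclC 0 X ≫ (resC R).map (mappingCone.inr _)

/-- Additive functors of modules preserve mapping cones. -/
lemma exists_distinguished_map {A B : Type w} [CommRing A] [CommRing B]
    (G : ModuleCat.{w} A ⥤ ModuleCat.{w} B) [G.Additive]
    {K L : CochainComplex (ModuleCat.{w} A) ℤ} (u : K ⟶ L) :
    ∃ r, Triangle.mk ((quot B).map ((G.mapHomologicalComplex _).map u))
      ((quot B).map ((G.mapHomologicalComplex _).map (mappingCone.inr u))) r ∈
        distTriang (HomotopyCategory (ModuleCat.{w} B) (.up ℤ)) :=
  ⟨_, (G.mapHomotopyCategory (.up ℤ)).map_distinguished _ (mappingCone_triangleh_distinguished u)⟩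

/-- As a complex of `R`-modules, the cone of `t - f` on `X[t, t⁻¹]` is homotopy equivalent to `X`, if
`f` is a homotopy equivalence. -/
lemma isIso_toLaurentCone [IsIso ((quot R).map f)] : IsIso ((quot R).map (toLaurentCone f)) := by
  obtain ⟨r, hT⟩ := exists_distinguished_map (resMod R) (tMul R ((extC R).obj X) - (extC R).map f)
  rw [toLaurentCone, Functor.map_comp]
  refine isIso_of_laurent_triangle (asIso ((quot R).map f)) (fun i => (quot R).map (inclC i X)) hT
    (fun i => ?_) (exists_quotient_desc X) (quotient_hom_ext X)
  rw [asIso_hom, ← Functor.map_comp, ← Functor.map_comp, ← Functor.map_sub, inclC_naturality,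
    Functor.map_sub, Preadditive.comp_sub, inclC_tMul]

/-- The equivalence of `X` with the cone of `t - f` carries `f` to multiplication by `t`. -/
lemma map_comp_toLaurentCone : (quot R).map f ≫ (quot R).map (toLaurentCone f) =
    (quot R).map (toLaurentCone f) ≫ (quot R).map ((resC R).map (tMul R (laurentCone f))) := by
  obtain ⟨r, hT⟩ := exists_distinguished_map (resMod R) (tMul R ((extC R).obj X) - (extC R).map f)
  have h := Dist.comp₁₂ hT
  rw [Functor.map_sub, Functor.map_sub, Preadditive.sub_comp, sub_eq_zero] at h
  rw [← Functor.map_comp, ← Functor.map_comp, toLaurentCone, assoc, ← Functor.map_comp,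
    tMul_naturality, ← assoc, inclC_naturality, assoc, Functor.map_comp (resC R)]
  rw [Functor.map_comp, Functor.map_comp, Functor.map_comp, Functor.map_comp, h]

lemma toLaurentCone_unitAug : toLaurentCone f ≫ (unitAug R).app (laurentCone f) =
    toAugExtC X ≫ (extAug R).map (mappingCone.inr _) := by
  rw [toLaurentCone, assoc, (unitAug R).naturality, toAugExtC, assoc]

/-- The base change along `t ↦ 1` of the cone of `t - f` is the cone of `1 - f`. -/
lemma exists_distinguished_extAug : ∃ r, Triangle.mk (𝟙 _ - (quot R).map f)
    ((quot R).map (toLaurentCone f ≫ (unitAug R).app (laurentCone f))) r ∈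
      distTriang (HomotopyCategory (ModuleCat.{w} R) (.up ℤ)) := by
  obtain ⟨r, hT⟩ := exists_distinguished_map (augMod R) (tMul R ((extC R).obj X) - (extC R).map f)
  let e := (quot R).mapIso (asIso (toAugExtC X))
  refine ⟨r ≫ e.inv⟦(1 : ℤ)⟧', isomorphic_distinguished _ hT _
    (Triangle.isoMk _ _ e e (Iso.refl _) ?_ ?_ ?_)⟩
  · change (𝟙 _ - (quot R).map f) ≫ (quot R).map (toAugExtC X) =
      (quot R).map (toAugExtC X) ≫ (quot R).map ((extAug R).map _)
    rw [Functor.map_sub, extAug_tMul, Functor.map_sub, CategoryTheory.Functor.map_id, Preadditive.sub_comp,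
      Preadditive.comp_sub, id_comp, comp_id, ← Functor.map_comp, toAugExtC_naturality,
      Functor.map_comp]
  · change (quot R).map _ ≫ 𝟙 _ = (quot R).map (toAugExtC X) ≫ (quot R).map ((extAug R).map _)
    rw [comp_id, toLaurentCone_unitAug, Functor.map_comp]
  · change (r ≫ e.inv⟦(1 : ℤ)⟧') ≫ e.hom⟦(1 : ℤ)⟧' = 𝟙 _ ≫ r
    rw [assoc, ← Functor.map_comp, Iso.inv_hom_id, CategoryTheory.Functor.map_id, comp_id, id_comp]

/-- An object of the homotopy category of complexes which is the cone of `τ⁻¹ - 1` is the derived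
base change along `t ↦ 1` of a complex on which `t` acts by `τ`. -/
lemma exists_laurent_model [X.IsKProjective] (τ : (quot R).obj X ≅ (quot R).obj X)
    {K : HomotopyCategory (ModuleCat.{w} R) (.up ℤ)} (φ : (quot R).obj X ⟶ K)
    (r : K ⟶ ((quot R).obj X)⟦(1 : ℤ)⟧) (hT : Triangle.mk (τ.inv - 𝟙 _) φ r ∈ distTriang _) :
    ∃ (M : CochainComplex (ModuleCat.{w} R[T;T⁻¹]) ℤ) (_ : M.IsKProjective)
      (e : (quot R).obj X ⟶ (quot R).obj ((resC R).obj M)) (ψ : K ⟶ (quot R).obj ((extAug R).obj M)),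
      IsIso e ∧ IsIso ψ ∧ τ.hom ≫ e = e ≫ (quot R).map ((resC R).map (tMul R M)) ∧
        φ ≫ ψ = e ≫ (quot R).map ((unitAug R).app M) := by
  obtain ⟨f, hf⟩ := (quot R).map_surjective τ.hom
  have : IsIso ((quot R).map f) := by
    rw [hf]
    infer_instance
  obtain ⟨r', hT'⟩ := exists_distinguished_extAug f
  -- `τ⁻¹ - 1 = τ⁻¹ ≫ (1 - τ)`, so that the cones of `τ⁻¹ - 1` and `1 - τ` are isomorphic
  have hτ : (τ.inv - 𝟙 _) ≫ 𝟙 _ = τ.inv ≫ (𝟙 _ - (quot R).map f) := by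
    rw [hf, comp_id, Preadditive.comp_sub, τ.inv_hom_id, comp_id]
  obtain ⟨ψ, hψ, hψ'⟩ := complete_distinguished_triangle_morphism _ _ hT hT' τ.inv (𝟙 _) hτ
  have : IsIso ψ := isIso₃_of_isIso₁₂ (Triangle.homMk (Triangle.mk (τ.inv - 𝟙 _) φ r)
      (Triangle.mk (𝟙 _ - (quot R).map f) _ r') τ.inv (𝟙 _) ψ hτ hψ hψ') hT hT'
      (inferInstanceAs (IsIso τ.inv)) (inferInstanceAs (IsIso (𝟙 _)))
  refine ⟨laurentCone f, isKProjective_mappingCone _, (quot R).map (toLaurentCone f), ψ,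
    isIso_toLaurentCone f, this, ?_, ?_⟩
  · rw [← hf]
    exact map_comp_toLaurentCone f
  · rw [← Functor.map_comp]
    exact hψ.trans (id_comp _)

/-- If `H'` is the cone of `τ⁻¹ - 1`, then `H'` is the derived base change of `H` along `t ↦ 1`,
where `t` acts on `H` by `τ`. -/
theorem IsDerivedBaseChange.of_distinguished {H H' : DR R} (τ : H ≅ H) (φ : H ⟶ H')
    (r : H' ⟶ H⟦(1 : ℤ)⟧) (hT : Triangle.mk (τ.inv - 𝟙 H) φ r ∈ distTriang (DR R)) :
    IsDerivedBaseChange τ.hom φ := by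
  have hK : CochainComplex.IsKProjective (H.obj.as : CochainComplex (ModuleCat.{w} R) ℤ) :=
    (kproj_iff _).1 H.property
  obtain ⟨M, hM, e, ψ, he, hψ, h₁, h₂⟩ := exists_laurent_model (X := H.obj.as) ((kproj R).ι.mapIso τ)
    φ.hom _ ((kproj R).ι.map_distinguished _ hT)
  exact ⟨M, hM, e, ψ, MorphismProperty.of_isIso _ _, MorphismProperty.of_isIso _ _, h₁, h₂⟩

end
end WeakTannaka

end

theorem proposition7p1 {R : Type w} [CommRing R]
    {C : Type u₁} [Category.{w} C] [Preadditive C] [HasZeroObject C] [HasShift C ℤ]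
    [∀ n : ℤ, (shiftFunctor C n).Additive] [Pretriangulated C] [IsTriangulated C]
    [MonoidalCategory C] [SymmetricCategory C] [MonoidalPreadditive C] [TensorExact C]
    [HasCoproducts.{w} C]
    {C' : Type u₂} [Category.{w} C'] [Preadditive C'] [HasZeroObject C'] [HasShift C' ℤ]
    [∀ n : ℤ, (shiftFunctor C' n).Additive] [Pretriangulated C'] [IsTriangulated C']
    [MonoidalCategory C'] [SymmetricCategory C'] [MonoidalPreadditive C'] [TensorExact C']
    [HasCoproducts.{w} C']
    {O : C} (P : TensorPowers O)
    (F : C ⥤ C') [F.CommShift ℤ] [F.IsTriangulated] [F.Braided]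
    (ω' : C' ⥤ DR R) [ω'.CommShift ℤ] [ω'.IsTriangulated] [ω'.Braided]
    (A : WeakTannakian (F ⋙ ω')) (A' : WeakTannakian ω') (σ : SectionCompat A A')
    (hω' : PreservesSums.{w} ω')
    (hF : PreservesSums.{w} F) (G : C' ⥤ C) (adj : F ⊣ G) (hG : PreservesSums.{w} G)
    {I : Type w} (g : I → C) (hg : ∀ i, IsCompactObject (g i)) (hgen : IsGenerating g)
    (hgen' : IsGenerating (fun i => F.obj (g i)))
    (E : OrbitFactorization P F)
    (hE : ∀ i j, Function.Bijective (E.mapHom : ((Orbit.π P).obj (g i) ⟶ (Orbit.π P).obj (g j)) → _)) :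
    ∃ (h : HopfObj A.hopf) (h' : HopfObj A'.hopf),
      A.IsHopfStructure h ∧ A'.IsHopfStructure h' ∧
      (groupLike A E.objIso ≫ h.comul = (λ_ _).inv ≫ (groupLike A E.objIso ⊗ₘ groupLike A E.objIso) ∧
        groupLike A E.objIso ≫ h.counit = 𝟙 _) ∧
      IsBimonHom (inducedHom A A') ∧
      IsDerivedBaseChange (mulLeft (groupLike A E.objIso)) (inducedHom A A') := by
  obtain ⟨r, hT⟩ := E.exists_distinguished A A' g hgen'
    (E.bijective_mapAddHom adj hF hG g hg hgen hE)
  have h : ω'.map ((twistIso A E.objIso).inv - 𝟙 (F.obj A.alg)) =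
      (ω'.mapIso (twistIso A E.objIso)).inv - 𝟙 _ := by
    rw [ω'.map_sub, ω'.map_id]
    rfl
  refine ⟨A.hopfObj, A'.hopfObj, A.isHopfStructure_hopfObj, A'.isHopfStructure_hopfObj,
    ⟨groupLike_comul A E.objIso, groupLike_counit A E.objIso⟩, isBimonHom_inducedHom A A' σ, ?_⟩
  -- multiplication by the group-like element is the image under `ω'` of the automorphism of
  -- `F (right 𝟙)` that occurs in the distinguished triangle
  rw [← map_twistIso_hom A E.objIso]
  refine IsDerivedBaseChange.of_distinguished (ω'.mapIso (twistIso A E.objIso)) (inducedHom A A')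
    (ω'.map r ≫ (ω'.commShiftIso (1 : ℤ)).hom.app _) ?_
  rw [← h]
  exact ω'.map_distinguished _ hT
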